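/- Let $q_{AB}$ be the metric of the unit sphere $S^2$ and $D_A$ its covariant derivative; indices of tensors on $S^2$ are raised and lowered with $q$. Let $I\subset\mathbb R$ be a non-empty open interval and $r_0>0$. On the region $u\in I$, $r>r_0$, $x\in S^2$ let $$g=e^{2\beta}\frac Vr\,du\otimes du+e^{2\beta}(du\otimes dr+dr\otimes du)-r^2h_{AB}(dx^A-U^Adu)\otimes(dx^B-U^Bdu)$$ be a Bondi–Sachs metric: $h_{AB}$ is a Riemannian metric on the spheres $u,r=\mathrm{const}$ with $\det h_{AB}=\det q_{AB}$, and $\beta$, $V/r$, $U^A$, $h_{AB}$ can be expanded in powers of $r^{-1}$, meaning that as functions of $(u,1/r,x)$ they extend smoothly across $1/r=0$. Suppose that $g$ is asymptotically flat: there are a mass aspect $M(u,x)$ and a symmetric tensor $c_{AB}(u,x)$ with, as $r\to\infty$, $$V=r-2M+O(r^{-1}),\quad h_{AB}=q_{AB}+\frac{c_{AB}}r+O(r^{-2}),\quad \beta=-\frac{c^{AB}c_{AB}}{32r^2}+O(r^{-3}),\quad U^A=-\frac{D_Bc^{AB}}{2r^2}+O(r^{-3}).$$ Call a smooth vector field $\xi$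 on the region an asymptotic Killing vector if $\delta g_{ab}=-\nabla_a\xi_b-\nabla_b\xi_a$ (that is, $\delta g=-\mathcal L_\xi g$) satisfies the gauge conditions $\delta g_{rr}=0$, $\delta g_{rA}=0$, $g^{AB}\delta g_{AB}=0$ and, as $r\to\infty$, the fall-off conditions $\delta g_{uu}=O(r^{-1})$, $\delta g_{uA}=O(1)$, $\delta g_{ur}=O(r^{-2})$, $\delta g_{AB}=O(r)$. (All $O$'s are along each ray, i.e. for fixed $u$ and $x$.) A conformal Killing vector of $S^2$ is a smooth vector field $f^A$ on $S^2$ with $D_Af_B+D_Bf_A=q_{AB}D_Cf^C$. 1. For every asymptotic Killing vector $\xi$ there are a smooth function $\alpha$ on $S^2$ and a conformal Killing vector $f^A$ of $S^2$ such that, as $r\to\infty$, $\xi$ has the form $$\Big[\alpha+\frac u2D_Af^A\Big]\partial_u+f^A\partial_A .$$ In detail, with $F=\alpha+\frac u2D_Af^A$: $\xi^u=F$ (for all $r>r_0$), $\xi^A=f^A-\frac1rD^AF+O(r^{-2})$ and $\xi^r=-\frac r2D_Cf^C+\frac12D_CD^CF+O(r^{-1})$. 2. Conversely, every smooth function $\alpha$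 on $S^2$ and every conformal Killing vector $f^A$ of $S^2$ arise in this way from some asymptotic Killing vector $\xi$. 3. Call a map $(u,x)\mapsto(K(x)[u+a(x)],\varphi(x))$ of $\mathbb R\times S^2$ a BMS transformation if $\varphi$ is a conformal diffeomorphism of $S^2$ with smooth factor $K>0$, i.e. $\varphi^*q=K^2q$, and $a$ is a smooth function on $S^2$. For all $\alpha$, $f^A$ as above the vector field $[\alpha+\frac u2D_Af^A]\partial_u+f^A\partial_A$ on $\mathbb R\times S^2$ is complete and its flow is a smooth one-parameter group of BMS transformations $u'=K_t[u+a_t]$, $x'=\varphi_t(x)$, with $$K_t(x)^2=\exp\int_0^tD_Af^A(\varphi_s(x))\,ds,\qquad a_t(x)=\int_0^t\frac{\alpha(\varphi_s(x))}{K_s(x)}\,ds .$$ Conversely, every smooth one-parameter group of BMS transformations is the flow of such a vector field. -/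

import Mathlib

open scoped ContDiff Topology
open Asymptotics Filter

namespace BondiSachs

noncomputable section

/-- Euclidean 3-space. The unit 2-sphere `S²` is the set of its unit vectors `x`, and the tangent
space of `S²` at `x` is the orthogonal complement of `x`. Functions, vector fields and tensor
fields on `S²` are written as functions on `E3`; only their values at unit vectors matter. -/
abbrev E3 := EuclideanSpace ℝ (Fin 3)

/-- Bilinear forms on `E3`. A covariant 2-tensor on the tangent space `x^⊥` of `S²` at `x` is
represented by the bilinear form on `E3` which restricts to it and vanishes on the normal `x`. -/
abbrev Form3 := LinearMap.BilinForm ℝ E3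

/-- `v` is tangent to `S²` at `x`. -/
def Tangent (x v : E3) : Prop := inner ℝ x v = 0

/-- The orthogonal projection onto the tangent space of `S²` at the unit vector `x`. -/
def tanProj (x : E3) : E3 →L[ℝ] E3 :=
  ContinuousLinearMap.id ℝ E3 - (innerSL ℝ x).smulRight x

/-! ### Calculus on the unit sphere -/

section Sphere

variable {G : Type*} [NormedAddCommGroup G] [NormedSpace ℝ G]

/-- The extension of a function on `S²` to `E3 ∖ {0}` which is constant along rays. -/
def radExt (F : E3 → G) (y : E3) : G := F (‖y‖⁻¹ • y)

/-- `F` is a smooth function on `S²`. -/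
def SmoothOnSphere (F : E3 → G) : Prop := ContDiffOn ℝ ∞ (radExt F) {0}ᶜ

/-- The differential at `x ∈ S²` of a function on `S²`; it is used on tangent vectors
(and vanishes on the normal `x`). -/
def sphD (F : E3 → G) (x : E3) : E3 →L[ℝ] G := fderiv ℝ (radExt F) x

end Sphere

/-- `f` is a smooth vector field on `S²`. -/
def IsSphereField (f : E3 → E3) : Prop :=
  SmoothOnSphere f ∧ ∀ x : E3, ‖x‖ = 1 → Tangent x (f x)

/-- The gradient `D^A F` on the unit sphere. -/
def sphGrad (F : E3 → ℝ) (x : E3) : E3 := gradient (radExt F) x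

/-- The divergence `D_A f^A` on the unit sphere (the trace of the differential of the vector
field; the normal direction does not contribute). -/
def sphDiv (f : E3 → E3) (x : E3) : ℝ :=
  ∑ i : Fin 3, (sphD f x (EuclideanSpace.single i 1)) i

/-- The metric `q` of the unit sphere at `x`. -/
def qForm (x : E3) : Form3 :=
  (innerₗ E3).compl₁₂ (tanProj x : E3 →ₗ[ℝ] E3) (tanProj x : E3 →ₗ[ℝ] E3)

/-- The divergence `D^B c_{AB}` of a symmetric 2-tensor field on the unit sphere, as a covector;
it is used on tangent vectors. -/
def sphDivForm (c : E3 → Form3) (x w : E3) : ℝ :=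
  ∑ i : Fin 3, sphD (fun y => c y (EuclideanSpace.single i 1) w) x (EuclideanSpace.single i 1)

/-- The square `c^{AB} c_{AB}`, indices being raised with the metric of the unit sphere. -/
def formSq (c : Form3) : ℝ :=
  ∑ i : Fin 3, ∑ j : Fin 3, (c (EuclideanSpace.single i 1) (EuclideanSpace.single j 1)) ^ 2

/-- `f` is a conformal Killing vector field of the unit sphere:
`D_A f_B + D_B f_A = (D_C f^C) q_{AB}`. (The covariant derivative is the tangential part of the
derivative in `E3`, so that the projection can be left out inside an inner product with a
tangent vector.) -/
def IsConformalKilling (f : E3 → E3) : Prop :=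
  IsSphereField f ∧ ∀ x : E3, ‖x‖ = 1 → ∀ v w : E3, Tangent x v → Tangent x w →
    inner ℝ (sphD f x v) w + inner ℝ v (sphD f x w) = sphDiv f x * inner ℝ v w

/-! ### Bondi–Sachs metrics -/

/-- The space-time region is the open subset `u ∈ I`, `‖y‖ > r₀` of `ℝ × E3`; the Bondi–Sachs
coordinates of the point `(u, y)` are the retarded time `u`, the radius `r = ‖y‖` and the
direction `x = y / ‖y‖ ∈ S²`. -/
abbrev Spacetime := ℝ × E3

/-- The function `F` of `(u, r, x)` can be expanded in powers of `r⁻¹`, uniformly with all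
derivatives: as a function of `(u, 1/r, x)` it extends smoothly across `1/r = 0`. -/
def ExpandsInInverseRadius {G : Type*} [NormedAddCommGroup G] [NormedSpace ℝ G]
    (I : Set ℝ) (r₀ : ℝ) (F : ℝ → ℝ → E3 → G) : Prop :=
  ∃ Fhat : ℝ × ℝ × E3 → G,
    ContDiffOn ℝ ∞ Fhat (I ×ˢ Set.Iio (1 / r₀) ×ˢ {0}ᶜ) ∧
    ∀ u ∈ I, ∀ r : ℝ, r₀ < r → ∀ y : E3, y ≠ 0 → F u r (‖y‖⁻¹ • y) = Fhat (u, 1 / r, y)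

/-- The metric functions of a Bondi–Sachs metric, as functions of `(u, r, x)`. -/
structure MetricData where
  I : Set ℝ
  r₀ : ℝ
  β : ℝ → ℝ → E3 → ℝ
  V : ℝ → ℝ → E3 → ℝ
  U : ℝ → ℝ → E3 → E3
  h : ℝ → ℝ → E3 → Form3

namespace MetricData

variable (S : MetricData)

/-- The space-time region `u ∈ I`, `r > r₀`. -/
def region : Set Spacetime := {p | p.1 ∈ S.I ∧ S.r₀ < ‖p.2‖}

/-- The coordinate ranges are `u ∈ I` for a non-empty open interval `I`, `r > r₀ > 0`, `x ∈ S²`;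
`U` is tangent to the spheres; `h` is a Riemannian metric on them with `det h = det q`; the
metric functions can be expanded in powers of `r⁻¹`. -/
structure IsBondiSachs : Prop where
  isOpen_I : IsOpen S.I
  ordConnected_I : S.I.OrdConnected
  nonempty_I : S.I.Nonempty
  r₀_pos : 0 < S.r₀
  U_tangent : ∀ u ∈ S.I, ∀ r : ℝ, S.r₀ < r → ∀ x : E3, ‖x‖ = 1 → Tangent x (S.U u r x)
  h_symm : ∀ u ∈ S.I, ∀ r : ℝ, S.r₀ < r → ∀ x : E3, ‖x‖ = 1 →
    ∀ v w : E3, S.h u r x v w = S.h u r x w v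
  h_normal : ∀ u ∈ S.I, ∀ r : ℝ, S.r₀ < r → ∀ x : E3, ‖x‖ = 1 → ∀ w : E3, S.h u r x x w = 0
  h_pos : ∀ u ∈ S.I, ∀ r : ℝ, S.r₀ < r → ∀ x : E3, ‖x‖ = 1 →
    ∀ v : E3, Tangent x v → v ≠ 0 → 0 < S.h u r x v v
  h_det : ∀ u ∈ S.I, ∀ r : ℝ, S.r₀ < r → ∀ x : E3, ‖x‖ = 1 →
    ∀ e : Fin 2 → E3, Orthonormal ℝ e → (∀ a, Tangent x (e a)) →
      (Matrix.of fun a b => S.h u r x (e a) (e b)).det = 1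
  β_expands : ExpandsInInverseRadius S.I S.r₀ S.β
  V_expands : ExpandsInInverseRadius S.I S.r₀ (fun u r x => S.V u r x / r)
  U_expands : ExpandsInInverseRadius S.I S.r₀ S.U
  h_expands : ∀ v w : E3, ExpandsInInverseRadius S.I S.r₀ (fun u r x => S.h u r x v w)

/-- The boundary conditions of an asymptotically flat metric, with mass aspect `M` and shear `c`:
`V = r - 2M + O(r⁻¹)`, `h_{AB} = q_{AB} + c_{AB}/r + O(r⁻²)`,
`β = - c^{AB} c_{AB} / (32 r²) + O(r⁻³)`, `U^A = - D_B c^{AB} / (2 r²) + O(r⁻³)`. -/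
def IsAsymptoticallyFlat : Prop :=
  ∃ (M : ℝ → E3 → ℝ) (c : ℝ → E3 → Form3), ∀ u ∈ S.I, ∀ x : E3, ‖x‖ = 1 →
    ((fun r : ℝ => S.V u r x - (r - 2 * M u x)) =O[atTop] fun r : ℝ => r⁻¹) ∧
    (∀ v w : E3, (fun r : ℝ => S.h u r x v w - (qForm x v w + c u x v w / r))
      =O[atTop] fun r : ℝ => (r ^ 2)⁻¹) ∧
    ((fun r : ℝ => S.β u r x + formSq (c u x) / (32 * r ^ 2))
      =O[atTop] fun r : ℝ => (r ^ 3)⁻¹) ∧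
    ∀ w : E3, Tangent x w →
      ((fun r : ℝ => inner ℝ (S.U u r x) w + sphDivForm (c u) x w / (2 * r ^ 2))
        =O[atTop] fun r : ℝ => (r ^ 3)⁻¹)

end MetricData

/-- The 1-form `du`. -/
def du : Spacetime →L[ℝ] ℝ := ContinuousLinearMap.fst ℝ ℝ E3

/-- The 1-form `dr` at a point with spatial part `y`. -/
def dr (y : E3) : Spacetime →L[ℝ] ℝ :=
  (innerSL ℝ (‖y‖⁻¹ • y)).comp (ContinuousLinearMap.snd ℝ ℝ E3)

/-- The differential `dx^A` of the direction `x = y / ‖y‖`, with values in the tangent space of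
`S²` at `x`. -/
def dx (y : E3) : Spacetime →L[ℝ] E3 :=
  ‖y‖⁻¹ • (tanProj (‖y‖⁻¹ • y)).comp (ContinuousLinearMap.snd ℝ ℝ E3)

/-- The Bondi–Sachs metric
`g = e^{2β} (V/r) du⊗du + e^{2β} (du⊗dr + dr⊗du) - r² h_{AB} (dx^A - U^A du)⊗(dx^B - U^B du)`. -/
def MetricData.metric (S : MetricData) (p v w : Spacetime) : ℝ :=
  let r : ℝ := ‖p.2‖
  let x : E3 := ‖p.2‖⁻¹ • p.2
  let β : ℝ := S.β p.1 r x
  let V : ℝ := S.V p.1 r x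
  let U : E3 := S.U p.1 r x
  Real.exp (2 * β) * (V / r) * (du v * du w)
    + Real.exp (2 * β) * (du v * dr p.2 w + dr p.2 v * du w)
    - r ^ 2 * S.h p.1 r x (dx p.2 v - du v • U) (dx p.2 w - du w • U)

/-- The variation `δg = - L_ξ g` of a metric `g` (that is `δg_{ab} = - ∇_a ξ_b - ∇_b ξ_a`), with
the Lie derivative `ξ^c ∂_c g_{ab} + g_{cb} ∂_a ξ^c + g_{ac} ∂_b ξ^c`, evaluated at `p` on the
constant vectors `v`, `w`. -/
def variation (g : Spacetime → Spacetime → Spacetime → ℝ) (ξ : Spacetime → Spacetime)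
    (p v w : Spacetime) : ℝ :=
  -(fderiv ℝ (fun p' => g p' v w) p (ξ p) + g p (fderiv ℝ ξ p v) w + g p v (fderiv ℝ ξ p w))

/-- The point with Bondi–Sachs coordinates `(u, r, x)`. -/
def pt (u r : ℝ) (x : E3) : Spacetime := (u, r • x)

/-- The coordinate vector `∂_u`. -/
def partialU : Spacetime := (1, 0)

/-- The coordinate vector `∂_r` at `(u, r, x)`. -/
def partialR (x : E3) : Spacetime := (0, x)

/-- The coordinate vector `e^A ∂_A` at `(u, r, x)`, for `e` tangent to `S²` at `x`. -/
def partialAng (r : ℝ) (e : E3) : Spacetime := (0, r • e)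

/-- The smooth vector field `ξ` on the space-time region preserves the Bondi–Sachs gauge,
`δg_{rr} = 0`, `δg_{rA} = 0`, `g^{AB} δg_{AB} = 0`, and the fall-off conditions
`δg_{uu} = O(r⁻¹)`, `δg_{uA} = O(1)`, `δg_{ur} = O(r⁻²)`, `δg_{AB} = O(r)` as `r → ∞`.
(The angular block `g^{AB}` of the inverse of a Bondi–Sachs metric is the inverse of the
matrix `g_{AB}`, since `g_{rA} = 0` and `g^{uA} = 0`.) -/
structure IsAsymptoticKilling (S : MetricData) (ξ : Spacetime → Spacetime) : Prop where
  smooth : ContDiffOn ℝ ∞ ξ S.region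
  gauge_rr : ∀ u ∈ S.I, ∀ r : ℝ, S.r₀ < r → ∀ x : E3, ‖x‖ = 1 →
    variation S.metric ξ (pt u r x) (partialR x) (partialR x) = 0
  gauge_rA : ∀ u ∈ S.I, ∀ r : ℝ, S.r₀ < r → ∀ x : E3, ‖x‖ = 1 → ∀ e : E3, Tangent x e →
    variation S.metric ξ (pt u r x) (partialR x) (partialAng r e) = 0
  gauge_trace : ∀ u ∈ S.I, ∀ r : ℝ, S.r₀ < r → ∀ x : E3, ‖x‖ = 1 →
    ∀ e : Fin 2 → E3, LinearIndependent ℝ e → (∀ a, Tangent x (e a)) →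
      ∑ a, ∑ b, (Matrix.of fun a b =>
          S.metric (pt u r x) (partialAng r (e a)) (partialAng r (e b)))⁻¹ a b *
        variation S.metric ξ (pt u r x) (partialAng r (e a)) (partialAng r (e b)) = 0
  falloff_uu : ∀ u ∈ S.I, ∀ x : E3, ‖x‖ = 1 →
    (fun r : ℝ => variation S.metric ξ (pt u r x) partialU partialU)
      =O[atTop] fun r : ℝ => r⁻¹
  falloff_uA : ∀ u ∈ S.I, ∀ x : E3, ‖x‖ = 1 → ∀ e : E3, Tangent x e →
    (fun r : ℝ => variation S.metric ξ (pt u r x) partialU (partialAng r e))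
      =O[atTop] fun _ : ℝ => (1 : ℝ)
  falloff_ur : ∀ u ∈ S.I, ∀ x : E3, ‖x‖ = 1 →
    (fun r : ℝ => variation S.metric ξ (pt u r x) partialU (partialR x))
      =O[atTop] fun r : ℝ => (r ^ 2)⁻¹
  falloff_AB : ∀ u ∈ S.I, ∀ x : E3, ‖x‖ = 1 → ∀ e e' : E3, Tangent x e → Tangent x e' →
    (fun r : ℝ => variation S.metric ξ (pt u r x) (partialAng r e) (partialAng r e'))
      =O[atTop] fun r : ℝ => r

/-- The component `ξ^u` at `(u, r, x)`. -/
def compU (ξ : Spacetime → Spacetime) (u r : ℝ) (x : E3) : ℝ := du (ξ (pt u r x))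

/-- The component `ξ^r` at `(u, r, x)`. -/
def compR (ξ : Spacetime → Spacetime) (u r : ℝ) (x : E3) : ℝ := dr (r • x) (ξ (pt u r x))

/-- The angular part `ξ^A` at `(u, r, x)`, a tangent vector of `S²` at `x`. -/
def compAng (ξ : Spacetime → Spacetime) (u r : ℝ) (x : E3) : E3 := dx (r • x) (ξ (pt u r x))

/-- The function `α + (u/2) D_A f^A` on `S²`, at retarded time `u`. -/
def timeShift (α : E3 → ℝ) (f : E3 → E3) (u : ℝ) (x : E3) : ℝ := α x + u / 2 * sphDiv f x

/-- The vector field `[α + (u/2) D_A f^A] ∂_u + f^A ∂_A` on `ℝ × S²`. -/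
def bmsGenerator (α : E3 → ℝ) (f : E3 → E3) (p : ℝ × E3) : ℝ × E3 :=
  (timeShift α f p.1 p.2, f p.2)

/-- As `r → ∞` the vector field `ξ` on the space-time has the form
`[α + (u/2) D_A f^A] ∂_u + f^A ∂_A`. In detail, with `F = α + (u/2) D_A f^A`:
`ξ^u = F`, `ξ^A = f^A - D^A F / r + O(r⁻²)`, `ξ^r = - (r/2) D_C f^C + D_C D^C F / 2 + O(r⁻¹)`. -/
structure HasAsymptoticForm (S : MetricData) (ξ : Spacetime → Spacetime)
    (α : E3 → ℝ) (f : E3 → E3) : Prop where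
  limit : ∀ u ∈ S.I, ∀ x : E3, ‖x‖ = 1 →
    Tendsto (fun r : ℝ => (compU ξ u r x, compAng ξ u r x)) atTop (𝓝 (bmsGenerator α f (u, x)))
  u_eq : ∀ u ∈ S.I, ∀ r : ℝ, S.r₀ < r → ∀ x : E3, ‖x‖ = 1 →
    compU ξ u r x = timeShift α f u x
  ang_expansion : ∀ u ∈ S.I, ∀ x : E3, ‖x‖ = 1 →
    (fun r : ℝ => compAng ξ u r x - (f x - r⁻¹ • sphGrad (timeShift α f u) x))
      =O[atTop] fun r : ℝ => (r ^ 2)⁻¹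
  r_expansion : ∀ u ∈ S.I, ∀ x : E3, ‖x‖ = 1 →
    (fun r : ℝ => compR ξ u r x -
        (-(r / 2) * sphDiv f x + sphDiv (sphGrad (timeShift α f u)) x / 2))
      =O[atTop] fun r : ℝ => r⁻¹

/-! ### Finite transformations -/

/-- `φ` is a conformal diffeomorphism of `S²` with conformal factor `K > 0`: `φ^* q = K² q`. -/
structure IsConformalMap (φ : E3 → E3) (K : E3 → ℝ) : Prop where
  mapsTo : ∀ x : E3, ‖x‖ = 1 → ‖φ x‖ = 1
  smooth : SmoothOnSphere φ
  inverse : ∃ ψ : E3 → E3, SmoothOnSphere ψ ∧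
    ∀ x : E3, ‖x‖ = 1 → ‖ψ x‖ = 1 ∧ ψ (φ x) = x ∧ φ (ψ x) = x
  factor_smooth : SmoothOnSphere K
  factor_pos : ∀ x : E3, ‖x‖ = 1 → 0 < K x
  conformal : ∀ x : E3, ‖x‖ = 1 → ∀ v w : E3, Tangent x v → Tangent x w →
    inner ℝ (sphD φ x v) (sphD φ x w) = K x ^ 2 * inner ℝ v w

/-- The transformation `(u, x) ↦ (K(x) [u + A(x)], φ(x))` of `ℝ × S²`. -/
def bmsMap (φ : E3 → E3) (K A : E3 → ℝ) (p : ℝ × E3) : ℝ × E3 :=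
  (K p.2 * (p.1 + A p.2), φ p.2)

/-- `(u, x) ↦ (K [u + A], φ(x))` is a BMS transformation: `φ` is a conformal map of `S²` with
factor `K`, and `A` is a smooth function on `S²`. -/
def IsBMS (φ : E3 → E3) (K A : E3 → ℝ) : Prop := IsConformalMap φ K ∧ SmoothOnSphere A

/-- A smooth one-parameter group of BMS transformations. -/
structure IsBMSGroup (φ : ℝ → E3 → E3) (K A : ℝ → E3 → ℝ) : Prop where
  isBMS : ∀ t, IsBMS (φ t) (K t) (A t)
  smooth_φ : ContDiffOn ℝ ∞ (fun p : ℝ × E3 => radExt (φ p.1) p.2) (Set.univ ×ˢ {0}ᶜ)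
  smooth_K : ContDiffOn ℝ ∞ (fun p : ℝ × E3 => radExt (K p.1) p.2) (Set.univ ×ˢ {0}ᶜ)
  smooth_A : ContDiffOn ℝ ∞ (fun p : ℝ × E3 => radExt (A p.1) p.2) (Set.univ ×ˢ {0}ᶜ)
  add : ∀ s t u : ℝ, ∀ x : E3, ‖x‖ = 1 →
    bmsMap (φ (s + t)) (K (s + t)) (A (s + t)) (u, x)
      = bmsMap (φ s) (K s) (A s) (bmsMap (φ t) (K t) (A t) (u, x))

/-- `γ` is an integral curve in `ℝ × S²`, defined for all times, of the vector field
`[α + (u/2) D_A f^A] ∂_u + f^A ∂_A`. -/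
def IsGeneratorCurve (α : E3 → ℝ) (f : E3 → E3) (γ : ℝ → ℝ × E3) : Prop :=
  ∀ t, ‖(γ t).2‖ = 1 ∧ HasDerivAt γ (bmsGenerator α f (γ t)) t

/-- The transformations `(u, x) ↦ (K_t [u + A_t], φ_t(x))` are the flow of
`[α + (u/2) D_A f^A] ∂_u + f^A ∂_A` on `ℝ × S²`: the orbits are integral curves, and every
integral curve is an orbit. -/
def IsFlowOf (α : E3 → ℝ) (f : E3 → E3) (φ : ℝ → E3 → E3) (K A : ℝ → E3 → ℝ) : Prop :=
  (∀ u : ℝ, ∀ x : E3, ‖x‖ = 1 →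
    bmsMap (φ 0) (K 0) (A 0) (u, x) = (u, x) ∧
    IsGeneratorCurve α f (fun t => bmsMap (φ t) (K t) (A t) (u, x))) ∧
  ∀ γ : ℝ → ℝ × E3, IsGeneratorCurve α f γ →
    ∀ t, γ t = bmsMap (φ t) (K t) (A t) (γ 0)

end

end BondiSachs

open BondiSachs

/-! Parts 1 and 2. In the coordinates (u, ρ, x) with ρ = 1/r the metric functions are smooth across
ρ = 0, with a = e^{2β}V/r = 1 + O(ρ), b = e^{2β} = 1 + O(ρ²), U = O(ρ²), h = q + O(ρ)
(`nonempty_metricExpansion`). Write ξ^u = F, ξ^r = r X, ξ^A = Y. The gauge conditions are then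
solved exactly: δg_rr = 0 says ∂_ρ F = 0; δg_rA = 0 says ∂_ρ Y^A = -e^{2β} h^{AB} ∂_B F, so Y is its
value Y₀ at ρ = 0 minus a primitive; the trace condition is algebraic because det h is fixed, and
gives X = -(1/2)(D_A Y^A - U^A ∂_A F). Hence a vector field that preserves the gauge is determined
by F(u, x) and Y₀(u, x), it extends smoothly to ρ = 0, and its expansion can be read off there
(`exists_isGaugeField`, `IsGaugeField.hasAsymptoticForm`).

Each fall-off condition now says that some Taylor coefficients at ρ = 0 vanish. The r² term of δg_AB
makes Y₀ conformal Killing, the r² term of δg_uA gives ∂_u Y₀ = 0, and the leading term of δg_ur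
gives ∂_u F = (1/2) D_A Y₀^A. Integration in u gives part 1 (`exists_asymptoticForm`). Conversely,
for F = α + (u/2)ψ with ψ = D_A f^A and Y₀ = f, the remaining coefficients cancel; in δg_uu this
needs D_A D^A ψ = -2ψ (`falloff_uu`, `exists_asymptoticKilling`).

Part 3 and this identity rest on the classification of conformal Killing vectors. In a stereographic
coordinate the conformal Killing equation is the Cauchy–Riemann system, and boundedness on the
sphere becomes quadratic growth; by the Cauchy estimates the coordinate expression is a quadratic
polynomial. So f(x) = a × x + b - ⟨b, x⟩x for constant vectors a, b
(`IsConformalKilling.exists_killingField`), and ψ = -2⟨b, x⟩ is a first spherical harmonic.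

Such an f generates the action of a one-parameter group of Lorentz transformations on the null
directions (1, x). The exponential of the generator therefore gives the flow φ_t for all times, the
energy of the image of (1, x) is 1/K_t, and conformality is the invariance of the Minkowski product.
The u-component satisfies a linear equation with integrating factor 1/K_t, which produces a_t
(`exists_bmsGroup`). Conversely, the derivative of a one-parameter group at t = 0 is a generator:
differentiating φ_t^* q = K_t² q gives the conformal Killing equation with ψ = 2 ∂_t K_t. The group
law moves the derivative from time 0 to any time, and uniqueness of integral curves follows from the
explicit flow (`IsBMSGroup.exists_generator`). -/

namespace BondiSachs

noncomputable section

/-! ### Integrals depending smoothly on parameters -/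

section ParametricIntegral

variable {E : Type} [NormedAddCommGroup E] [NormedSpace ℝ E]

/-- The parameters for which the segment `[0, 1] × {x}` lies in `T`. -/
def segmentDomain (T : Set (ℝ × E)) : Set E := {x | ∀ s ∈ Set.Icc (0 : ℝ) 1, (s, x) ∈ T}

omit [NormedSpace ℝ E] in
lemma exists_tube {T : Set (ℝ × E)} (hT : IsOpen T) {x₀ : E} (hx : x₀ ∈ segmentDomain T) :
    ∃ v ∈ 𝓝 x₀, ∀ s ∈ Set.Icc (0 : ℝ) 1, ∀ x ∈ v, (s, x) ∈ T := by
  obtain ⟨u, v, -, hv, hu, hxv, huv⟩ := generalized_tube_lemma (s := Set.Icc (0 : ℝ) 1)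
    isCompact_Icc (isCompact_singleton (x := x₀)) hT (by
      rintro ⟨s, x⟩ ⟨hs, hx'⟩
      obtain rfl : x = x₀ := hx'
      exact hx s hs)
  exact ⟨v, hv.mem_nhds (hxv rfl), fun s hs x hx => huv ⟨hu hs, hx⟩⟩

omit [NormedSpace ℝ E] in
lemma isOpen_segmentDomain {T : Set (ℝ × E)} (hT : IsOpen T) : IsOpen (segmentDomain T) := by
  rw [isOpen_iff_mem_nhds]
  intro x₀ hx
  obtain ⟨v, hv, h⟩ := exists_tube hT hx
  filter_upwards [hv] with x hx s hs using h s hs x hx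

/-- Differentiation under the integral sign. On the compact segment over `x₀` the partial derivative
is bounded by some `C`, hence by `C + 1` on an open set around it. The tube lemma yields one
neighbourhood of `x₀` on which this constant dominates for all `s` at once. -/
lemma hasFDerivAt_segmentIntegral {F : Type} [NormedAddCommGroup F] [NormedSpace ℝ F]
    {T : Set (ℝ × E)} (hT : IsOpen T) {G : ℝ × E → F} (hG : ContDiffOn ℝ 1 G T) {x₀ : E}
    (hx : x₀ ∈ segmentDomain T) :
    HasFDerivAt (fun x => ∫ s in (0 : ℝ)..1, G (s, x))
      (∫ s in (0 : ℝ)..1, (fderiv ℝ G (s, x₀)).comp (ContinuousLinearMap.inr ℝ ℝ E)) x₀ := by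
  have hG' : ContinuousOn (fun p => (fderiv ℝ G p).comp (ContinuousLinearMap.inr ℝ ℝ E)) T :=
    (hG.continuousOn_fderiv_of_isOpen hT le_rfl).clm_comp continuousOn_const
  have hline : ∀ x ∈ segmentDomain T, ContinuousOn (fun s : ℝ => (s, x)) (Set.Icc 0 1) :=
    fun x _ => by fun_prop
  obtain ⟨C, hC⟩ : ∃ C, ∀ s ∈ Set.Icc (0 : ℝ) 1,
      ‖(fderiv ℝ G (s, x₀)).comp (ContinuousLinearMap.inr ℝ ℝ E)‖ ≤ C :=
    (isCompact_Icc (a := (0 : ℝ)) (b := 1)).exists_bound_of_continuousOn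
      (hG'.comp (hline x₀ hx) hx)
  have hT' : IsOpen (T ∩ (fun p => ‖(fderiv ℝ G p).comp (ContinuousLinearMap.inr ℝ ℝ E)‖) ⁻¹'
      Set.Iio (C + 1)) := hG'.norm.isOpen_inter_preimage hT isOpen_Iio
  obtain ⟨v, hv, hvT⟩ := exists_tube hT' (x₀ := x₀)
    (fun s hs => ⟨hx s hs, (hC s hs).trans_lt (lt_add_one C)⟩)
  have hsub : Set.uIoc (0 : ℝ) 1 ⊆ Set.Icc 0 1 := by
    rw [Set.uIoc_of_le zero_le_one]; exact Set.Ioc_subset_Icc_self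
  have hcont : ∀ x ∈ segmentDomain T, ContinuousOn (fun s => G (s, x)) (Set.Icc 0 1) :=
    fun x hx => hG.continuousOn.comp (hline x hx) hx
  refine intervalIntegral.hasFDerivAt_integral_of_dominated_of_fderiv_le
    (F := fun x s => G (s, x)) (bound := fun _ => C + 1)
    (F' := fun x s => (fderiv ℝ G (s, x)).comp (ContinuousLinearMap.inr ℝ ℝ E))
    hv ?_ ?_ ?_ ?_ intervalIntegrable_const ?_
  · filter_upwards [(isOpen_segmentDomain hT).mem_nhds hx] with x hx
    exact ((hcont x hx).mono hsub).aestronglyMeasurable measurableSet_uIoc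
  · exact ContinuousOn.intervalIntegrable (by rw [Set.uIcc_of_le zero_le_one]; exact hcont x₀ hx)
  · exact ((hG'.comp (hline x₀ hx) hx).mono hsub).aestronglyMeasurable measurableSet_uIoc
  · filter_upwards with s hs x hx
    exact (hvT s (hsub hs) x hx).2.le
  · filter_upwards with s hs x hx
    have h1 : HasFDerivAt G (fderiv ℝ G (s, x)) (s, x) :=
      ((hG.contDiffAt (hT.mem_nhds (hvT s (hsub hs) x hx).1)).differentiableAt
        one_ne_zero).hasFDerivAt
    exact h1.comp x (hasFDerivAt_prodMk_right s x)

/-- The derivative of the integral is again an integral of the same kind, with values in a space of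
operators; the induction therefore runs over all target spaces simultaneously. -/
lemma contDiffOn_nat_segmentIntegral (n : ℕ) {F : Type} [NormedAddCommGroup F] [NormedSpace ℝ F]
    {T : Set (ℝ × E)} (hT : IsOpen T) {G : ℝ × E → F} (hG : ContDiffOn ℝ ∞ G T) :
    ContDiffOn ℝ n (fun x => ∫ s in (0 : ℝ)..1, G (s, x)) (segmentDomain T) := by
  have hV := isOpen_segmentDomain hT
  have h1 : ContDiffOn ℝ 1 G T := hG.of_le (by exact_mod_cast le_top)
  induction n generalizing F with
  | zero =>
    refine contDiffOn_zero.2 fun x hx => ?_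
    exact (hasFDerivAt_segmentIntegral hT h1 hx).continuousAt.continuousWithinAt
  | succ n ih =>
    push_cast
    rw [contDiffOn_succ_iff_fderiv_of_isOpen hV]
    refine ⟨fun x hx =>
      (hasFDerivAt_segmentIntegral hT h1 hx).differentiableAt.differentiableWithinAt,
      fun h => by simp at h, ?_⟩
    have h2 : ContDiffOn ℝ ∞
        (fun p => (fderiv ℝ G p).comp (ContinuousLinearMap.inr ℝ ℝ E)) T :=
      (hG.fderiv_of_isOpen hT (by simp)).clm_comp contDiffOn_const
    exact (ih h2 (h2.of_le (by exact_mod_cast le_top))).congr fun x hx =>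
      (hasFDerivAt_segmentIntegral hT h1 hx).fderiv

/-- The integral over `[0, 1]` of a smooth function depends smoothly on the parameters. -/
theorem contDiffOn_segmentIntegral {F : Type} [NormedAddCommGroup F] [NormedSpace ℝ F]
    {T : Set (ℝ × E)} (hT : IsOpen T) {G : ℝ × E → F} (hG : ContDiffOn ℝ ∞ G T) :
    ContDiffOn ℝ ∞ (fun x => ∫ s in (0 : ℝ)..1, G (s, x)) (segmentDomain T) :=
  contDiffOn_infty.2 fun n => contDiffOn_nat_segmentIntegral n hT hG

end ParametricIntegral

/-! ### The direction map and calculus on the sphere -/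

/-- The direction `y / ‖y‖` of a vector. -/
def dir (y : E3) : E3 := ‖y‖⁻¹ • y

lemma norm_dir {y : E3} (hy : y ≠ 0) : ‖dir y‖ = 1 := by
  rw [dir, norm_smul, norm_inv, norm_norm, inv_mul_cancel₀ (norm_ne_zero_iff.2 hy)]

lemma dir_of_norm_eq_one {x : E3} (hx : ‖x‖ = 1) : dir x = x := by simp [dir, hx]

lemma ne_zero_of_norm_eq_one {x : E3} (hx : ‖x‖ = 1) : x ≠ 0 := by
  rintro rfl; simp at hx

lemma dir_ne_zero {y : E3} (hy : y ≠ 0) : dir y ≠ 0 := ne_zero_of_norm_eq_one (norm_dir hy)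

lemma dir_dir (y : E3) : dir (dir y) = dir y := by
  rcases eq_or_ne y 0 with rfl | hy
  · simp [dir]
  · exact dir_of_norm_eq_one (norm_dir hy)

lemma norm_smul_unit {r : ℝ} (hr : 0 < r) {x : E3} (hx : ‖x‖ = 1) : ‖r • x‖ = r := by
  rw [norm_smul, hx, mul_one, Real.norm_of_nonneg hr.le]

lemma dir_smul_unit {r : ℝ} (hr : 0 < r) {x : E3} (hx : ‖x‖ = 1) : dir (r • x) = x := by
  rw [dir, norm_smul_unit hr hx, smul_smul, inv_mul_cancel₀ hr.ne', one_smul]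

lemma tanProj_apply (x v : E3) : tanProj x v = v - inner ℝ x v • x := by
  simp [tanProj]

lemma tanProj_of_tangent {x v : E3} (h : Tangent x v) : tanProj x v = v := by
  rw [tanProj_apply, show inner ℝ x v = 0 from h, zero_smul, sub_zero]

lemma tanProj_self {x : E3} (hx : ‖x‖ = 1) : tanProj x x = 0 := by
  simp [tanProj_apply, hx]

lemma tangent_tanProj {x : E3} (hx : ‖x‖ = 1) (v : E3) : Tangent x (tanProj x v) := by
  simp [Tangent, tanProj_apply, inner_sub_right, inner_smul_right, hx]

lemma tangent_smul {x v : E3} (c : ℝ) (h : Tangent x v) : Tangent x (c • v) := by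
  rw [Tangent, inner_smul_right, show inner ℝ x v = 0 from h, mul_zero]

lemma tangent_add {x v w : E3} (h : Tangent x v) (h' : Tangent x w) : Tangent x (v + w) := by
  rw [Tangent, inner_add_right, show inner ℝ x v = 0 from h, show inner ℝ x w = 0 from h',
    add_zero]

lemma contDiffAt_dir {y : E3} (hy : y ≠ 0) : ContDiffAt ℝ ∞ dir y :=
  ((contDiffAt_norm ℝ hy).inv (norm_ne_zero_iff.2 hy)).smul contDiffAt_id

lemma contDiffOn_dir : ContDiffOn ℝ ∞ dir {0}ᶜ := fun _ hy =>
  (contDiffAt_dir hy).contDiffWithinAt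

lemma mapsTo_dir : Set.MapsTo dir {0}ᶜ {0}ᶜ := fun _ hy => dir_ne_zero hy

lemma hasFDerivAt_norm {y : E3} (hy : y ≠ 0) :
    HasFDerivAt (fun y : E3 => ‖y‖) (innerSL ℝ (dir y)) y := by
  have h1 := (hasStrictFDerivAt_norm_sq y).hasFDerivAt.sqrt (by simpa using hy)
  have : (fun y : E3 => √(‖y‖ ^ 2)) = fun y => ‖y‖ := by
    funext y; exact Real.sqrt_sq (norm_nonneg y)
  rw [this] at h1
  refine h1.congr_fderiv ?_
  ext v
  have := norm_ne_zero_iff.2 hy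
  simp [dir, Real.sqrt_sq (norm_nonneg y)]
  field_simp

lemma hasFDerivAt_dir {y : E3} (hy : y ≠ 0) :
    HasFDerivAt dir (‖y‖⁻¹ • tanProj (dir y)) y := by
  have h0 := norm_ne_zero_iff.2 hy
  have h1 := ((hasDerivAt_inv h0).comp_hasFDerivAt y (hasFDerivAt_norm hy)).smul (hasFDerivAt_id y)
  refine h1.congr_fderiv ?_
  ext v i
  simp [tanProj_apply, dir, inner_smul_left]
  field_simp
  ring

lemma radExt_apply {G : Type*} [NormedAddCommGroup G] [NormedSpace ℝ G] (F : E3 → G) (y : E3) :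
    radExt F y = F (dir y) := rfl

section

variable {G : Type*} [NormedAddCommGroup G] [NormedSpace ℝ G]

lemma radExt_of_norm_eq_one (F : E3 → G) {x : E3} (hx : ‖x‖ = 1) : radExt F x = F x := by
  rw [radExt_apply, dir_of_norm_eq_one hx]

lemma radExt_dir (F : E3 → G) (y : E3) : radExt F (dir y) = radExt F y := by
  rw [radExt_apply, radExt_apply, dir_dir]

lemma radExt_radExt (F : E3 → G) : radExt (radExt F) = radExt F :=
  funext fun y => radExt_dir F y

omit [NormedAddCommGroup G] [NormedSpace ℝ G] in
lemma radExt_eventuallyEq {F F' : E3 → G} (h : ∀ x : E3, ‖x‖ = 1 → F x = F' x) {x : E3}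
    (hx : x ≠ 0) : radExt F =ᶠ[𝓝 x] radExt F' := by
  filter_upwards [isOpen_ne.mem_nhds hx] with y hy using h _ (norm_dir hy)

lemma sphD_congr {F F' : E3 → G} (h : ∀ x : E3, ‖x‖ = 1 → F x = F' x) {x : E3}
    (hx : ‖x‖ = 1) : sphD F x = sphD F' x :=
  (radExt_eventuallyEq h (ne_zero_of_norm_eq_one hx)).fderiv_eq

lemma sphDiv_congr {f g : E3 → E3} (h : ∀ x : E3, ‖x‖ = 1 → f x = g x) {x : E3}
    (hx : ‖x‖ = 1) : sphDiv f x = sphDiv g x := by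
  simp only [sphDiv, sphD_congr h hx]

lemma sphD_radExt (F : E3 → G) (x : E3) : sphD (radExt F) x = sphD F x := by
  rw [sphD, radExt_radExt, sphD]

lemma smoothOnSphere_of_contDiffOn {F : E3 → G} (hF : ContDiffOn ℝ ∞ F {0}ᶜ) :
    SmoothOnSphere F := hF.comp contDiffOn_dir mapsTo_dir

lemma smoothOnSphere_of_contDiff {F : E3 → G} (hF : ContDiff ℝ ∞ F) :
    SmoothOnSphere F := smoothOnSphere_of_contDiffOn hF.contDiffOn

lemma SmoothOnSphere.contDiffAt {F : E3 → G} (hF : SmoothOnSphere F) {y : E3} (hy : y ≠ 0) :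
    ContDiffAt ℝ ∞ (radExt F) y := ContDiffOn.contDiffAt hF (isOpen_ne.mem_nhds hy)

lemma SmoothOnSphere.differentiableAt {F : E3 → G} (hF : SmoothOnSphere F) {y : E3}
    (hy : y ≠ 0) : DifferentiableAt ℝ (radExt F) y :=
  (hF.contDiffAt hy).differentiableAt (by simp)

lemma SmoothOnSphere.hasFDerivAt {F : E3 → G} (hF : SmoothOnSphere F) {x : E3}
    (hx : ‖x‖ = 1) : HasFDerivAt (radExt F) (sphD F x) x :=
  (hF.differentiableAt (ne_zero_of_norm_eq_one hx)).hasFDerivAt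

/-- `radExt F` is `F ∘ dir`, and at a unit vector the derivative of `dir` is the tangential
projection. This turns derivatives in the ambient space into derivatives on the sphere. -/
lemma sphD_eq_of_hasFDerivAt {F : E3 → G} {F' : E3 →L[ℝ] G} {x : E3} (hx : ‖x‖ = 1)
    (h : HasFDerivAt F F' x) : sphD F x = F'.comp (tanProj x) := by
  have h1 := hasFDerivAt_dir (ne_zero_of_norm_eq_one hx)
  rw [hx, inv_one, one_smul, dir_of_norm_eq_one hx] at h1
  rw [← dir_of_norm_eq_one hx] at h
  have h2 := h.comp x h1
  exact h2.fderiv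

/-- The differential of a function on the sphere only sees the tangential part. -/
lemma sphD_tanProj (F : E3 → G) {x : E3} (hx : ‖x‖ = 1) (v : E3) :
    sphD F x (tanProj x v) = sphD F x v := by
  -- In the differentiable case `sphD F x` is itself an ambient derivative, namely that of `radExt
  -- F`, so the projection formula applies to it. Otherwise `sphD F x` has the default value 0.
  by_cases h : DifferentiableAt ℝ (radExt F) x
  · rw [← sphD_radExt, sphD_eq_of_hasFDerivAt hx h.hasFDerivAt]
    simp [tanProj_of_tangent (tangent_tanProj hx v)]
  · simp [sphD, fderiv_zero_of_not_differentiableAt h]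

lemma sphD_self (F : E3 → G) {x : E3} (hx : ‖x‖ = 1) : sphD F x x = 0 := by
  rw [← sphD_tanProj F hx, tanProj_self hx, map_zero]

lemma SmoothOnSphere.sphD {F : E3 → G} (hF : SmoothOnSphere F) : SmoothOnSphere (sphD F) :=
  smoothOnSphere_of_contDiffOn (ContDiffOn.fderiv_of_isOpen hF isOpen_ne (by simp))

lemma SmoothOnSphere.add {F F' : E3 → G} (hF : SmoothOnSphere F) (hF' : SmoothOnSphere F') :
    SmoothOnSphere fun x => F x + F' x := ContDiffOn.add hF hF'

lemma SmoothOnSphere.const_smul {F : E3 → G} (c : ℝ) (hF : SmoothOnSphere F) :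
    SmoothOnSphere fun x => c • F x := ContDiffOn.const_smul c hF

lemma sphD_add {F F' : E3 → G} (hF : SmoothOnSphere F) (hF' : SmoothOnSphere F') {x : E3}
    (hx : ‖x‖ = 1) : sphD (fun y => F y + F' y) x = sphD F x + sphD F' x :=
  ((hF.hasFDerivAt hx).add (hF'.hasFDerivAt hx)).fderiv

lemma sphD_const_smul {F : E3 → G} (hF : SmoothOnSphere F) (c : ℝ) {x : E3}
    (hx : ‖x‖ = 1) : sphD (fun y => c • F y) x = c • sphD F x :=
  ((hF.hasFDerivAt hx).const_smul c).fderiv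

end

lemma inner_sphGrad (F : E3 → ℝ) (x v : E3) : inner ℝ (sphGrad F x) v = sphD F x v := by
  rw [sphGrad, gradient, InnerProductSpace.toDual_symm_apply, sphD]

lemma sphGrad_eq (F : E3 → ℝ) (x : E3) :
    sphGrad F x = (InnerProductSpace.toDual ℝ E3).symm (sphD F x) := rfl

lemma SmoothOnSphere.sphGrad {F : E3 → ℝ} (hF : SmoothOnSphere F) :
    SmoothOnSphere (sphGrad F) :=
  (InnerProductSpace.toDual ℝ E3).symm.contDiff.comp_contDiffOn hF.sphD

lemma SmoothOnSphere.sphDiv {f : E3 → E3} (hf : SmoothOnSphere f) :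
    SmoothOnSphere (sphDiv f) := by
  have : ContDiff ℝ ∞ (fun L : E3 →L[ℝ] E3 => ∑ i : Fin 3, (L (EuclideanSpace.single i 1)) i) := by
    fun_prop
  exact this.comp_contDiffOn hf.sphD

lemma sphDiv_add {f g : E3 → E3} (hf : SmoothOnSphere f) (hg : SmoothOnSphere g) {x : E3}
    (hx : ‖x‖ = 1) : sphDiv (fun y => f y + g y) x = sphDiv f x + sphDiv g x := by
  simp [sphDiv, sphD_add hf hg hx, Finset.sum_add_distrib]

lemma sphDiv_const_smul {f : E3 → E3} (hf : SmoothOnSphere f) (c : ℝ) {x : E3}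
    (hx : ‖x‖ = 1) : sphDiv (fun y => c • f y) x = c * sphDiv f x := by
  simp [sphDiv, sphD_const_smul hf c hx, Finset.mul_sum]

lemma sphGrad_add {F F' : E3 → ℝ} (hF : SmoothOnSphere F) (hF' : SmoothOnSphere F') {x : E3}
    (hx : ‖x‖ = 1) : sphGrad (fun y => F y + F' y) x = sphGrad F x + sphGrad F' x := by
  simp [sphGrad_eq, sphD_add hF hF' hx]

lemma sphGrad_const_smul {F : E3 → ℝ} (hF : SmoothOnSphere F) (c : ℝ) {x : E3}
    (hx : ‖x‖ = 1) : sphGrad (fun y => c * F y) x = c • sphGrad F x := by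
  have := sphD_const_smul hF c hx
  simp only [smul_eq_mul] at this
  simp [sphGrad_eq, this]

/-! ### Orthonormal frames -/

/-- The cross product on `E3`. -/
def cross (v w : E3) : E3 :=
  !₂[v 1 * w 2 - v 2 * w 1, v 2 * w 0 - v 0 * w 2, v 0 * w 1 - v 1 * w 0]

@[simp] lemma cross_zero' (v w : E3) : cross v w 0 = v 1 * w 2 - v 2 * w 1 := rfl
@[simp] lemma cross_one' (v w : E3) : cross v w 1 = v 2 * w 0 - v 0 * w 2 := rfl
@[simp] lemma cross_two' (v w : E3) : cross v w 2 = v 0 * w 1 - v 1 * w 0 := rfl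

lemma inner_eq (v w : E3) : inner ℝ v w = v 0 * w 0 + v 1 * w 1 + v 2 * w 2 := by
  simp [PiLp.inner_apply, Fin.sum_univ_three]; ring

lemma norm_sq_eq (v : E3) : ‖v‖ ^ 2 = v 0 ^ 2 + v 1 ^ 2 + v 2 ^ 2 := by
  rw [← real_inner_self_eq_norm_sq, inner_eq]; ring

lemma ext_three {v w : E3} (h0 : v 0 = w 0) (h1 : v 1 = w 1) (h2 : v 2 = w 2) : v = w := by
  ext i; fin_cases i <;> assumption

/-- A tangent vector of unit length at `x`, together with `x × e`, is an oriented orthonormal frame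
of the tangent space. -/
structure IsFrame (x e₁ e₂ : E3) : Prop where
  norm_x : ‖x‖ = 1
  norm_fst : ‖e₁‖ = 1
  tangent_fst : Tangent x e₁
  snd_eq : e₂ = cross x e₁

lemma exists_frame {x : E3} (hx : ‖x‖ = 1) : ∃ e₁ e₂, IsFrame x e₁ e₂ := by
  obtain ⟨v, hv⟩ : ∃ v : E3, tanProj x v ≠ 0 := by
    by_contra! h
    -- If all projections vanished, the first two basis vectors would be multiples of `x`, which
    -- forces x₀² = x₁² = 1 and x₀x₁ = 0.
    have h0 := h (EuclideanSpace.single 0 1)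
    have h1 := h (EuclideanSpace.single 1 1)
    rw [tanProj_apply] at h0 h1
    have a := congrArg (fun w : E3 => w 0) h0
    have b := congrArg (fun w : E3 => w 1) h1
    have c := congrArg (fun w : E3 => w 1) h0
    simp [inner_eq] at a b c
    rcases c with c | c <;> simp [c] at a b
  exact ⟨dir (tanProj x v), _, hx, norm_dir hv, tangent_smul _ (tangent_tanProj hx v), rfl⟩

namespace IsFrame

variable {x e₁ e₂ : E3} (h : IsFrame x e₁ e₂)
include h

lemma eqs : x 0 ^ 2 + x 1 ^ 2 + x 2 ^ 2 = 1 ∧ e₁ 0 ^ 2 + e₁ 1 ^ 2 + e₁ 2 ^ 2 = 1 ∧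
    x 0 * e₁ 0 + x 1 * e₁ 1 + x 2 * e₁ 2 = 0 := by
  refine ⟨?_, ?_, ?_⟩
  · rw [← norm_sq_eq, h.norm_x, one_pow]
  · rw [← norm_sq_eq, h.norm_fst, one_pow]
  · rw [← inner_eq]; exact h.tangent_fst

lemma tangent_snd : Tangent x e₂ := by
  rw [Tangent, h.snd_eq, inner_eq]; simp; ring

lemma inner_fst_snd : inner ℝ e₁ e₂ = 0 := by
  rw [h.snd_eq, inner_eq]; simp; ring

lemma norm_snd : ‖e₂‖ = 1 := by
  have h1 : ‖e₂‖ ^ 2 = 1 := by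
    obtain ⟨a, b, c⟩ := h.eqs
    rw [h.snd_eq, norm_sq_eq]
    simp only [cross_zero', cross_one', cross_two']
    linear_combination (e₁ 0 ^ 2 + e₁ 1 ^ 2 + e₁ 2 ^ 2) * a + b -
      (x 0 * e₁ 0 + x 1 * e₁ 1 + x 2 * e₁ 2) * c
  exact (pow_eq_one_iff_of_nonneg (norm_nonneg _) two_ne_zero).1 h1

lemma cross_fst : cross x e₁ = e₂ := h.snd_eq.symm

lemma cross_snd : cross x e₂ = -e₁ := by
  obtain ⟨a, b, c⟩ := h.eqs
  rw [h.snd_eq]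
  refine ext_three ?_ ?_ ?_ <;> simp only [cross_zero', cross_one', cross_two', PiLp.neg_apply]
  · linear_combination x 0 * c - e₁ 0 * a
  · linear_combination x 1 * c - e₁ 1 * a
  · linear_combination x 2 * c - e₁ 2 * a

lemma orthonormal_pair : Orthonormal ℝ ![e₁, e₂] := by
  have h1 : inner ℝ e₂ e₁ = 0 := by rw [real_inner_comm]; exact h.inner_fst_snd
  rw [orthonormal_iff_ite]
  intro i j
  fin_cases i <;> fin_cases j <;>
    simp [h.norm_fst, h.norm_snd, h.inner_fst_snd, h1]

lemma orthonormal : Orthonormal ℝ ![e₁, e₂, x] := by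
  have h1 : inner ℝ e₂ e₁ = 0 := by rw [real_inner_comm]; exact h.inner_fst_snd
  have h2 : inner ℝ x e₁ = 0 := h.tangent_fst
  have h3 : inner ℝ x e₂ = 0 := h.tangent_snd
  have h4 : inner ℝ e₁ x = 0 := by rw [real_inner_comm]; exact h2
  have h5 : inner ℝ e₂ x = 0 := by rw [real_inner_comm]; exact h3
  rw [orthonormal_iff_ite]
  intro i j
  fin_cases i <;> fin_cases j <;>
    simp [h.norm_fst, h.norm_snd, h.inner_fst_snd, h1, h2, h3, h4, h5, h.norm_x]

/-- The orthonormal basis of `E3` which consists of the frame and the normal. -/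
def basis : OrthonormalBasis (Fin 3) ℝ E3 :=
  OrthonormalBasis.mk h.orthonormal (by
    have := h.orthonormal.linearIndependent.span_eq_top_of_card_eq_finrank' (by simp)
    rw [this])

lemma coe_basis : ⇑h.basis = ![e₁, e₂, x] := OrthonormalBasis.coe_mk _ _

lemma expand (v : E3) : v = inner ℝ e₁ v • e₁ + inner ℝ e₂ v • e₂ + inner ℝ x v • x := by
  have := (h.basis.sum_repr' v).symm
  simpa [Fin.sum_univ_three, h.coe_basis] using this

lemma expand_of_tangent {v : E3} (hv : Tangent x v) :
    v = inner ℝ e₁ v • e₁ + inner ℝ e₂ v • e₂ := by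
  have := h.expand v
  rwa [show inner ℝ x v = 0 from hv, zero_smul, add_zero] at this

/-- The trace of a bilinear form in an orthonormal frame. -/
lemma sum_bilin (B : E3 →ₗ[ℝ] E3 →ₗ[ℝ] ℝ) :
    ∑ i : Fin 3, B (EuclideanSpace.single i 1) (EuclideanSpace.single i 1)
      = B e₁ e₁ + B e₂ e₂ + B x x := by
  -- The trace does not depend on the orthonormal basis: expand each `b i` in the basis `b'` and use
  -- Σᵢ ⟨b'ⱼ, bᵢ⟩⟨bᵢ, b'ₖ⟩ = δⱼₖ.
  have key : ∀ b b' : OrthonormalBasis (Fin 3) ℝ E3,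
      ∑ i, B (b i) (b i) = ∑ i, B (b' i) (b' i) := by
    intro b b'
    have h1 : ∀ i, B (b i) (b i) =
        ∑ j, ∑ k, inner ℝ (b' j) (b i) * inner ℝ (b i) (b' k) * B (b' j) (b' k) := by
      intro i
      conv_lhs => rw [← b'.sum_repr' (b i)]
      simp only [map_sum, map_smul, LinearMap.sum_apply, LinearMap.smul_apply, smul_eq_mul,
        Finset.mul_sum]
      rw [Finset.sum_comm]
      refine Finset.sum_congr rfl fun j _ => Finset.sum_congr rfl fun k _ => ?_
      rw [real_inner_comm (b' k) (b i)]; ring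
    simp only [h1]
    rw [Finset.sum_comm]
    refine Finset.sum_congr rfl fun j _ => ?_
    rw [Finset.sum_comm]
    have h2 : ∀ k, ∑ i, inner ℝ (b' j) (b i) * inner ℝ (b i) (b' k) * B (b' j) (b' k)
        = (if j = k then 1 else 0) * B (b' j) (b' k) := by
      intro k
      rw [← Finset.sum_mul, b.sum_inner_mul_inner, orthonormal_iff_ite.1 b'.orthonormal]
    simp [h2]
  have := key (EuclideanSpace.basisFun (Fin 3) ℝ) h.basis
  simpa [Fin.sum_univ_three, h.coe_basis] using this

/-- The differential vanishes on the normal, so the trace over the ambient space reduces to the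
trace over the tangent frame. -/
lemma sphDiv_eq (f : E3 → E3) :
    sphDiv f x = inner ℝ (sphD f x e₁) e₁ + inner ℝ (sphD f x e₂) e₂ := by
  have := h.sum_bilin ((innerₗ E3).comp (sphD f x : E3 →ₗ[ℝ] E3))
  simp only [LinearMap.comp_apply, ContinuousLinearMap.coe_coe, innerₗ_apply_apply,
    sphD_self f h.norm_x, inner_zero_left, add_zero] at this
  rw [← this, sphDiv]
  refine Finset.sum_congr rfl fun i _ => ?_
  simp [EuclideanSpace.inner_single_right]

end IsFrame

/-! ### Classification of the conformal Killing vectors of the sphere -/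

/-- An entire function of at most quadratic growth is a quadratic polynomial. -/
lemma exists_quadratic_of_growth {F : ℂ → ℂ} (hF : Differentiable ℂ F) {C : ℝ}
    (hC : ∀ z, ‖F z‖ ≤ C * (1 + ‖z‖ ^ 2)) :
    ∃ c₀ c₁ c₂ : ℂ, ∀ z, F z = c₀ + c₁ * z + c₂ * z ^ 2 := by
  have hzero : ∀ n : ℕ, 3 ≤ n → iteratedDeriv n F 0 = 0 := by
    intro n hn
    -- Cauchy's estimate on the circle of radius R bounds the n-th derivative by n! C (1 + R²)/Rⁿ,
    -- which tends to 0 as R → ∞ when n ≥ 3.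
    have hb : ∀ R : ℝ, 0 < R → ‖iteratedDeriv n F 0‖ ≤
        n.factorial * C * ((R ^ n)⁻¹ + (R ^ (n - 2))⁻¹) := by
      intro R hR
      have h1 := Complex.norm_iteratedDeriv_le_of_forall_mem_sphere_norm_le n (c := 0) hR
        hF.diffContOnCl (C := C * (1 + R ^ 2)) (fun z hz => by
          have := hC z
          rwa [mem_sphere_zero_iff_norm.1 hz] at this)
      refine h1.trans (le_of_eq ?_)
      obtain ⟨k, rfl⟩ : ∃ k, n = k + 2 := ⟨n - 2, by omega⟩
      simp only [Nat.add_sub_cancel]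
      field_simp
      ring
    have hlim : Tendsto (fun R : ℝ => n.factorial * C * ((R ^ n)⁻¹ + (R ^ (n - 2))⁻¹)) atTop
        (𝓝 (n.factorial * C * (0 + 0))) :=
      ((tendsto_inv_atTop_zero.comp (tendsto_pow_atTop (by omega))).add
        (tendsto_inv_atTop_zero.comp (tendsto_pow_atTop (by omega)))).const_mul _
    have := ge_of_tendsto hlim ((eventually_gt_atTop 0).mono hb)
    simpa using this
  refine ⟨iteratedDeriv 0 F 0, iteratedDeriv 1 F 0, (2 : ℂ)⁻¹ * iteratedDeriv 2 F 0, fun z => ?_⟩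
  rw [← Complex.taylorSeries_eq_of_entire' (c := 0) (z := z) hF,
    tsum_eq_sum (s := Finset.range 3) (fun n hn => by
      rw [hzero n (by simpa using hn)]; simp)]
  simp [Finset.sum_range_succ]

/-- The function `1 + |z|²`. -/
def stereoDenom (z : ℂ) : ℝ := 1 + z.re ^ 2 + z.im ^ 2

lemma stereoDenom_pos (z : ℂ) : 0 < stereoDenom z := by unfold stereoDenom; positivity

/-- The inverse of the stereographic projection from the north pole. -/
def stereo (z : ℂ) : E3 :=
  !₂[2 * z.re / stereoDenom z, 2 * z.im / stereoDenom z, (stereoDenom z - 2) / stereoDenom z]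

/-- The derivative of `stereo` along the real axis. -/
def stereoRe (z : ℂ) : E3 :=
  !₂[2 * (1 - z.re ^ 2 + z.im ^ 2) / stereoDenom z ^ 2, -4 * z.re * z.im / stereoDenom z ^ 2,
    4 * z.re / stereoDenom z ^ 2]

/-- The derivative of `stereo` along the imaginary axis. -/
def stereoIm (z : ℂ) : E3 :=
  !₂[-4 * z.re * z.im / stereoDenom z ^ 2, 2 * (1 + z.re ^ 2 - z.im ^ 2) / stereoDenom z ^ 2,
    4 * z.im / stereoDenom z ^ 2]

lemma norm_stereo (z : ℂ) : ‖stereo z‖ = 1 := by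
  have h : ‖stereo z‖ ^ 2 = 1 := by
    have := (stereoDenom_pos z).ne'
    rw [norm_sq_eq]
    simp only [stereo, PiLp.toLp_apply, Matrix.cons_val]
    field_simp
    unfold stereoDenom
    ring
  exact (pow_eq_one_iff_of_nonneg (norm_nonneg _) two_ne_zero).1 h

lemma contDiff_stereo : ContDiff ℝ ∞ stereo := by
  have h1 : ContDiff ℝ ∞ stereoDenom := by
    unfold stereoDenom
    exact (contDiff_const.add (Complex.reCLM.contDiff.pow 2)).add (Complex.imCLM.contDiff.pow 2)
  have h2 : ∀ z, stereoDenom z ≠ 0 := fun z => (stereoDenom_pos z).ne'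
  rw [contDiff_euclidean]
  intro i
  fin_cases i
  · exact (contDiff_const.mul Complex.reCLM.contDiff).div h1 h2
  · exact (contDiff_const.mul Complex.imCLM.contDiff).div h1 h2
  · exact (h1.sub contDiff_const).div h1 h2

lemma hasDerivAt_E3 {f : ℝ → E3} {f' : E3} {t : ℝ}
    (h : ∀ i, HasDerivAt (fun s => f s i) (f' i) t) : HasDerivAt f f' t := by
  rw [hasDerivAt_iff_hasFDerivAt, ← hasFDerivWithinAt_univ, hasFDerivWithinAt_euclidean]
  intro i
  rw [hasFDerivWithinAt_univ]
  refine (h i).hasFDerivAt.congr_fderiv ?_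
  ext
  simp

lemma hasDerivAt_line {G : Type*} [NormedAddCommGroup G] [NormedSpace ℝ G] {F : ℂ → G} {z : ℂ}
    (h : DifferentiableAt ℝ F z) (v : ℂ) :
    HasDerivAt (fun t : ℝ => F (z + t • v)) (fderiv ℝ F z v) 0 := by
  have h1 : HasDerivAt (fun t : ℝ => z + t • v) v 0 := by
    simpa using ((hasDerivAt_id (0 : ℝ)).smul_const v).const_add z
  have h2 : HasFDerivAt F (fderiv ℝ F z) (z + (0 : ℝ) • v) := by simpa using h.hasFDerivAt
  exact h2.comp_hasDerivAt (0 : ℝ) h1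

lemma fderiv_stereo (z : ℂ) :
    fderiv ℝ stereo z 1 = stereoRe z ∧ fderiv ℝ stereo z Complex.I = stereoIm z := by
  have hd : DifferentiableAt ℝ stereo z := (contDiff_stereo.differentiable (by simp)) z
  have hs := (stereoDenom_pos z).ne'
  constructor
  · refine (hasDerivAt_line hd 1).unique ?_
    refine hasDerivAt_E3 ?_
    have hr : HasDerivAt (fun t : ℝ => z.re + t) 1 0 := (hasDerivAt_id _).const_add _
    have hden : HasDerivAt (fun t : ℝ => stereoDenom (z + t • 1)) (2 * z.re) 0 := by
      have := ((hr.pow 2).const_add 1).add_const (z.im ^ 2)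
      simpa [stereoDenom] using! this
    have hs' : stereoDenom (z + (0 : ℝ) • 1) ≠ 0 := by simpa using hs
    intro i
    fin_cases i
    · have := (hr.const_mul 2).div hden hs'
      simp only [stereo, stereoRe]
      convert! this using 1
      · funext t; simp
      · simp; field_simp; unfold stereoDenom; ring
    · have := (hasDerivAt_const (0 : ℝ) (2 * z.im)).div hden hs'
      simp only [stereo, stereoRe]
      convert! this using 1
      · funext t; simp
      · simp; ring
    · have := (hden.sub_const 2).div hden hs'
      simp only [stereo, stereoRe]
      convert! this using 1
      simp; field_simp; ring
  · refine (hasDerivAt_line hd Complex.I).unique ?_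
    refine hasDerivAt_E3 ?_
    have hr : HasDerivAt (fun t : ℝ => z.im + t) 1 0 := (hasDerivAt_id _).const_add _
    have hden : HasDerivAt (fun t : ℝ => stereoDenom (z + t • Complex.I)) (2 * z.im) 0 := by
      have := (hr.pow 2).const_add (1 + z.re ^ 2)
      simpa [stereoDenom] using! this
    have hs' : stereoDenom (z + (0 : ℝ) • Complex.I) ≠ 0 := by simpa using hs
    intro i
    fin_cases i
    · have := (hasDerivAt_const (0 : ℝ) (2 * z.re)).div hden hs'
      simp only [stereo, stereoIm]
      convert! this using 1
      · funext t; simp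
      · simp; ring
    · have := (hr.const_mul 2).div hden hs'
      simp only [stereo, stereoIm]
      convert! this using 1
      · funext t; simp
      · simp; field_simp; unfold stereoDenom; ring
    · have := (hden.sub_const 2).div hden hs'
      simp only [stereo, stereoIm]
      convert! this using 1
      simp; field_simp; ring

/-- The product of a real vector with the null vector `((1 - z²)/2, i(1 + z²)/2, z)`, which is
`(1 + |z|²)²/4` times the derivative of `stereo` along the real axis plus `i` times the derivative
along the imaginary axis. -/
def nullPair (z : ℂ) (v : E3) : ℂ :=
  v 0 * ((1 - z ^ 2) / 2) + v 1 * (Complex.I * (1 + z ^ 2) / 2) + v 2 * z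

/-- The two coordinate vectors are orthogonal with squared length 4/(1 + |z|²)². For tangent `v` the
real and imaginary parts are thus the components of `v` in the coordinate basis: `nullPair z v` is
the value dz(v) of the stereographic coordinate form, written without denominators. -/
lemma nullPair_eq (z : ℂ) (v : E3) :
    nullPair z v = (stereoDenom z ^ 2 / 4 * inner ℝ v (stereoRe z) : ℝ)
      + (stereoDenom z ^ 2 / 4 * inner ℝ v (stereoIm z) : ℝ) * Complex.I := by
  have hs := (stereoDenom_pos z).ne'
  have e1 : stereoDenom z ^ 2 / 4 * inner ℝ v (stereoRe z) =
      v 0 * (1 - z.re ^ 2 + z.im ^ 2) / 2 - v 1 * z.re * z.im + v 2 * z.re := by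
    rw [inner_eq]
    simp only [stereoRe, PiLp.toLp_apply, Matrix.cons_val]
    field_simp
    ring
  have e2 : stereoDenom z ^ 2 / 4 * inner ℝ v (stereoIm z) =
      - v 0 * z.re * z.im + v 1 * (1 + z.re ^ 2 - z.im ^ 2) / 2 + v 2 * z.im := by
    rw [inner_eq]
    simp only [stereoIm, PiLp.toLp_apply, Matrix.cons_val]
    field_simp
    ring
  rw [e1, e2, nullPair]
  apply Complex.ext
  · simp [pow_two]; ring
  · simp [pow_two]; ring

/-- The real part, the imaginary part and tangency are three linear equations for the difference
`d`. Their coefficient vectors are mutually orthogonal multiples of `stereoRe z`, `stereoIm z` and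
`stereo z`; recombining the equations with these coefficients isolates (1 + |z|²)² times each
component of `d`. -/
lemma eq_of_nullPair_eq {z : ℂ} {v w : E3} (hv : Tangent (stereo z) v) (hw : Tangent (stereo z) w)
    (h : nullPair z v = nullPair z w) : v = w := by
  have hs := (stereoDenom_pos z).ne'
  have hvw : inner ℝ (stereo z) (v - w) = 0 := by
    rw [inner_sub_right, show inner ℝ (stereo z) v = 0 from hv,
      show inner ℝ (stereo z) w = 0 from hw, sub_zero]
  have h0 : nullPair z (v - w) = 0 := by
    have : nullPair z (v - w) = nullPair z v - nullPair z w := by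
      simp [nullPair]; ring
    rw [this, h, sub_self]
  rw [← sub_eq_zero]
  generalize v - w = d at *
  rw [nullPair] at h0
  have hA := congrArg Complex.re h0
  have hB := congrArg Complex.im h0
  have hC : 2 * z.re * d 0 + 2 * z.im * d 1 + (stereoDenom z - 2) * d 2 = 0 := by
    rw [inner_eq] at hvw
    simp only [stereo, PiLp.toLp_apply, Matrix.cons_val] at hvw
    field_simp at hvw
    linarith
  simp [pow_two] at hA hB
  have hpos : stereoDenom z ^ 2 ≠ 0 := pow_ne_zero _ hs
  unfold stereoDenom at hC hpos
  refine ext_three ?_ ?_ ?_ <;> refine mul_left_cancel₀ hpos ?_ <;>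
    simp only [PiLp.zero_apply, mul_zero]
  · linear_combination 2 * (1 - z.re ^ 2 + z.im ^ 2) * hA - 4 * z.re * z.im * hB + 2 * z.re * hC
  · linear_combination 2 * (1 + z.re ^ 2 - z.im ^ 2) * hB - 4 * z.re * z.im * hA + 2 * z.im * hC
  · linear_combination 4 * z.re * hA + 4 * z.im * hB + (z.re ^ 2 + z.im ^ 2 - 1) * hC

lemma exists_bound_of_smoothOnSphere {G : Type*} [NormedAddCommGroup G] [NormedSpace ℝ G]
    {f : E3 → G} (hf : SmoothOnSphere f) : ∃ C, ∀ x : E3, ‖x‖ = 1 → ‖f x‖ ≤ C := by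
  have hc : ContinuousOn (radExt f) (Metric.sphere 0 1) := by
    refine (ContDiffOn.continuousOn hf).mono fun x hx => ?_
    exact ne_zero_of_norm_eq_one (by simpa using hx)
  obtain ⟨C, hC⟩ := (isCompact_sphere (0 : E3) 1).exists_bound_of_continuousOn hc
  refine ⟨C, fun x hx => ?_⟩
  rw [← radExt_of_norm_eq_one f hx]
  exact hC x (by simpa using hx)

/-- The stereographic representation of a conformal Killing vector is holomorphic. -/
lemma differentiable_nullPair {f : E3 → E3} (hf : IsConformalKilling f) :
    Differentiable ℂ fun z => nullPair z (f (stereo z)) := by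
  intro z
  rw [differentiableAt_complex_iff_differentiableAt_real]
  have hx := norm_stereo z
  have hs : HasFDerivAt stereo (fderiv ℝ stereo z) z :=
    ((contDiff_stereo.differentiable (by simp)) z).hasFDerivAt
  have hfs : HasFDerivAt (fun z => f (stereo z))
      ((sphD f (stereo z)).comp (fderiv ℝ stereo z)) z := by
    have := (hf.1.1.hasFDerivAt hx).comp z hs
    refine this.congr_of_eventuallyEq (Eventually.of_forall fun w => ?_)
    exact (radExt_of_norm_eq_one f (norm_stereo w)).symm
  have hcomp : ∀ i, HasFDerivAt (fun z => ((f (stereo z) i : ℝ) : ℂ))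
      (Complex.ofRealCLM.comp ((EuclideanSpace.proj i).comp
        ((sphD f (stereo z)).comp (fderiv ℝ stereo z)))) z := by
    intro i
    exact (Complex.ofRealCLM.comp (EuclideanSpace.proj i : E3 →L[ℝ] ℝ)).hasFDerivAt.comp z hfs
  have hz : ∀ {m : ℂ → ℂ} {m' : ℂ}, HasDerivAt m m' z →
      HasFDerivAt m (((ContinuousLinearMap.toSpanSingleton ℂ m')).restrictScalars ℝ) z :=
    fun hm => hm.hasFDerivAt.restrictScalars ℝ
  have d0 : HasDerivAt (fun z : ℂ => (1 - z ^ 2) / 2) (-z) z := by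
    convert! (((hasDerivAt_id z).pow 2).const_sub 1).div_const 2 using 1
    simp; ring
  have d1 : HasDerivAt (fun z : ℂ => Complex.I * (1 + z ^ 2) / 2) (Complex.I * z) z := by
    convert! ((((hasDerivAt_id z).pow 2).const_add 1).const_mul Complex.I).div_const 2 using 1
    simp; ring
  have d2 := hasDerivAt_id' z
  have hF := (((hcomp 0).mul (hz d0)).add ((hcomp 1).mul (hz d1))).add ((hcomp 2).mul (hz d2))
  have hF' : HasFDerivAt (fun z => nullPair z (f (stereo z))) _ z := hF
  refine ⟨hF'.differentiableAt, ?_⟩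
  -- What remains is complex linearity of the real derivative. The term in which the null vector is
  -- differentiated is a complex multiple of `v`, so only the term with the differential of `f`
  -- needs the conformal Killing equation.
  have hval : ∀ v : ℂ, fderiv ℝ (fun z => nullPair z (f (stereo z))) z v =
      nullPair z (sphD f (stereo z) (fderiv ℝ stereo z v)) +
      (f (stereo z) 0 * -z + f (stereo z) 1 * (Complex.I * z) + f (stereo z) 2) * v := by
    intro v
    rw [hF'.fderiv]
    simp [nullPair]
    ring
  rw [hval, hval, smul_eq_mul, mul_one, mul_add, mul_comm Complex.I (_ + _ + _), (fderiv_stereo z).1,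
    (fderiv_stereo z).2]
  congr 1
  rw [nullPair_eq, nullPair_eq]
  have hne := (stereoDenom_pos z).ne'
  have t1 : Tangent (stereo z) (stereoRe z) := by
    rw [Tangent, inner_eq]
    simp only [stereo, stereoRe, PiLp.toLp_apply, Matrix.cons_val]
    field_simp; unfold stereoDenom; ring
  have t2 : Tangent (stereo z) (stereoIm z) := by
    rw [Tangent, inner_eq]
    simp only [stereo, stereoIm, PiLp.toLp_apply, Matrix.cons_val]
    field_simp; unfold stereoDenom; ring
  have n12 : inner ℝ (stereoRe z) (stereoIm z) = 0 := by
    rw [inner_eq]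
    simp only [stereoRe, stereoIm, PiLp.toLp_apply, Matrix.cons_val]
    field_simp; unfold stereoDenom; ring
  have n11 : inner ℝ (stereoRe z) (stereoRe z) = inner ℝ (stereoIm z) (stereoIm z) := by
    rw [inner_eq, inner_eq]
    simp only [stereoRe, stereoIm, PiLp.toLp_apply, Matrix.cons_val]
    field_simp; ring
  -- On the two coordinate vectors, which are orthogonal and of equal length, the conformal Killing
  -- equation becomes the pair `c1`, `c2` of Cauchy–Riemann equations.
  have k12 := hf.2 _ hx _ _ t1 t2
  have k11 := hf.2 _ hx _ _ t1 t1
  have k22 := hf.2 _ hx _ _ t2 t2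
  rw [real_inner_comm] at k11 k22
  rw [n12] at k12
  rw [n11] at k11
  have c1 : inner ℝ (sphD f (stereo z) (stereoRe z)) (stereoRe z) =
      inner ℝ (sphD f (stereo z) (stereoIm z)) (stereoIm z) := by
    rw [real_inner_comm] at k11 k22
    linarith [real_inner_comm (sphD f (stereo z) (stereoRe z)) (stereoRe z),
      real_inner_comm (sphD f (stereo z) (stereoIm z)) (stereoIm z)]
  have c2 : inner ℝ (sphD f (stereo z) (stereoRe z)) (stereoIm z) =
      - inner ℝ (sphD f (stereo z) (stereoIm z)) (stereoRe z) := by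
    linarith [real_inner_comm (sphD f (stereo z) (stereoIm z)) (stereoRe z)]
  rw [c1, c2]
  apply Complex.ext
  · simp
  · simp; ring

/-- The conformal Killing vector with rotational part `a` and boost part `b`. -/
def killingField (a b x : E3) : E3 := cross a x + b - inner ℝ b x • x

lemma tangent_killingField (a b : E3) {x : E3} (hx : ‖x‖ = 1) :
    Tangent x (killingField a b x) := by
  have h := norm_sq_eq x
  rw [hx] at h
  simp only [Tangent, killingField, inner_eq, PiLp.add_apply, PiLp.sub_apply, PiLp.smul_apply,
    cross_zero', cross_one', cross_two', smul_eq_mul]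
  linear_combination (b 0 * x 0 + b 1 * x 1 + b 2 * x 2) * h

lemma contDiff_killingField (a b : E3) : ContDiff ℝ ∞ (killingField a b) := by
  have : ContDiff ℝ ∞ (cross a) := by
    rw [contDiff_euclidean]
    intro i
    fin_cases i <;> simp <;> fun_prop
  exact (this.add contDiff_const).sub ((contDiff_const.inner ℝ contDiff_id).smul contDiff_id)

/-- The quadratic polynomial depends on a and b only through the complex vector B = b + ia. If its
coefficients are c₀, c₁, c₂, then B₀ = c₀ - c₂, B₁ = -i(c₀ + c₂) and B₂ = c₁, so every quadratic
polynomial occurs. -/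
lemma nullPair_killingField (a b : E3) (z : ℂ) :
    nullPair z (killingField a b (stereo z)) =
      ((b 0 + Complex.I * a 0) + Complex.I * (b 1 + Complex.I * a 1)) / 2
      + (b 2 + Complex.I * a 2) * z
      + (-(b 0 + Complex.I * a 0) + Complex.I * (b 1 + Complex.I * a 1)) / 2 * z ^ 2 := by
  have hne := (stereoDenom_pos z).ne'
  apply Complex.ext
  · simp [nullPair, killingField, inner_eq, stereo, pow_two]
    field_simp
    unfold stereoDenom
    ring
  · simp [nullPair, killingField, inner_eq, stereo, pow_two]
    field_simp
    unfold stereoDenom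
    ring

/-- Every conformal Killing vector of the sphere is a sum of a rotation and a boost. -/
theorem IsConformalKilling.exists_killingField {f : E3 → E3} (hf : IsConformalKilling f) :
    ∃ a b : E3, ∀ x : E3, ‖x‖ = 1 → f x = killingField a b x := by
  obtain ⟨C, hC⟩ := exists_bound_of_smoothOnSphere hf.1.1
  -- `f` is bounded on the compact sphere, and the entries of the null vector grow at most like 1 +
  -- |z|².
  have hgrowth : ∀ z, ‖nullPair z (f (stereo z))‖ ≤ (3 * C) * (1 + ‖z‖ ^ 2) := by
    intro z
    have hv := hC _ (norm_stereo z)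
    have hi : ∀ i, ‖((f (stereo z) i : ℝ) : ℂ)‖ ≤ C := fun i => by
      rw [Complex.norm_real]; exact (PiLp.norm_apply_le _ i).trans hv
    have hC0 : 0 ≤ C := (norm_nonneg _).trans hv
    have h0 : ‖(1 - z ^ 2) / 2‖ ≤ 1 + ‖z‖ ^ 2 := by
      rw [norm_div]
      have := norm_sub_le 1 (z ^ 2)
      simp at this ⊢
      linarith [sq_nonneg ‖z‖]
    have h1 : ‖Complex.I * (1 + z ^ 2) / 2‖ ≤ 1 + ‖z‖ ^ 2 := by
      rw [norm_div, norm_mul]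
      have := norm_add_le 1 (z ^ 2)
      simp at this ⊢
      linarith [sq_nonneg ‖z‖]
    have h2 : ‖z‖ ≤ 1 + ‖z‖ ^ 2 := by nlinarith [sq_nonneg (‖z‖ - 1), norm_nonneg z]
    calc ‖nullPair z (f (stereo z))‖ ≤ ‖((f (stereo z) 0 : ℝ) : ℂ) * ((1 - z ^ 2) / 2)‖
          + ‖((f (stereo z) 1 : ℝ) : ℂ) * (Complex.I * (1 + z ^ 2) / 2)‖
          + ‖((f (stereo z) 2 : ℝ) : ℂ) * z‖ := norm_add₃_le
      _ ≤ C * (1 + ‖z‖ ^ 2) + C * (1 + ‖z‖ ^ 2) + C * (1 + ‖z‖ ^ 2) := by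
        rw [norm_mul, norm_mul, norm_mul]
        gcongr
        · exact hi 0
        · exact hi 1
        · exact hi 2
      _ = (3 * C) * (1 + ‖z‖ ^ 2) := by ring
  obtain ⟨c₀, c₁, c₂, hF⟩ := exists_quadratic_of_growth (differentiable_nullPair hf) hgrowth
  -- The inverse of the relation between the polynomial and the vector b + ia in
  -- `nullPair_killingField`.
  set B₀ : ℂ := c₀ - c₂ with hB₀
  set B₁ : ℂ := -Complex.I * (c₀ + c₂) with hB₁
  let a : E3 := !₂[B₀.im, B₁.im, c₁.im]
  let b : E3 := !₂[B₀.re, B₁.re, c₁.re]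
  have e0 : (b 0 : ℂ) + Complex.I * a 0 = B₀ := by
    apply Complex.ext <;> simp [a, b]
  have e1 : (b 1 : ℂ) + Complex.I * a 1 = B₁ := by
    apply Complex.ext <;> simp [a, b]
  have e2 : (b 2 : ℂ) + Complex.I * a 2 = c₁ := by
    apply Complex.ext <;> simp [a, b]
  have hst : ∀ z, f (stereo z) = killingField a b (stereo z) := by
    intro z
    refine eq_of_nullPair_eq (hf.1.2 _ (norm_stereo z))
      (tangent_killingField a b (norm_stereo z)) ?_
    rw [hF, nullPair_killingField, e0, e1, e2, hB₀, hB₁]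
    linear_combination ((c₀ + c₂) / 2 + (c₀ + c₂) / 2 * z ^ 2) * Complex.I_sq
  have hsurj : ∀ x : E3, ‖x‖ = 1 → x 2 ≠ 1 → ∃ z, stereo z = x := by
    intro x hx h2
    have h := norm_sq_eq x
    rw [hx] at h
    have h3 : 1 - x 2 ≠ 0 := fun h => h2 (by linarith)
    have hd : stereoDenom ⟨x 0 / (1 - x 2), x 1 / (1 - x 2)⟩ = 2 / (1 - x 2) := by
      unfold stereoDenom
      field_simp
      linarith
    refine ⟨⟨x 0 / (1 - x 2), x 1 / (1 - x 2)⟩, ?_⟩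
    refine ext_three ?_ ?_ ?_ <;> simp only [stereo, PiLp.toLp_apply, Matrix.cons_val, hd] <;>
      field_simp
    ring
  refine ⟨a, b, fun x hx => ?_⟩
  by_cases h2 : x 2 = 1
  · have hx0 : x = !₂[0, 0, 1] := by
      have h := norm_sq_eq x
      rw [hx, h2] at h
      have a0 : x 0 = 0 := by nlinarith [sq_nonneg (x 0), sq_nonneg (x 1)]
      have a1 : x 1 = 0 := by nlinarith [sq_nonneg (x 0), sq_nonneg (x 1)]
      exact ext_three (by simpa using a0) (by simpa using a1) (by simpa using h2)
    -- The north pole is not in the image of `stereo`. It is reached by continuity along this curve,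
    -- whose direction differs from the pole for t ≠ 0.
    let y : ℝ → E3 := fun t => !₂[t, 0, 1]
    have hy : Continuous y := by
      rw [← contDiff_zero (𝕜 := ℝ), contDiff_euclidean]
      intro i
      fin_cases i
      · exact contDiff_id
      · exact contDiff_const
      · exact contDiff_const
    have hy0 : ∀ t, y t ≠ 0 := fun t h => by simpa [y] using congrArg (fun v : E3 => v 2) h
    have c1 : Continuous fun t => radExt f (y t) :=
      (ContDiffOn.continuousOn hf.1.1).comp_continuous hy hy0
    have c2 : Continuous fun t => radExt (killingField a b) (y t) :=
      (ContDiffOn.continuousOn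
        (smoothOnSphere_of_contDiff (contDiff_killingField a b))).comp_continuous hy hy0
    have hev : ∀ t ∈ ({0}ᶜ : Set ℝ), radExt f (y t) = radExt (killingField a b) (y t) := by
      intro t ht
      have hn := norm_dir (hy0 t)
      obtain ⟨z, hz⟩ := hsurj (dir (y t)) hn (fun h => by
        have hq := norm_sq_eq (dir (y t))
        rw [hn, h] at hq
        have h00 : dir (y t) 0 = 0 := by nlinarith [sq_nonneg (dir (y t) 0), sq_nonneg (dir (y t) 1)]
        rcases mul_eq_zero.1 (show ‖y t‖⁻¹ * t = 0 from h00) with h00 | h00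
        · exact hy0 t (by simpa using h00)
        · exact ht h00)
      rw [radExt_apply, radExt_apply, ← hz, hst]
    have := Continuous.ext_on (dense_compl_singleton (0 : ℝ)) c1 c2 hev
    have h := congrFun this 0
    have hy00 : y 0 = x := hx0.symm
    simpa only [hy00, radExt_of_norm_eq_one _ hx] using h
  · obtain ⟨z, rfl⟩ := hsurj x hx h2
    exact hst z

/-! ### The flow of a conformal Killing vector -/

/-- The cross product as a continuous linear map. -/
def crossL (a : E3) : E3 →L[ℝ] E3 :=
  LinearMap.toContinuousLinearMap
    { toFun := cross a
      map_add' := fun v w => by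
        refine ext_three ?_ ?_ ?_ <;> simp <;> ring
      map_smul' := fun c v => by
        refine ext_three ?_ ?_ ?_ <;> simp <;> ring }

@[simp] lemma crossL_apply (a v : E3) : crossL a v = cross a v := rfl

lemma inner_cross_self (a v : E3) : inner ℝ (cross a v) v = 0 := by
  rw [inner_eq]; simp; ring

lemma inner_cross_anti (a v w : E3) : inner ℝ (cross a v) w = - inner ℝ v (cross a w) := by
  rw [inner_eq, inner_eq]; simp; ring

lemma hasFDerivAt_killingField (a b x : E3) :
    HasFDerivAt (killingField a b)
      (crossL a - ((inner ℝ b x : ℝ) • ContinuousLinearMap.id ℝ E3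
        + (innerSL ℝ b).smulRight x)) x := by
  have h1 : HasFDerivAt (fun x => inner ℝ b x • x)
      ((inner ℝ b x : ℝ) • ContinuousLinearMap.id ℝ E3 + (innerSL ℝ b).smulRight x) x :=
    (innerSL ℝ b).hasFDerivAt.smul (hasFDerivAt_id x)
  exact ((crossL a).hasFDerivAt.add_const b).sub h1

lemma sphD_killingField (a b : E3) {x : E3} (hx : ‖x‖ = 1) {v : E3} (hv : Tangent x v) :
    sphD (killingField a b) x v = cross a v - inner ℝ b x • v - inner ℝ b v • x := by
  rw [sphD_eq_of_hasFDerivAt hx (hasFDerivAt_killingField a b x)]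
  simp [tanProj_of_tangent hv]
  abel

/-- The rotation is antisymmetric and has no trace; the boost contributes -⟨b, x⟩ in each of the two
tangent directions. -/
lemma sphDiv_killingField (a b : E3) {x : E3} (hx : ‖x‖ = 1) :
    sphDiv (killingField a b) x = -2 * inner ℝ b x := by
  obtain ⟨e₁, e₂, h⟩ := exists_frame hx
  rw [h.sphDiv_eq, sphD_killingField a b hx h.tangent_fst, sphD_killingField a b hx h.tangent_snd]
  simp only [inner_sub_left, inner_smul_left, inner_cross_self, real_inner_self_eq_norm_sq,
    h.norm_fst, h.norm_snd, show inner ℝ x e₁ = 0 from h.tangent_fst,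
    show inner ℝ x e₂ = 0 from h.tangent_snd]
  simp
  ring

lemma hasDerivAt_fst {G G' : Type*} [NormedAddCommGroup G] [NormedSpace ℝ G]
    [NormedAddCommGroup G'] [NormedSpace ℝ G'] {γ : ℝ → G × G'} {γ' : G × G'} {t : ℝ}
    (h : HasDerivAt γ γ' t) : HasDerivAt (fun t => (γ t).1) γ'.1 t :=
  (ContinuousLinearMap.fst ℝ G G').hasFDerivAt.comp_hasDerivAt t h

lemma hasDerivAt_snd {G G' : Type*} [NormedAddCommGroup G] [NormedSpace ℝ G]
    [NormedAddCommGroup G'] [NormedSpace ℝ G'] {γ : ℝ → G × G'} {γ' : G × G'} {t : ℝ}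
    (h : HasDerivAt γ γ' t) : HasDerivAt (fun t => (γ t).2) γ'.2 t :=
  (ContinuousLinearMap.snd ℝ G G').hasFDerivAt.comp_hasDerivAt t h

/-- The Minkowski product on `ℝ × E3`. -/
def minkowski (p q : ℝ × E3) : ℝ := p.1 * q.1 - inner ℝ p.2 q.2

/-- The infinitesimal Lorentz transformation with rotational part `a` and boost part `b`. -/
def lorentzGen (a b : E3) : (ℝ × E3) →L[ℝ] (ℝ × E3) :=
  ((innerSL ℝ b).comp (ContinuousLinearMap.snd ℝ ℝ E3)).prod
    ((ContinuousLinearMap.fst ℝ ℝ E3).smulRight b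
      + (crossL a).comp (ContinuousLinearMap.snd ℝ ℝ E3))

@[simp] lemma lorentzGen_apply (a b : E3) (p : ℝ × E3) :
    lorentzGen a b p = (inner ℝ b p.2, p.1 • b + cross a p.2) := by
  simp [lorentzGen]

/-- The one-parameter group of Lorentz transformations generated by `lorentzGen a b`. -/
def lorentz (a b : E3) (t : ℝ) : (ℝ × E3) →L[ℝ] (ℝ × E3) :=
  NormedSpace.exp (t • lorentzGen a b)

lemma exp_add_smul {𝔸 : Type*} [NormedRing 𝔸] [NormedAlgebra ℝ 𝔸] [CompleteSpace 𝔸] (s t : ℝ)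
    (x : 𝔸) :
    NormedSpace.exp ((s + t) • x) = NormedSpace.exp (s • x) * NormedSpace.exp (t • x) := by
  let _ : NormedAlgebra ℚ 𝔸 := NormedAlgebra.restrictScalars ℚ ℝ 𝔸
  rw [add_smul, NormedSpace.exp_add_of_commute]
  exact ((Commute.refl x).smul_left s).smul_right t

section Lorentz

variable (a b : E3)

lemma lorentz_zero : lorentz a b 0 = 1 := by
  rw [lorentz, zero_smul ℝ (lorentzGen a b), NormedSpace.exp_zero]

lemma lorentz_add (s t : ℝ) (p : ℝ × E3) :
    lorentz a b (s + t) p = lorentz a b s (lorentz a b t p) := by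
  have : lorentz a b (s + t) = lorentz a b s * lorentz a b t := by
    exact exp_add_smul s t (lorentzGen a b)
  rw [this]; rfl

lemma lorentz_neg (t : ℝ) (p : ℝ × E3) : lorentz a b (-t) (lorentz a b t p) = p := by
  rw [← lorentz_add, neg_add_cancel, lorentz_zero]; rfl

lemma hasDerivAt_lorentz (t : ℝ) :
    HasDerivAt (lorentz a b) (lorentzGen a b * lorentz a b t) t :=
  hasDerivAt_exp_smul_const' (lorentzGen a b) t

lemma hasDerivAt_lorentz_apply (p : ℝ × E3) (t : ℝ) :
    HasDerivAt (fun t => lorentz a b t p) (lorentzGen a b (lorentz a b t p)) t :=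
  (hasDerivAt_lorentz a b t).clm_apply (hasDerivAt_const t p) |>.congr_deriv (by simp)

lemma contDiff_lorentz : ContDiff ℝ ∞ (lorentz a b) := by
  have h : ContDiff ℝ ∞ (NormedSpace.exp : ((ℝ × E3) →L[ℝ] (ℝ × E3)) → _) :=
    contDiff_iff_contDiffAt.2 fun x => (NormedSpace.exp_analytic (𝕂 := ℝ) x).contDiffAt
  exact h.comp (contDiff_id.smul contDiff_const)

/-- The generator is antisymmetric for the Minkowski product, so the product of two orbits has
derivative zero. -/
lemma minkowski_lorentz (t : ℝ) (p q : ℝ × E3) :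
    minkowski (lorentz a b t p) (lorentz a b t q) = minkowski p q := by
  have hd : ∀ t, HasDerivAt (fun t => minkowski (lorentz a b t p) (lorentz a b t q)) 0 t := by
    intro t
    have hp := hasDerivAt_lorentz_apply a b p t
    have hq := hasDerivAt_lorentz_apply a b q t
    have := ((hasDerivAt_fst hp).mul (hasDerivAt_fst hq)).sub
      ((hasDerivAt_snd hp).inner ℝ (hasDerivAt_snd hq))
    refine this.congr_deriv ?_
    simp only [lorentzGen_apply, inner_add_left, inner_add_right, inner_smul_left,
      inner_smul_right, inner_cross_anti]
    simp only [conj_trivial, real_inner_comm b]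
    ring
  have := is_const_of_deriv_eq_zero (fun t => (hd t).differentiableAt) (fun t => (hd t).deriv) t 0
  simpa [lorentz_zero] using this

/-- The energy component of the image of the null vector `(1, x)`. -/
def lorentzFst (t : ℝ) (x : E3) : ℝ := (lorentz a b t (1, x)).1

/-- The momentum component of the image of the null vector `(1, x)`. -/
def lorentzSnd (t : ℝ) (x : E3) : E3 := (lorentz a b t (1, x)).2

/-- The action of a Lorentz transformation on the sphere of null directions. -/
def lorentzMap (t : ℝ) (x : E3) : E3 := (lorentzFst a b t x)⁻¹ • lorentzSnd a b t x

/-- The conformal factor of a Lorentz transformation. -/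
def lorentzFactor (t : ℝ) (x : E3) : ℝ := (lorentzFst a b t x)⁻¹

lemma contDiff_lorentzFst : ContDiff ℝ ∞ (fun p : ℝ × E3 => lorentzFst a b p.1 p.2) :=
  contDiff_fst.comp (((contDiff_lorentz a b).comp contDiff_fst).clm_apply
    (contDiff_const.prodMk contDiff_snd))

lemma contDiff_lorentzSnd : ContDiff ℝ ∞ (fun p : ℝ × E3 => lorentzSnd a b p.1 p.2) :=
  contDiff_snd.comp (((contDiff_lorentz a b).comp contDiff_fst).clm_apply
    (contDiff_const.prodMk contDiff_snd))

variable {x : E3} (hx : ‖x‖ = 1)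
include hx

lemma norm_lorentzSnd_sq (t : ℝ) : ‖lorentzSnd a b t x‖ ^ 2 = lorentzFst a b t x ^ 2 := by
  have := minkowski_lorentz a b t (1, x) (1, x)
  simp only [minkowski, real_inner_self_eq_norm_sq, hx] at this
  unfold lorentzSnd lorentzFst
  linarith

lemma lorentzFst_ne_zero (t : ℝ) : lorentzFst a b t x ≠ 0 := by
  intro h
  have h1 := norm_lorentzSnd_sq a b hx t
  rw [h] at h1
  have h2 : lorentzSnd a b t x = 0 := by simpa using h1
  have h3 : lorentz a b t (1, x) = 0 := Prod.ext h h2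
  have h4 := lorentz_neg a b t (1, x)
  rw [h3, map_zero] at h4
  simpa using congrArg Prod.fst h4

/-- The energy is continuous in t, equals 1 at t = 0, and cannot vanish: a null vector without
energy is 0, and an invertible map does not send (1, x) to 0. -/
lemma lorentzFst_pos (t : ℝ) : 0 < lorentzFst a b t x := by
  by_contra! hneg
  have hc : Continuous fun t => lorentzFst a b t x :=
    (contDiff_lorentzFst a b).continuous.comp (Continuous.prodMk_left x)
  have h0 : lorentzFst a b 0 x = 1 := by simp [lorentzFst, lorentz_zero]
  obtain ⟨s, hs⟩ := mem_range_of_exists_le_of_exists_ge hc ⟨t, hneg⟩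
    ⟨0, by rw [h0]; exact zero_le_one⟩
  exact lorentzFst_ne_zero a b hx s hs

lemma norm_lorentzMap (t : ℝ) : ‖lorentzMap a b t x‖ = 1 := by
  have h := norm_lorentzSnd_sq a b hx t
  have hpos := lorentzFst_pos a b hx t
  rw [sq_eq_sq₀ (norm_nonneg _) hpos.le] at h
  rw [lorentzMap, norm_smul, h, norm_inv, Real.norm_of_nonneg hpos.le, inv_mul_cancel₀ hpos.ne']

omit hx in
lemma lorentzMap_zero (x : E3) : lorentzMap a b 0 x = x := by
  simp [lorentzMap, lorentzFst, lorentzSnd, lorentz_zero]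

omit hx in
lemma lorentzFst_zero (x : E3) : lorentzFst a b 0 x = 1 := by
  simp [lorentzFst, lorentz_zero]

/-- The null vector (1, x) goes to a multiple of (1, φ_t(x)). By linearity this gives the group law
of φ_t and the cocycle law of the energy. -/
lemma lorentz_eq_smul (t : ℝ) :
    lorentz a b t (1, x) = lorentzFst a b t x • ((1 : ℝ), lorentzMap a b t x) := by
  have h := lorentzFst_ne_zero a b hx t
  refine Prod.ext ?_ ?_
  · simp [lorentzFst]
  · simp only [Prod.smul_snd, lorentzMap, smul_smul, mul_inv_cancel₀ h, one_smul]; rfl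

lemma lorentzFst_add (s t : ℝ) :
    lorentzFst a b (s + t) x = lorentzFst a b t x * lorentzFst a b s (lorentzMap a b t x) := by
  rw [lorentzFst, lorentz_add, lorentz_eq_smul a b hx, map_smul]; rfl

lemma lorentzMap_add (s t : ℝ) :
    lorentzMap a b (s + t) x = lorentzMap a b s (lorentzMap a b t x) := by
  have h := lorentzFst_ne_zero a b hx t
  have h2 : lorentzSnd a b (s + t) x =
      lorentzFst a b t x • lorentzSnd a b s (lorentzMap a b t x) := by
    rw [lorentzSnd, lorentz_add, lorentz_eq_smul a b hx, map_smul]; rfl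
  rw [lorentzMap, lorentzFst_add a b hx, h2, smul_smul, mul_inv, mul_right_comm,
    inv_mul_cancel₀ h, one_mul]
  rfl

lemma hasDerivAt_lorentzFst (t : ℝ) : HasDerivAt (fun t => lorentzFst a b t x)
    (lorentzFst a b t x * inner ℝ b (lorentzMap a b t x)) t := by
  have h := hasDerivAt_fst (hasDerivAt_lorentz_apply a b (1, x) t)
  refine h.congr_deriv ?_
  rw [lorentz_eq_smul a b hx, map_smul]
  simp

/-- In the derivative of momentum divided by energy, the linear equation contributes b + a × y and
the derivative of the energy contributes -⟨b, y⟩y. -/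
lemma hasDerivAt_lorentzMap (t : ℝ) : HasDerivAt (fun t => lorentzMap a b t x)
    (killingField a b (lorentzMap a b t x)) t := by
  have h := hasDerivAt_snd (hasDerivAt_lorentz_apply a b (1, x) t)
  have h1 := hasDerivAt_lorentzFst a b hx t
  have hne := lorentzFst_ne_zero a b hx t
  refine ((h1.inv hne).smul h).congr_deriv ?_
  simp only [Pi.inv_apply]
  rw [lorentz_eq_smul a b hx, map_smul]
  simp only [lorentzGen_apply, Prod.smul_snd, killingField, smul_smul, inv_mul_cancel₀ hne, one_smul]
  rw [show -(lorentzFst a b t x * inner ℝ b (lorentzMap a b t x)) / lorentzFst a b t x ^ 2 *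
    lorentzFst a b t x = - inner ℝ b (lorentzMap a b t x) by field_simp, neg_smul]
  abel

omit hx in
lemma contDiffOn_radExt_lorentzFst :
    ContDiffOn ℝ ∞ (fun p : ℝ × E3 => lorentzFst a b p.1 (dir p.2)) (Set.univ ×ˢ {0}ᶜ) :=
  (contDiff_lorentzFst a b).comp_contDiffOn
    (contDiffOn_fst.prodMk (contDiffOn_dir.comp contDiffOn_snd fun _ hp => hp.2))

omit hx in
lemma contDiffOn_radExt_lorentzFactor :
    ContDiffOn ℝ ∞ (fun p : ℝ × E3 => radExt (lorentzFactor a b p.1) p.2) (Set.univ ×ˢ {0}ᶜ) :=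
  (contDiffOn_radExt_lorentzFst a b).inv fun p hp =>
    lorentzFst_ne_zero a b (norm_dir hp.2) p.1

omit hx in
lemma contDiffOn_radExt_lorentzMap :
    ContDiffOn ℝ ∞ (fun p : ℝ × E3 => radExt (lorentzMap a b p.1) p.2) (Set.univ ×ˢ {0}ᶜ) :=
  (contDiffOn_radExt_lorentzFactor a b).smul ((contDiff_lorentzSnd a b).comp_contDiffOn
    (contDiffOn_fst.prodMk (contDiffOn_dir.comp contDiffOn_snd fun _ hp => hp.2)))

omit hx in
lemma smoothOnSphere_of_joint {G : Type*} [NormedAddCommGroup G] [NormedSpace ℝ G]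
    {φ : ℝ → E3 → G}
    (h : ContDiffOn ℝ ∞ (fun p : ℝ × E3 => radExt (φ p.1) p.2) (Set.univ ×ˢ {0}ᶜ)) (t : ℝ) :
    SmoothOnSphere (φ t) :=
  h.comp (contDiffOn_const.prodMk contDiffOn_id) fun _ hy => ⟨trivial, hy⟩

/-- For tangent v the vector (0, v) is Minkowski-orthogonal to (1, x), so its image is orthogonal to
the null vector (1, φ_t(x)). The differential of φ_t removes the energy of this image by subtracting
a multiple of that null vector, which changes no Minkowski products, and then divides by the energy
of the image of (1, x). -/
lemma lorentzMap_conformal (t : ℝ) {v w : E3} (hv : Tangent x v) (hw : Tangent x w) :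
    inner ℝ (sphD (lorentzMap a b t) x v) (sphD (lorentzMap a b t) x w)
      = lorentzFactor a b t x ^ 2 * inner ℝ v w := by
  have hne := lorentzFst_ne_zero a b hx t
  have hL : HasFDerivAt (fun x : E3 => lorentz a b t (1, x))
      ((lorentz a b t).comp (ContinuousLinearMap.inr ℝ ℝ E3)) x :=
    (lorentz a b t).hasFDerivAt.comp x (hasFDerivAt_prodMk_right 1 x)
  have h1 := ((hasDerivAt_inv hne).comp_hasFDerivAt x hL.fst).smul hL.snd
  have hD : ∀ v, Tangent x v → sphD (lorentzMap a b t) x v =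
      (lorentzFst a b t x)⁻¹ • ((lorentz a b t (0, v)).2 -
        (lorentz a b t (0, v)).1 • lorentzMap a b t x) := by
    intro v hv
    rw [sphD_eq_of_hasFDerivAt (F := lorentzMap a b t) hx h1]
    simp only [lorentzMap, lorentzSnd]
    simp [tanProj_of_tangent hv, smul_smul, sub_eq_add_neg]
    congr 1
    ring
  -- Invariance of the product of (1, x) with (0, v), which is zero.
  have key : ∀ v, Tangent x v → (lorentz a b t (0, v)).1 =
      inner ℝ (lorentzMap a b t x) (lorentz a b t (0, v)).2 := by
    intro v hv
    have := minkowski_lorentz a b t (1, x) (0, v)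
    rw [lorentz_eq_smul a b hx] at this
    simp only [minkowski, Prod.smul_fst, Prod.smul_snd, smul_eq_mul, mul_one, mul_zero,
      inner_smul_left, conj_trivial, show inner ℝ x v = 0 from hv, sub_zero] at this
    have h2 : lorentzFst a b t x * ((lorentz a b t (0, v)).1 -
      inner ℝ (lorentzMap a b t x) (lorentz a b t (0, v)).2) = 0 := by linarith
    rcases mul_eq_zero.1 h2 with h | h
    · exact absurd h hne
    · linarith
  have h2 := minkowski_lorentz a b t (0, v) (0, w)
  simp only [minkowski, zero_mul, zero_sub] at h2
  have hvw : inner ℝ v w = inner ℝ (lorentz a b t (0, v)).2 (lorentz a b t (0, w)).2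
      - (lorentz a b t (0, v)).1 * (lorentz a b t (0, w)).1 := by linarith
  have hn := norm_lorentzMap a b hx t
  rw [hD v hv, hD w hw, hvw, inner_smul_left, inner_smul_right, inner_sub_left, inner_sub_right,
    inner_sub_right, inner_smul_left, inner_smul_left, inner_smul_right, inner_smul_right,
    real_inner_self_eq_norm_sq, hn, ← key w hw, real_inner_comm (lorentzMap a b t x), ← key v hv,
    lorentzFactor]
  simp only [conj_trivial]
  ring

omit hx in
lemma isConformalMap_lorentzMap (t : ℝ) :
    IsConformalMap (lorentzMap a b t) (lorentzFactor a b t) where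
  mapsTo x hx := norm_lorentzMap a b hx t
  smooth := smoothOnSphere_of_joint (contDiffOn_radExt_lorentzMap a b) t
  inverse := by
    refine ⟨lorentzMap a b (-t),
      smoothOnSphere_of_joint (contDiffOn_radExt_lorentzMap a b) (-t), fun x hx => ?_⟩
    refine ⟨norm_lorentzMap a b hx _, ?_, ?_⟩
    · rw [← lorentzMap_add a b hx, neg_add_cancel, lorentzMap_zero]
    · rw [← lorentzMap_add a b hx, add_neg_cancel, lorentzMap_zero]
  factor_smooth := smoothOnSphere_of_joint (contDiffOn_radExt_lorentzFactor a b) t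
  factor_pos x hx := inv_pos.2 (lorentzFst_pos a b hx t)
  conformal x hx v w hv hw := lorentzMap_conformal a b hx t hv hw

end Lorentz

/-! ### The flow of a generator -/

section Flow

variable (a b : E3) (α : E3 → ℝ)

/-- The supertranslation `a_t` of the flow. -/
def lorentzShift (t : ℝ) (x : E3) : ℝ :=
  ∫ s in (0 : ℝ)..t, α (lorentzMap a b s x) / lorentzFactor a b s x

variable {α} (hα : SmoothOnSphere α)
include hα

lemma contDiffOn_shift_integrand :
    ContDiffOn ℝ ∞ (fun p : ℝ × E3 =>
      α (lorentzMap a b p.1 (dir p.2)) / lorentzFactor a b p.1 (dir p.2)) (Set.univ ×ˢ {0}ᶜ) := by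
  have h1 : ContDiffOn ℝ ∞ (fun p : ℝ × E3 => radExt α (radExt (lorentzMap a b p.1) p.2))
      (Set.univ ×ˢ {0}ᶜ) :=
    ContDiffOn.comp (g := radExt α) (t := {0}ᶜ) hα (contDiffOn_radExt_lorentzMap a b) fun p hp =>
      ne_zero_of_norm_eq_one (norm_lorentzMap a b (norm_dir hp.2) p.1)
  refine (h1.div (contDiffOn_radExt_lorentzFactor a b) fun p hp => ?_).congr fun p hp => ?_
  · exact inv_ne_zero (lorentzFst_ne_zero a b (norm_dir hp.2) p.1)
  · simp only [Pi.div_apply, radExt_apply,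
      dir_of_norm_eq_one (norm_lorentzMap a b (norm_dir hp.2) p.1)]

lemma continuous_shift_integrand {x : E3} (hx : ‖x‖ = 1) :
    Continuous fun s => α (lorentzMap a b s x) / lorentzFactor a b s x := by
  have := (contDiffOn_shift_integrand a b hα).continuousOn.comp_continuous
    (Continuous.prodMk_left x) (fun s => ⟨trivial, ne_zero_of_norm_eq_one hx⟩)
  simpa only [Function.comp_def, dir_of_norm_eq_one hx] using this

lemma hasDerivAt_lorentzShift {x : E3} (hx : ‖x‖ = 1) (t : ℝ) :
    HasDerivAt (fun t => lorentzShift a b α t x)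
      (α (lorentzMap a b t x) * lorentzFst a b t x) t := by
  have hc := continuous_shift_integrand a b hα hx
  refine (intervalIntegral.integral_hasDerivAt_right (hc.intervalIntegrable 0 t)
    (hc.stronglyMeasurableAtFilter _ _) hc.continuousAt).congr_deriv ?_
  rw [lorentzFactor, div_inv_eq_mul]

/-- The substitution s ↦ ts turns the integral over [0, t] into t times an integral over the fixed
interval [0, 1], in which t is one of the parameters. -/
lemma contDiffOn_lorentzShift :
    ContDiffOn ℝ ∞ (fun p : ℝ × E3 => radExt (lorentzShift a b α p.1) p.2)
      (Set.univ ×ˢ {0}ᶜ) := by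
  set g : ℝ × E3 → ℝ := fun p =>
    α (lorentzMap a b p.1 (dir p.2)) / lorentzFactor a b p.1 (dir p.2) with hg
  have hg' : ContDiffOn ℝ ∞ g (Set.univ ×ˢ {0}ᶜ) := contDiffOn_shift_integrand a b hα
  have hT : IsOpen ((Set.univ : Set ℝ) ×ˢ ((Set.univ : Set ℝ) ×ˢ ({0}ᶜ : Set E3))) :=
    isOpen_univ.prod (isOpen_univ.prod isOpen_compl_singleton)
  have h1 : ContDiffOn ℝ ∞ (fun q : ℝ × ℝ × E3 => g (q.2.1 * q.1, q.2.2))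
      (Set.univ ×ˢ (Set.univ ×ˢ {0}ᶜ)) := by
    refine hg'.comp ?_ fun q hq => ⟨trivial, hq.2.2⟩
    fun_prop
  have h2 := contDiffOn_segmentIntegral hT h1
  refine (contDiffOn_fst.mul (h2.mono ?_)).congr ?_
  · exact fun p hp s _ => ⟨trivial, trivial, hp.2⟩
  · intro p _
    have := intervalIntegral.mul_integral_comp_mul_left (f := fun s => g (s, p.2)) (a := 0) (b := 1)
      p.1
    simp only [mul_zero, mul_one] at this
    exact this.symm

/-- The integral is split at time t. In the second piece the cocycle law extracts the factor
1/K_t(x) from the integrand. -/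
lemma lorentzShift_add {x : E3} (hx : ‖x‖ = 1) (s t : ℝ) :
    lorentzShift a b α (s + t) x = lorentzShift a b α t x +
      lorentzFst a b t x * lorentzShift a b α s (lorentzMap a b t x) := by
  have hc := continuous_shift_integrand a b hα hx
  have h1 : ∫ r in t..s + t, α (lorentzMap a b r x) / lorentzFactor a b r x =
      lorentzFst a b t x * lorentzShift a b α s (lorentzMap a b t x) := by
    have := intervalIntegral.integral_comp_add_right
      (f := fun r => α (lorentzMap a b r x) / lorentzFactor a b r x) (a := 0) (b := s) t
    rw [zero_add] at this
    rw [← this, lorentzShift, ← intervalIntegral.integral_const_mul]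
    refine intervalIntegral.integral_congr fun r _ => ?_
    simp only [lorentzFactor, lorentzMap_add a b hx, lorentzFst_add a b hx, div_inv_eq_mul]
    ring
  rw [← h1, lorentzShift, lorentzShift, intervalIntegral.integral_add_adjacent_intervals]
  · exact hc.intervalIntegrable _ _
  · exact hc.intervalIntegrable _ _

lemma isBMSGroup_lorentz :
    IsBMSGroup (lorentzMap a b) (lorentzFactor a b) (lorentzShift a b α) where
  isBMS t := ⟨isConformalMap_lorentzMap a b t,
    smoothOnSphere_of_joint (contDiffOn_lorentzShift a b hα) t⟩
  smooth_φ := contDiffOn_radExt_lorentzMap a b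
  smooth_K := contDiffOn_radExt_lorentzFactor a b
  smooth_A := contDiffOn_lorentzShift a b hα
  add s t u x hx := by
    have h1 := lorentzFst_ne_zero a b hx t
    have h2 := lorentzFst_ne_zero a b (norm_lorentzMap a b hx t) s
    simp only [bmsMap, lorentzShift_add a b hα hx, lorentzFactor, lorentzMap_add a b hx,
      lorentzFst_add a b hx, Prod.mk.injEq, and_true]
    field_simp
    ring

variable {f : E3 → E3} (hf : ∀ x : E3, ‖x‖ = 1 → f x = killingField a b x)
include hf

omit hα in
lemma sphDiv_eq_of_killing {x : E3} (hx : ‖x‖ = 1) : sphDiv f x = -2 * inner ℝ b x := by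
  rw [sphDiv_congr hf hx, sphDiv_killingField a b hx]

/-- Since K' = (1/2)ψK and A' = α/K along the orbit, the derivative of K(u + A) is (1/2)ψK(u + A) +
α. -/
lemma isGeneratorCurve_lorentz (u : ℝ) {x : E3} (hx : ‖x‖ = 1) :
    IsGeneratorCurve α f
      (fun t => bmsMap (lorentzMap a b t) (lorentzFactor a b t) (lorentzShift a b α t) (u, x)) := by
  intro t
  have hn := norm_lorentzMap a b hx t
  have hne := lorentzFst_ne_zero a b hx t
  refine ⟨hn, ?_⟩
  have h1 := ((hasDerivAt_lorentzFst a b hx t).inv hne).mul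
    ((hasDerivAt_lorentzShift a b hα hx t).const_add u)
  have h2 := hasDerivAt_lorentzMap a b hx t
  refine (h1.prodMk h2).congr_deriv ?_
  refine Prod.ext ?_ (hf _ hn).symm
  simp only [bmsMap, bmsGenerator, timeShift, sphDiv_eq_of_killing a b hf hn, lorentzFactor,
    Pi.inv_apply]
  field_simp
  ring

/-- Uniqueness of integral curves by linearization: a curve on the sphere is lifted to a curve of
null vectors that solves the linear Lorentz equation, and applying the inverse Lorentz
transformations makes the lift constant. -/
lemma generatorCurve_eq {γ : ℝ → ℝ × E3} (hγ : IsGeneratorCurve α f γ) (t : ℝ) :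
    γ t = bmsMap (lorentzMap a b t) (lorentzFactor a b t) (lorentzShift a b α t) (γ 0) := by
  have hn : ∀ t, ‖(γ t).2‖ = 1 := fun t => (hγ t).1
  have h2 : ∀ t, HasDerivAt (fun t => (γ t).2) (killingField a b (γ t).2) t := by
    intro t
    rw [← hf _ (hn t)]
    exact hasDerivAt_snd (hγ t).2
  have h1 : ∀ t, HasDerivAt (fun t => (γ t).1)
      (α (γ t).2 - (γ t).1 * inner ℝ b (γ t).2) t := by
    intro t
    refine (hasDerivAt_fst (hγ t).2).congr_deriv ?_
    simp only [bmsGenerator, timeShift, sphDiv_eq_of_killing a b hf (hn t)]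
    ring
  have hc : Continuous fun t => inner ℝ b (γ t).2 :=
    continuous_const.inner (continuous_iff_continuousAt.2 fun t => (h2 t).continuousAt)
  -- The energy of the lift. This factor cancels the quadratic term -⟨b, x⟩x of the field, and it is
  -- also the integrating factor of the linear equation u' = α - ⟨b, x⟩u.
  set μ : ℝ → ℝ := fun t => Real.exp (∫ s in (0 : ℝ)..t, inner ℝ b (γ s).2) with hμ
  have hμd : ∀ t, HasDerivAt μ (μ t * inner ℝ b (γ t).2) t := fun t =>
    (intervalIntegral.integral_hasDerivAt_right (hc.intervalIntegrable 0 t)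
      (hc.stronglyMeasurableAtFilter _ _) hc.continuousAt).exp
  have hμ0 : μ 0 = 1 := by simp [hμ]
  have hμne : ∀ t, μ t ≠ 0 := fun t => (Real.exp_pos _).ne'
  have hp : ∀ t, HasDerivAt (fun t => (μ t, μ t • (γ t).2))
      (lorentzGen a b (μ t, μ t • (γ t).2)) t := by
    intro t
    refine ((hμd t).prodMk ((hμd t).smul (h2 t))).congr_deriv ?_
    refine Prod.ext ?_ ?_
    · simp [inner_smul_right]
    · have : cross a (μ t • (γ t).2) = μ t • cross a (γ t).2 := (crossL a).map_smul _ _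
      simp only [lorentzGen_apply, killingField, this, smul_sub, smul_add, smul_smul]
      abel
  have hconst : ∀ t, lorentz a b (-t) (μ t, μ t • (γ t).2) = (1, (γ 0).2) := by
    intro t
    have hd : ∀ t, HasDerivAt (fun t => lorentz a b (-t) (μ t, μ t • (γ t).2)) 0 t := by
      intro t
      have hE : HasDerivAt (fun t => lorentz a b (-t))
          (-(lorentz a b (-t) * lorentzGen a b)) t := by
        have h0 : HasDerivAt (lorentz a b) (lorentz a b (-t) * lorentzGen a b) (-t) :=
          hasDerivAt_exp_smul_const (lorentzGen a b) (-t)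
        exact (h0.scomp t (hasDerivAt_neg t)).congr_deriv (by simp)
      refine (hE.clm_apply (hp t)).congr_deriv ?_
      simp
    have := is_const_of_deriv_eq_zero (fun t => (hd t).differentiableAt)
      (fun t => (hd t).deriv) t 0
    rw [this, neg_zero, lorentz_zero, hμ0, one_smul]
    rfl
  have hE : ∀ t, lorentz a b t (1, (γ 0).2) = (μ t, μ t • (γ t).2) := by
    intro t
    rw [← hconst t, ← lorentz_add, add_neg_cancel, lorentz_zero]
    rfl
  have hfst : ∀ t, lorentzFst a b t (γ 0).2 = μ t := fun t => by rw [lorentzFst, hE]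
  have hmap : ∀ t, lorentzMap a b t (γ 0).2 = (γ t).2 := fun t => by
    rw [lorentzMap, hfst, lorentzSnd, hE, smul_smul, inv_mul_cancel₀ (hμne t), one_smul]
  have hu : ∀ t, μ t * (γ t).1 - lorentzShift a b α t (γ 0).2 = (γ 0).1 := by
    intro t
    have hd : ∀ t, HasDerivAt (fun t => μ t * (γ t).1 - lorentzShift a b α t (γ 0).2) 0 t := by
      intro t
      refine (((hμd t).mul (h1 t)).sub
        (hasDerivAt_lorentzShift a b hα (hn 0) t)).congr_deriv ?_
      rw [hmap, hfst]
      ring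
    have := is_const_of_deriv_eq_zero (fun t => (hd t).differentiableAt)
      (fun t => (hd t).deriv) t 0
    rw [this, hμ0, lorentzShift]
    simp
  refine Prod.ext ?_ (hmap t).symm
  simp only [bmsMap, lorentzFactor, hfst]
  rw [← hu t]
  field_simp [hμne t]
  ring

lemma isFlowOf_lorentz :
    IsFlowOf α f (lorentzMap a b) (lorentzFactor a b) (lorentzShift a b α) := by
  refine ⟨fun u x hx => ⟨?_, isGeneratorCurve_lorentz a b hα hf u hx⟩,
    fun γ hγ t => generatorCurve_eq a b hα hf hγ t⟩
  simp [bmsMap, lorentzMap_zero, lorentzFactor, lorentzFst_zero, lorentzShift]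

omit hα in
-- The logarithm of K² is -2 times the logarithm of the energy, whose derivative along the flow is ψ
-- = -2⟨b, φ_s(x)⟩; at time 0 it vanishes.
lemma lorentzFactor_sq {x : E3} (hx : ‖x‖ = 1) (t : ℝ) :
    lorentzFactor a b t x ^ 2 =
      Real.exp (∫ s in (0 : ℝ)..t, sphDiv f (lorentzMap a b s x)) := by
  have hpos := fun s => lorentzFst_pos a b hx s
  have hd : ∀ s ∈ Set.uIcc 0 t, HasDerivAt (fun s => -2 * Real.log (lorentzFst a b s x))
      (sphDiv f (lorentzMap a b s x)) s := by
    intro s _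
    refine (((hasDerivAt_lorentzFst a b hx s).log (hpos s).ne').const_mul (-2)).congr_deriv ?_
    rw [sphDiv_eq_of_killing a b hf (norm_lorentzMap a b hx s),
      mul_div_cancel_left₀ _ (hpos s).ne']
  have hc : Continuous fun s => sphDiv f (lorentzMap a b s x) := by
    have h : (fun s => sphDiv f (lorentzMap a b s x)) = fun s => -2 * inner ℝ b (lorentzMap a b s x) :=
      funext fun s => sphDiv_eq_of_killing a b hf (norm_lorentzMap a b hx s)
    rw [h]
    exact continuous_const.mul (continuous_const.inner
      (continuous_iff_continuousAt.2 fun s => (hasDerivAt_lorentzMap a b hx s).continuousAt))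
  rw [intervalIntegral.integral_eq_sub_of_hasDerivAt hd (hc.intervalIntegrable _ _),
    lorentzFst_zero, Real.log_one, mul_zero, sub_zero, mul_comm, Real.exp_mul,
    Real.exp_log (hpos t), lorentzFactor]
  rw [Real.rpow_neg (hpos t).le]
  norm_num

end Flow

/-- The generators are complete, and their flows are one-parameter groups of BMS transformations. -/
theorem exists_bmsGroup {α : E3 → ℝ} {f : E3 → E3} (hα : SmoothOnSphere α)
    (hf : IsConformalKilling f) :
    ∃ (φ : ℝ → E3 → E3) (K A : ℝ → E3 → ℝ), IsBMSGroup φ K A ∧ IsFlowOf α f φ K A ∧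
      ∀ t : ℝ, ∀ x : E3, ‖x‖ = 1 →
        K t x ^ 2 = Real.exp (∫ s in (0 : ℝ)..t, sphDiv f (φ s x)) ∧
        A t x = ∫ s in (0 : ℝ)..t, α (φ s x) / K s x := by
  obtain ⟨a, b, h⟩ := hf.exists_killingField
  exact ⟨_, _, _, isBMSGroup_lorentz a b hα, isFlowOf_lorentz a b hα h,
    fun t x hx => ⟨lorentzFactor_sq a b h hx t, rfl⟩⟩

/-! ### The generator of a one-parameter group -/

section Generator

lemma isOpen_univ_prod_compl : IsOpen ((Set.univ : Set ℝ) ×ˢ ({0}ᶜ : Set E3)) :=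
  isOpen_univ.prod isOpen_compl_singleton

section

variable {G : Type*} [NormedAddCommGroup G] [NormedSpace ℝ G] {φ : ℝ → E3 → G}
  (h : ContDiffOn ℝ ∞ (fun p : ℝ × E3 => radExt (φ p.1) p.2) (Set.univ ×ˢ {0}ᶜ))
include h

lemma joint_contDiffAt (t : ℝ) {y : E3} (hy : y ≠ 0) :
    ContDiffAt ℝ ∞ (fun p : ℝ × E3 => radExt (φ p.1) p.2) (t, y) :=
  h.contDiffAt (isOpen_univ_prod_compl.mem_nhds ⟨trivial, hy⟩)

lemma joint_hasDerivAt (t : ℝ) {y : E3} (hy : y ≠ 0) :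
    HasDerivAt (fun t => φ t (dir y))
      (fderiv ℝ (fun p : ℝ × E3 => radExt (φ p.1) p.2) (t, y) (1, 0)) t := by
  have h1 := ((joint_contDiffAt h t hy).differentiableAt (by simp)).hasFDerivAt
  have h2 : HasDerivAt (fun t : ℝ => (t, y)) (1, 0) t :=
    (hasDerivAt_id t).prodMk (hasDerivAt_const t y)
  exact h1.comp_hasDerivAt t h2

lemma hasDerivAt_deriv (t : ℝ) {x : E3} (hx : ‖x‖ = 1) :
    HasDerivAt (fun t => φ t x) (deriv (fun t => φ t x) t) t := by
  have := joint_hasDerivAt h t (ne_zero_of_norm_eq_one hx)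
  rw [dir_of_norm_eq_one hx] at this
  exact this.differentiableAt.hasDerivAt

lemma smoothOnSphere_deriv : SmoothOnSphere fun x => deriv (fun t => φ t x) 0 := by
  have h1 : ContDiffOn ℝ ∞ (fun y : E3 =>
      fderiv ℝ (fun p : ℝ × E3 => radExt (φ p.1) p.2) (0, y) (1, 0)) {0}ᶜ :=
    ((h.fderiv_of_isOpen isOpen_univ_prod_compl (by simp)).clm_apply contDiffOn_const).comp
      (contDiffOn_const.prodMk contDiffOn_id) fun _ hy => ⟨trivial, hy⟩
  exact h1.congr fun y hy => (joint_hasDerivAt h 0 hy).deriv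

/-- The time derivative commutes with the differential on the sphere. -/
lemma hasDerivAt_sphD {x : E3} (hx : ‖x‖ = 1) (v : E3) :
    HasDerivAt (fun t => sphD (φ t) x v) (sphD (fun x => deriv (fun t => φ t x) 0) x v) 0 := by
  have hx0 := ne_zero_of_norm_eq_one hx
  set Φ : ℝ × E3 → G := fun p => radExt (φ p.1) p.2 with hΦ
  have hc : ∀ t, ContDiffAt ℝ ∞ Φ (t, x) := fun t => joint_contDiffAt h t hx0
  have h1 : ∀ t, sphD (φ t) x v = fderiv ℝ Φ (t, x) (0, v) := by
    intro t
    have := (((hc t).differentiableAt (by simp)).hasFDerivAt).comp x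
      (hasFDerivAt_prodMk_right (𝕜 := ℝ) t x)
    have h2 : HasFDerivAt (radExt (φ t))
      ((fderiv ℝ Φ (t, x)).comp (ContinuousLinearMap.inr ℝ ℝ E3)) x := this
    rw [sphD, h2.fderiv]
    rfl
  have hd2 : HasFDerivAt (fderiv ℝ Φ) (fderiv ℝ (fderiv ℝ Φ) (0, x)) (0, x) :=
    (((hc 0).fderiv_right (m := ∞) (by simp)).differentiableAt (by simp)).hasFDerivAt
  have h3 : HasDerivAt (fun t : ℝ => fderiv ℝ Φ (t, x) (0, v))
      (fderiv ℝ (fderiv ℝ Φ) (0, x) (1, 0) (0, v)) 0 := by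
    have h2 : HasDerivAt (fun t : ℝ => (t, x)) (1, 0) 0 :=
      (hasDerivAt_id (0 : ℝ)).prodMk (hasDerivAt_const _ x)
    exact (ContinuousLinearMap.apply ℝ G ((0 : ℝ), v)).hasFDerivAt.comp_hasDerivAt (0 : ℝ)
      (hd2.comp_hasDerivAt (0 : ℝ) h2)
  have h4 : sphD (fun x => deriv (fun t => φ t x) 0) x v =
      fderiv ℝ (fderiv ℝ Φ) (0, x) (0, v) (1, 0) := by
    have h5 : HasFDerivAt (fun y : E3 => fderiv ℝ Φ (0, y) (1, 0))
        ((ContinuousLinearMap.apply ℝ G ((1 : ℝ), (0 : E3))).comp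
          ((fderiv ℝ (fderiv ℝ Φ) (0, x)).comp (ContinuousLinearMap.inr ℝ ℝ E3))) x :=
      (ContinuousLinearMap.apply ℝ G ((1 : ℝ), (0 : E3))).hasFDerivAt.comp x
        (hd2.comp x (hasFDerivAt_prodMk_right (𝕜 := ℝ) (0 : ℝ) x))
    have h6 : radExt (fun x => deriv (fun t => φ t x) 0) =ᶠ[𝓝 x]
        fun y : E3 => fderiv ℝ Φ (0, y) (1, 0) := by
      filter_upwards [isOpen_ne.mem_nhds hx0] with y hy using (joint_hasDerivAt h 0 hy).deriv
    rw [sphD, h6.fderiv_eq, h5.fderiv]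
    rfl
  -- Both derivatives are mixed second derivatives of the joint map in t and x.
  have hsymm : IsSymmSndFDerivAt ℝ Φ (0, x) :=
    (contDiffAt_infty.1 (hc 0) 2).isSymmSndFDerivAt (by simp)
  rw [h4, hsymm.eq]
  exact h3.congr_of_eventuallyEq (Eventually.of_forall h1)

end

variable {φ : ℝ → E3 → E3} {K A : ℝ → E3 → ℝ} (hG : IsBMSGroup φ K A)
include hG

/-- The group law at s = t = 0 makes the transformation idempotent. It is injective because φ₀ is
invertible and K₀ > 0, so it is the identity; u = 0 and u = 1 then determine K₀ and A₀. -/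
lemma IsBMSGroup.map_zero {x : E3} (hx : ‖x‖ = 1) : φ 0 x = x ∧ K 0 x = 1 ∧ A 0 x = 0 := by
  have hadd := fun u => hG.add 0 0 u x hx
  simp only [add_zero] at hadd
  obtain ⟨ψ, -, hψ⟩ := (hG.isBMS 0).1.inverse
  have hφ : φ 0 x = x := by
    have h1 : φ 0 x = φ 0 (φ 0 x) := congrArg Prod.snd (hadd 0)
    have h2 := congrArg ψ h1
    rw [(hψ x hx).2.1, (hψ _ ((hG.isBMS 0).1.mapsTo x hx)).2.1] at h2
    exact h2.symm
  have hpos := (hG.isBMS 0).1.factor_pos x hx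
  have h1 : ∀ u, u = K 0 x * (u + A 0 x) := by
    intro u
    have := congrArg Prod.fst (hadd u)
    simp only [bmsMap, hφ] at this
    have := mul_left_cancel₀ hpos.ne' this
    linarith
  have h2 := h1 0
  have h3 := h1 1
  have hK : K 0 x = 1 := by linarith
  refine ⟨hφ, hK, ?_⟩
  rw [hK] at h2
  linarith

/-- The equation φ_t^* q = K_t² q is differentiated at t = 0, where the differential of φ_t is the
identity on tangent vectors and K_t = 1. The trace of the result identifies the divergence with 2
∂_t K_t; tangency comes from |φ_t(x)|² = 1. -/
lemma IsBMSGroup.isConformalKilling_deriv :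
    IsConformalKilling (fun x => deriv (fun t => φ t x) 0) ∧
    ∀ x : E3, ‖x‖ = 1 →
      sphDiv (fun x => deriv (fun t => φ t x) 0) x = 2 * deriv (fun t => K t x) 0 := by
  set f : E3 → E3 := fun x => deriv (fun t => φ t x) 0 with hf
  have key : ∀ x : E3, ‖x‖ = 1 → ∀ v w : E3, Tangent x v → Tangent x w →
      inner ℝ (sphD f x v) w + inner ℝ v (sphD f x w) =
        2 * deriv (fun t => K t x) 0 * inner ℝ v w := by
    intro x hx v w hv hw
    have h0 : ∀ v, Tangent x v → sphD (φ 0) x v = v := by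
      intro v hv
      rw [sphD_congr (F' := id) (fun y hy => (hG.map_zero hy).1) hx,
        sphD_eq_of_hasFDerivAt hx (hasFDerivAt_id x)]
      simpa using tanProj_of_tangent hv
    have h1 := (hasDerivAt_sphD hG.smooth_φ hx v).inner ℝ (hasDerivAt_sphD hG.smooth_φ hx w)
    have h2 := ((hasDerivAt_deriv hG.smooth_K 0 hx).pow 2).mul_const (inner ℝ v w)
    have h3 : (fun t => inner ℝ (sphD (φ t) x v) (sphD (φ t) x w)) =
        fun t => (K t x) ^ 2 * inner ℝ v w :=
      funext fun t => (hG.isBMS t).1.conformal x hx v w hv hw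
    rw [h3] at h1
    have h4 := h1.unique h2
    rw [h0 v hv, h0 w hw, (hG.map_zero hx).2.1] at h4
    simp only [Nat.cast_ofNat, one_pow, mul_one] at h4
    rw [← h4, hf]
    ring
  have hdiv : ∀ x : E3, ‖x‖ = 1 → sphDiv f x = 2 * deriv (fun t => K t x) 0 := by
    intro x hx
    obtain ⟨e₁, e₂, h⟩ := exists_frame hx
    have h1 := key x hx e₁ e₁ h.tangent_fst h.tangent_fst
    have h2 := key x hx e₂ e₂ h.tangent_snd h.tangent_snd
    rw [real_inner_self_eq_norm_sq, h.norm_fst, real_inner_comm] at h1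
    rw [real_inner_self_eq_norm_sq, h.norm_snd, real_inner_comm] at h2
    rw [h.sphDiv_eq, real_inner_comm, real_inner_comm e₂]
    linarith
  refine ⟨⟨⟨smoothOnSphere_deriv hG.smooth_φ, fun x hx => ?_⟩, fun x hx v w hv hw => ?_⟩, hdiv⟩
  · have h1 := hasDerivAt_deriv hG.smooth_φ 0 hx
    have h2 := h1.inner ℝ h1
    have h3 : (fun t => inner ℝ (φ t x) (φ t x)) = fun _ => (1 : ℝ) := funext fun t => by
      rw [real_inner_self_eq_norm_sq, (hG.isBMS t).1.mapsTo x hx, one_pow]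
    rw [h3] at h2
    have h4 := h2.unique (hasDerivAt_const (0 : ℝ) (1 : ℝ))
    rw [(hG.map_zero hx).1, real_inner_comm] at h4
    rw [Tangent, real_inner_comm]
    simp only [hf]
    linarith
  · rw [key x hx v w hv hw, hdiv x hx]

lemma IsBMSGroup.isGeneratorCurve (u : ℝ) {x : E3} (hx : ‖x‖ = 1) :
    IsGeneratorCurve (fun x => deriv (fun t => A t x) 0) (fun x => deriv (fun t => φ t x) 0)
      (fun t => bmsMap (φ t) (K t) (A t) (u, x)) := by
  intro t
  have hn : ‖φ t x‖ = 1 := (hG.isBMS t).1.mapsTo x hx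
  refine ⟨hn, ?_⟩
  -- The group law writes the orbit near time t as the orbit of the point (u', x') reached at time
  -- t, run for the time s - t. Only derivatives at time 0 are then needed.
  obtain ⟨u', x', hux⟩ : ∃ u' x', bmsMap (φ t) (K t) (A t) (u, x) = (u', x') := ⟨_, _, rfl⟩
  have hx' : ‖x'‖ = 1 := by
    rw [show x' = φ t x from (congrArg Prod.snd hux).symm]; exact hn
  obtain ⟨z1, z2, z3⟩ := hG.map_zero hx'
  have h1 := ((hasDerivAt_deriv hG.smooth_K 0 hx').mul
    ((hasDerivAt_deriv hG.smooth_A 0 hx').const_add u')).prodMk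
    (hasDerivAt_deriv hG.smooth_φ 0 hx')
  have h2 : HasDerivAt (fun s => bmsMap (φ (s - t)) (K (s - t)) (A (s - t)) (u', x'))
      (bmsGenerator (fun x => deriv (fun t => A t x) 0) (fun x => deriv (fun t => φ t x) 0)
        (u', x')) t := by
    have h3 : HasDerivAt (fun s => bmsMap (φ s) (K s) (A s) (u', x'))
        (deriv (fun t => K t x') 0 * (u' + A 0 x') + K 0 x' * deriv (fun t => A t x') 0,
          deriv (fun t => φ t x') 0) (t - t) := by
      rw [sub_self]; exact h1
    refine (h3.comp_sub_const t t).congr_deriv (Prod.ext ?_ rfl)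
    simp only [bmsGenerator, timeShift, hG.isConformalKilling_deriv.2 x' hx', z2, z3]
    ring
  simp only [hux]
  refine h2.congr_of_eventuallyEq (Eventually.of_forall fun s => ?_)
  simp only
  rw [← hux, ← hG.add (s - t) t u x hx, sub_add_cancel]

/-- Every smooth one-parameter group of BMS transformations is the flow of a generator. -/
theorem IsBMSGroup.exists_generator :
    ∃ (α : E3 → ℝ) (f : E3 → E3), SmoothOnSphere α ∧ IsConformalKilling f ∧
      IsFlowOf α f φ K A := by
  have hα := smoothOnSphere_deriv hG.smooth_A
  have hf := hG.isConformalKilling_deriv.1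
  refine ⟨_, _, hα, hf, fun u x hx => ⟨?_, hG.isGeneratorCurve u hx⟩, fun γ hγ t => ?_⟩
  · obtain ⟨z1, z2, z3⟩ := hG.map_zero hx
    simp [bmsMap, z1, z2, z3]
  -- Both the given integral curve and the orbit of its initial point are orbits of the explicit
  -- flow of this generator, so they agree.
  · obtain ⟨φ', K', A', -, hF, -⟩ := exists_bmsGroup hα hf
    have h1 := hF.2 γ hγ t
    have h2 := hF.2 _ (hG.isGeneratorCurve (γ 0).1 (hγ 0).1) t
    have h3 : bmsMap (φ 0) (K 0) (A 0) ((γ 0).1, (γ 0).2) = γ 0 := by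
      obtain ⟨z1, z2, z3⟩ := hG.map_zero (hγ 0).1
      simp [bmsMap, z1, z2, z3]
    simp only [h3] at h2
    rw [h1, ← h2]

end Generator

/-! ### The Lie derivative of a metric of Bondi–Sachs form -/

/-- Bilinear forms on `E3` as continuous bilinear maps. -/
abbrev CForm3 := E3 →L[ℝ] E3 →L[ℝ] ℝ

/-- The 1-form `dx^A - U^A du`. -/
def shiftedForm (U : Spacetime → E3) (p v : Spacetime) : E3 := dx p.2 v - du v • U p

/-- The metric `a du⊗du + b (du⊗dr + dr⊗du) - r² H(dx - U du, dx - U du)`. -/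
def modelMetric (a b : Spacetime → ℝ) (U : Spacetime → E3) (H : Spacetime → CForm3)
    (p v w : Spacetime) : ℝ :=
  a p * (du v * du w) + b p * (du v * dr p.2 w + dr p.2 v * du w)
    - ‖p.2‖ ^ 2 * H p (shiftedForm U p v) (shiftedForm U p w)

/-- The Lie derivative of an exact form is the differential of its contraction. -/
lemma fderiv_exact_form {E G : Type*} [NormedAddCommGroup E] [NormedSpace ℝ E]
    [NormedAddCommGroup G] [NormedSpace ℝ G] {ρ : E → G} {η : E → E →L[ℝ] G} {p : E}
    (hρ : ContDiffAt ℝ ∞ ρ p) (hη : ∀ᶠ p' in 𝓝 p, HasFDerivAt ρ (η p') p') {ξ : E → E}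
    (hξ : DifferentiableAt ℝ ξ p) (v : E) :
    DifferentiableAt ℝ η p ∧ DifferentiableAt ℝ (fun p' => η p' (ξ p')) p ∧
    fderiv ℝ η p (ξ p) v + η p (fderiv ℝ ξ p v) = fderiv ℝ (fun p' => η p' (ξ p')) p v := by
  have he : η =ᶠ[𝓝 p] fderiv ℝ ρ := hη.mono fun p' h => h.fderiv.symm
  have hd : DifferentiableAt ℝ η p :=
    ((hρ.fderiv_right (m := ∞) (by simp)).differentiableAt (by simp)).congr_of_eventuallyEq he
  have hs : IsSymmSndFDerivAt ℝ ρ p := (contDiffAt_infty.1 hρ 2).isSymmSndFDerivAt (by simp)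
  have h1 := hd.hasFDerivAt.clm_apply hξ.hasFDerivAt
  refine ⟨hd, h1.differentiableAt, ?_⟩
  rw [h1.fderiv]
  simp only [add_apply, ContinuousLinearMap.comp_apply,
    ContinuousLinearMap.flip_apply]
  rw [he.fderiv_eq, hs.eq]
  abel

lemma hasFDerivAt_radius {p : Spacetime} (hp : p.2 ≠ 0) :
    HasFDerivAt (fun p : Spacetime => ‖p.2‖) (dr p.2) p :=
  (hasFDerivAt_norm hp).comp p hasFDerivAt_snd

lemma hasFDerivAt_direction {p : Spacetime} (hp : p.2 ≠ 0) :
    HasFDerivAt (fun p : Spacetime => dir p.2) (dx p.2) p :=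
  (hasFDerivAt_dir hp).comp p hasFDerivAt_snd

lemma eventually_snd_ne_zero {p : Spacetime} (hp : p.2 ≠ 0) :
    ∀ᶠ p' : Spacetime in 𝓝 p, p'.2 ≠ 0 :=
  continuousAt_snd.eventually (isOpen_ne.mem_nhds hp)

lemma fderiv_dr_form {p : Spacetime} (hp : p.2 ≠ 0) {ξ : Spacetime → Spacetime}
    (hξ : DifferentiableAt ℝ ξ p) (v : Spacetime) :
    DifferentiableAt ℝ (fun p : Spacetime => dr p.2) p ∧
    DifferentiableAt ℝ (fun p => dr p.2 (ξ p)) p ∧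
    fderiv ℝ (fun p : Spacetime => dr p.2) p (ξ p) v + dr p.2 (fderiv ℝ ξ p v) =
      fderiv ℝ (fun p => dr p.2 (ξ p)) p v :=
  fderiv_exact_form (ρ := fun p : Spacetime => ‖p.2‖) (η := fun p : Spacetime => dr p.2)
    ((contDiffAt_norm ℝ hp).comp p contDiffAt_snd)
    ((eventually_snd_ne_zero hp).mono fun _ h => hasFDerivAt_radius h) hξ v

lemma fderiv_dx_form {p : Spacetime} (hp : p.2 ≠ 0) {ξ : Spacetime → Spacetime}
    (hξ : DifferentiableAt ℝ ξ p) (v : Spacetime) :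
    DifferentiableAt ℝ (fun p : Spacetime => dx p.2) p ∧
    DifferentiableAt ℝ (fun p => dx p.2 (ξ p)) p ∧
    fderiv ℝ (fun p : Spacetime => dx p.2) p (ξ p) v + dx p.2 (fderiv ℝ ξ p v) =
      fderiv ℝ (fun p => dx p.2 (ξ p)) p v :=
  fderiv_exact_form (ρ := fun p : Spacetime => dir p.2) (η := fun p : Spacetime => dx p.2)
    ((contDiffAt_dir hp).comp p contDiffAt_snd)
    ((eventually_snd_ne_zero hp).mono fun _ h => hasFDerivAt_direction h) hξ v

/-- The Lie derivative of the 1-form `dx^A - U^A du`. -/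
def lieShifted (U : Spacetime → E3) (ξ : Spacetime → Spacetime) (p v : Spacetime) : E3 :=
  fderiv ℝ (fun p => dx p.2 (ξ p)) p v - du v • fderiv ℝ U p (ξ p)
    - fderiv ℝ (fun p => du (ξ p)) p v • U p

/-- The Lie derivative is a derivation that commutes with d, so on du, dr and dx it gives the
differentials of the components of ξ. In this form no derivative of the coordinate forms themselves
is left. -/
theorem variation_modelMetric {a b : Spacetime → ℝ} {U : Spacetime → E3} {H : Spacetime → CForm3}
    {ξ : Spacetime → Spacetime} {p : Spacetime} (hp : p.2 ≠ 0) (ha : DifferentiableAt ℝ a p)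
    (hb : DifferentiableAt ℝ b p) (hU : DifferentiableAt ℝ U p) (hH : DifferentiableAt ℝ H p)
    (hξ : DifferentiableAt ℝ ξ p) (v w : Spacetime) :
    variation (modelMetric a b U H) ξ p v w =
      -(fderiv ℝ a p (ξ p) * (du v * du w)
        + a p * (fderiv ℝ (fun p => du (ξ p)) p v * du w
          + du v * fderiv ℝ (fun p => du (ξ p)) p w)
        + fderiv ℝ b p (ξ p) * (du v * dr p.2 w + dr p.2 v * du w)
        + b p * (fderiv ℝ (fun p => du (ξ p)) p v * dr p.2 w
          + du v * fderiv ℝ (fun p => dr p.2 (ξ p)) p w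
          + fderiv ℝ (fun p => dr p.2 (ξ p)) p v * du w
          + dr p.2 v * fderiv ℝ (fun p => du (ξ p)) p w)
        - 2 * ‖p.2‖ * dr p.2 (ξ p) * H p (shiftedForm U p v) (shiftedForm U p w)
        - ‖p.2‖ ^ 2 * (fderiv ℝ H p (ξ p) (shiftedForm U p v) (shiftedForm U p w)
          + H p (lieShifted U ξ p v) (shiftedForm U p w)
          + H p (shiftedForm U p v) (lieShifted U ξ p w))) := by
  have hdu : ∀ v, fderiv ℝ (fun p => du (ξ p)) p v = du (fderiv ℝ ξ p v) := fun v => by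
    have h : HasFDerivAt (fun p => du (ξ p)) (du.comp (fderiv ℝ ξ p)) p :=
      du.hasFDerivAt.comp p hξ.hasFDerivAt
    rw [h.fderiv]
    rfl
  have hr1 := (fderiv_dr_form hp hξ v).1.hasFDerivAt
  have hx1 := (fderiv_dx_form hp hξ v).1.hasFDerivAt
  have hrv : ∀ v, HasFDerivAt (fun p : Spacetime => dr p.2 v) _ p := fun v =>
    (ContinuousLinearMap.apply ℝ ℝ v).hasFDerivAt.comp p hr1
  have hxv : ∀ v, HasFDerivAt (fun p : Spacetime => dx p.2 v) _ p := fun v =>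
    (ContinuousLinearMap.apply ℝ E3 v).hasFDerivAt.comp p hx1
  have hθ : ∀ v, HasFDerivAt (fun p => shiftedForm U p v) _ p := fun v =>
    (hxv v).sub (hU.hasFDerivAt.const_smul (du v))
  have hHθ := (hH.hasFDerivAt.clm_apply (hθ v)).clm_apply (hθ w)
  have hg := ((ha.hasFDerivAt.mul_const (du v * du w)).add
    (hb.hasFDerivAt.mul (((hrv w).const_mul (du v)).add ((hrv v).mul_const (du w))))).sub
    (((hasFDerivAt_radius hp).pow 2).mul hHθ)
  have hg' : HasFDerivAt (fun p' => modelMetric a b U H p' v w) _ p := hg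
  have er : ∀ v, fderiv ℝ (fun p => dr p.2 (ξ p)) p v =
      fderiv ℝ (fun p : Spacetime => dr p.2) p (ξ p) v + dr p.2 (fderiv ℝ ξ p v) :=
    fun v => (fderiv_dr_form hp hξ v).2.2.symm
  have ex : ∀ v, fderiv ℝ (fun p => dx p.2 (ξ p)) p v =
      fderiv ℝ (fun p : Spacetime => dx p.2) p (ξ p) v + dx p.2 (fderiv ℝ ξ p v) :=
    fun v => (fderiv_dx_form hp hξ v).2.2.symm
  have el : ∀ v, lieShifted U ξ p v =
      (fderiv ℝ (fun p : Spacetime => dx p.2) p (ξ p) v - du v • fderiv ℝ U p (ξ p))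
      + shiftedForm U p (fderiv ℝ ξ p v) := fun v => by
    rw [lieShifted, ex, hdu, shiftedForm]; abel
  rw [variation, hg'.fderiv, er, er, el, el, hdu, hdu]
  simp only [add_apply, sub_apply,
    smul_apply, ContinuousLinearMap.comp_apply,
    ContinuousLinearMap.flip_apply, ContinuousLinearMap.apply_apply, smul_eq_mul, map_add,
    modelMetric]
  simp
  ring

/-! ### Functions of `(u, 1/r, x)` -/

/-- The coordinates `(u, ρ, y)` with `ρ = 1/r`, extended across `ρ = 0`. -/
abbrev Conf := ℝ × ℝ × E3

/-- The domain of the extended metric functions. -/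
def dom (I : Set ℝ) (r₀ : ℝ) : Set Conf := I ×ˢ Set.Iio (1 / r₀) ×ˢ {0}ᶜ

lemma mem_dom {I : Set ℝ} {r₀ u ρ : ℝ} {y : E3} :
    (u, ρ, y) ∈ dom I r₀ ↔ u ∈ I ∧ ρ < 1 / r₀ ∧ y ≠ 0 := by
  simp [dom]

lemma isOpen_dom {I : Set ℝ} (hI : IsOpen I) (r₀ : ℝ) : IsOpen (dom I r₀) :=
  hI.prod (isOpen_Iio.prod isOpen_compl_singleton)

lemma contDiffAt_of_dom {G : Type*} [NormedAddCommGroup G] [NormedSpace ℝ G] {I : Set ℝ}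
    (hI : IsOpen I) {r₀ : ℝ} {W : Conf → G} (hW : ContDiffOn ℝ ∞ W (dom I r₀)) {q : Conf}
    (hq : q ∈ dom I r₀) : ContDiffAt ℝ ∞ W q :=
  hW.contDiffAt ((isOpen_dom hI r₀).mem_nhds hq)

lemma hasFDerivAt_of_dom {G : Type*} [NormedAddCommGroup G] [NormedSpace ℝ G] {I : Set ℝ}
    (hI : IsOpen I) {r₀ : ℝ} {W : Conf → G} (hW : ContDiffOn ℝ ∞ W (dom I r₀)) {q : Conf}
    (hq : q ∈ dom I r₀) : HasFDerivAt W (fderiv ℝ W q) q :=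
  ((contDiffAt_of_dom hI hW hq).differentiableAt (by simp)).hasFDerivAt

section

variable {G : Type} [NormedAddCommGroup G] [NormedSpace ℝ G] {I : Set ℝ} {r₀ : ℝ}

/-- The average of `W` over the segment from `(u, 0, y)` to `(u, ρ, y)`. -/
def avg (W : Conf → G) (q : Conf) : G := ∫ s in (0 : ℝ)..1, W (q.1, s * q.2.1, q.2.2)

lemma segment_mem_dom (hr : 0 < r₀) {u ρ : ℝ} {y : E3} (hq : (u, ρ, y) ∈ dom I r₀) {s : ℝ}
    (hs : s ∈ Set.Icc (0 : ℝ) 1) : (u, s * ρ, y) ∈ dom I r₀ := by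
  rw [mem_dom] at hq ⊢
  refine ⟨hq.1, ?_, hq.2.2⟩
  have h1 : 0 < 1 / r₀ := by positivity
  rcases le_or_gt ρ 0 with h | h
  · exact (mul_nonpos_of_nonneg_of_nonpos hs.1 h).trans_lt h1
  · exact (mul_le_of_le_one_left h.le hs.2).trans_lt hq.2.1

lemma contDiffOn_avg (hI : IsOpen I) (hr : 0 < r₀) {W : Conf → G}
    (hW : ContDiffOn ℝ ∞ W (dom I r₀)) : ContDiffOn ℝ ∞ (avg W) (dom I r₀) := by
  set m : ℝ × Conf → Conf := fun p => (p.2.1, p.1 * p.2.2.1, p.2.2.2) with hm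
  have hmc : ContDiff ℝ ∞ m := by fun_prop
  have hT : IsOpen (m ⁻¹' dom I r₀) := (isOpen_dom hI r₀).preimage hmc.continuous
  have h1 : ContDiffOn ℝ ∞ (fun p => W (m p)) (m ⁻¹' dom I r₀) :=
    hW.comp hmc.contDiffOn fun _ hp => hp
  exact (contDiffOn_segmentIntegral hT h1).mono fun q hq s hs => segment_mem_dom hr hq hs

lemma avg_zero [CompleteSpace G] (W : Conf → G) (u : ℝ) (y : E3) :
    avg W (u, 0, y) = W (u, 0, y) := by
  simp [avg]

lemma line_hasDerivAt (hI : IsOpen I) {W : Conf → G} (hW : ContDiffOn ℝ ∞ W (dom I r₀)) {u ρ : ℝ}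
    {y : E3} (hq : (u, ρ, y) ∈ dom I r₀) :
    HasDerivAt (fun ρ => W (u, ρ, y)) (fderiv ℝ W (u, ρ, y) (0, 1, 0)) ρ := by
  have h1 : HasDerivAt (fun ρ : ℝ => (u, ρ, y)) (0, 1, 0) ρ :=
    (hasDerivAt_const ρ u).prodMk ((hasDerivAt_id ρ).prodMk (hasDerivAt_const ρ y))
  exact (hasFDerivAt_of_dom hI hW hq).comp_hasDerivAt ρ h1

/-- ρ · `avg W` is the integral of W from 0 to ρ. Writing the primitive in this way displays its
factor ρ and the smoothness of the quotient across ρ = 0. -/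
lemma hasDerivAt_smul_avg [CompleteSpace G] (hI : IsOpen I) (hr : 0 < r₀) {W : Conf → G}
    (hW : ContDiffOn ℝ ∞ W (dom I r₀)) {u ρ : ℝ} {y : E3} (hq : (u, ρ, y) ∈ dom I r₀) :
    HasDerivAt (fun ρ => ρ • avg W (u, ρ, y)) (W (u, ρ, y)) ρ := by
  rw [mem_dom] at hq
  have hc : ContinuousOn (fun s => W (u, s, y)) (Set.Iio (1 / r₀)) := fun s hs =>
    (line_hasDerivAt hI hW (mem_dom.2 ⟨hq.1, hs, hq.2.2⟩)).continuousAt.continuousWithinAt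
  have hsub : Set.uIcc 0 ρ ⊆ Set.Iio (1 / r₀) := by
    intro s hs
    exact hs.2.trans_lt (max_lt (by positivity) hq.2.1)
  have h1 := intervalIntegral.integral_hasDerivAt_right (a := 0) (b := ρ)
    ((hc.mono hsub).intervalIntegrable)
    (hc.stronglyMeasurableAtFilter isOpen_Iio ρ hq.2.1)
    (hc.continuousAt (isOpen_Iio.mem_nhds hq.2.1))
  refine h1.congr_of_eventuallyEq (Eventually.of_forall fun ρ => ?_)
  have := intervalIntegral.smul_integral_comp_mul_right (f := fun s => W (u, s, y)) (a := 0)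
    (b := 1) ρ
  simpa [avg] using this

lemma eq_of_line_hasDerivAt {J : Set ℝ} (hJ : IsOpen J) (hJ' : J.OrdConnected) {f g : ℝ → G}
    {f' : ℝ → G} (hf : ∀ ρ ∈ J, HasDerivAt f (f' ρ) ρ) (hg : ∀ ρ ∈ J, HasDerivAt g (f' ρ) ρ)
    {ρ₀ : ℝ} (h₀ : ρ₀ ∈ J) (he : f ρ₀ = g ρ₀) {ρ : ℝ} (hρ : ρ ∈ J) : f ρ = g ρ := by
  have hd : ∀ ρ ∈ J, HasDerivAt (fun ρ => f ρ - g ρ) 0 ρ := fun ρ hρ =>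
    ((hf ρ hρ).sub (hg ρ hρ)).congr_deriv (sub_self _)
  have := hJ.is_const_of_deriv_eq_zero hJ'.isPreconnected
    (fun ρ hρ => (hd ρ hρ).differentiableAt.differentiableWithinAt) (fun ρ hρ => (hd ρ hρ).deriv)
    hρ h₀
  simp only [he, sub_self] at this
  exact sub_eq_zero.1 this

lemma contDiffOn_fderiv_apply (hI : IsOpen I) {W : Conf → G} (hW : ContDiffOn ℝ ∞ W (dom I r₀))
    (v : Conf) : ContDiffOn ℝ ∞ (fun q => fderiv ℝ W q v) (dom I r₀) :=
  (hW.fderiv_of_isOpen (isOpen_dom hI r₀) (by simp)).clm_apply contDiffOn_const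

/-- Hadamard's lemma: a smooth function which vanishes at `ρ = 0` is divisible by `ρ`. -/
lemma exists_factor [CompleteSpace G] (hI : IsOpen I) (hr : 0 < r₀) {W : Conf → G}
    (hW : ContDiffOn ℝ ∞ W (dom I r₀)) (h0 : ∀ u ∈ I, ∀ y ≠ 0, W (u, 0, y) = 0) :
    ∃ W₁ : Conf → G, ContDiffOn ℝ ∞ W₁ (dom I r₀) ∧ (∀ q ∈ dom I r₀, W q = q.2.1 • W₁ q) ∧
      ∀ u y, W₁ (u, 0, y) = fderiv ℝ W (u, 0, y) (0, 1, 0) := by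
  have hW' := contDiffOn_fderiv_apply hI hW (0, 1, 0)
  refine ⟨avg fun q => fderiv ℝ W q (0, 1, 0), contDiffOn_avg hI hr hW', ?_, fun u y => avg_zero _ _ _⟩
  rintro ⟨u, ρ, y⟩ hq
  rw [mem_dom] at hq
  have h1 : ∀ ρ ∈ Set.Iio (1 / r₀), (u, ρ, y) ∈ dom I r₀ := fun ρ hρ =>
    mem_dom.2 ⟨hq.1, hρ, hq.2.2⟩
  refine eq_of_line_hasDerivAt (J := Set.Iio (1 / r₀)) isOpen_Iio Set.ordConnected_Iio
    (f := fun ρ => W (u, ρ, y))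
    (fun ρ hρ => line_hasDerivAt hI hW (h1 ρ hρ))
    (fun ρ hρ => hasDerivAt_smul_avg hI hr hW' (h1 ρ hρ)) (ρ₀ := 0)
    (by simpa using hr) ?_ hq.2.1
  simp [h0 u hq.1 y hq.2.2]

/-- A ray at fixed `u` and `x`, parametrized by the radius. -/
def ray (u : ℝ) (x : E3) (r : ℝ) : Conf := (u, r⁻¹, x)

lemma tendsto_ray (u : ℝ) (x : E3) : Tendsto (ray u x) atTop (𝓝 (u, 0, x)) :=
  tendsto_const_nhds.prodMk_nhds (tendsto_inv_atTop_zero.prodMk_nhds tendsto_const_nhds)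

lemma zero_mem_dom (hr : 0 < r₀) {u : ℝ} (hu : u ∈ I) {y : E3} (hy : y ≠ 0) :
    (u, (0 : ℝ), y) ∈ dom I r₀ := mem_dom.2 ⟨hu, by positivity, hy⟩

lemma ray_mem_dom (hr : 0 < r₀) {u : ℝ} (hu : u ∈ I) {x : E3} (hx : ‖x‖ = 1) {r : ℝ}
    (h : r₀ < r) : ray u x r ∈ dom I r₀ :=
  mem_dom.2 ⟨hu, by rw [inv_eq_one_div]; exact one_div_lt_one_div_of_lt hr h,
    ne_zero_of_norm_eq_one hx⟩

lemma tendsto_along_ray (hI : IsOpen I) (hr : 0 < r₀) {W : Conf → G}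
    (hW : ContDiffOn ℝ ∞ W (dom I r₀)) {u : ℝ} (hu : u ∈ I) {x : E3} (hx : ‖x‖ = 1) :
    Tendsto (fun r => W (ray u x r)) atTop (𝓝 (W (u, 0, x))) :=
  (contDiffAt_of_dom hI hW
    (zero_mem_dom hr hu (ne_zero_of_norm_eq_one hx))).continuousAt.tendsto.comp (tendsto_ray u x)

/-- If a function is constant along the rays of `E3` and decays along each ray `r → ∞`, it vanishes
at `ρ = 0`. -/
lemma eq_zero_of_isBigO (hI : IsOpen I) (hr : 0 < r₀) {W : Conf → G}
    (hW : ContDiffOn ℝ ∞ W (dom I r₀))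
    (hhom : ∀ u ρ y, (u, ρ, y) ∈ dom I r₀ → W (u, ρ, dir y) = W (u, ρ, y))
    (hO : ∀ u ∈ I, ∀ x : E3, ‖x‖ = 1 →
      (fun r => W (ray u x r)) =O[atTop] fun r : ℝ => r⁻¹) :
    ∀ u ∈ I, ∀ y ≠ 0, W (u, 0, y) = 0 := by
  intro u hu y hy
  rw [← hhom u 0 y (zero_mem_dom hr hu hy)]
  exact tendsto_nhds_unique (tendsto_along_ray hI hr hW hu (norm_dir hy))
    ((hO u hu _ (norm_dir hy)).trans_tendsto tendsto_inv_atTop_zero)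

/-- Smoothness of the extension is what turns decay along each single ray, without uniformity, into
a smooth factor ρ. -/
lemma exists_factor_of_isBigO [CompleteSpace G] (hI : IsOpen I) (hr : 0 < r₀) {W : Conf → G}
    (hW : ContDiffOn ℝ ∞ W (dom I r₀))
    (hhom : ∀ u ρ y, (u, ρ, y) ∈ dom I r₀ → W (u, ρ, dir y) = W (u, ρ, y))
    (hO : ∀ u ∈ I, ∀ x : E3, ‖x‖ = 1 →
      (fun r => W (ray u x r)) =O[atTop] fun r : ℝ => r⁻¹) :
    ∃ W₁ : Conf → G, ContDiffOn ℝ ∞ W₁ (dom I r₀) ∧ ∀ q ∈ dom I r₀, W q = q.2.1 • W₁ q := by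
  obtain ⟨W₁, h1, h2, -⟩ := exists_factor hI hr hW (eq_zero_of_isBigO hI hr hW hhom hO)
  exact ⟨W₁, h1, h2⟩

/-- Hadamard's lemma is applied twice; the quotient W₁ by ρ still decays like 1/r along the rays. -/
lemma exists_factor_sq_of_isBigO [CompleteSpace G] (hI : IsOpen I) (hr : 0 < r₀) {W : Conf → G}
    (hW : ContDiffOn ℝ ∞ W (dom I r₀))
    (hhom : ∀ u ρ y, (u, ρ, y) ∈ dom I r₀ → W (u, ρ, dir y) = W (u, ρ, y))
    (hO : ∀ u ∈ I, ∀ x : E3, ‖x‖ = 1 →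
      (fun r => W (ray u x r)) =O[atTop] fun r : ℝ => (r ^ 2)⁻¹) :
    ∃ W₂ : Conf → G, ContDiffOn ℝ ∞ W₂ (dom I r₀) ∧ ∀ q ∈ dom I r₀, W q = q.2.1 ^ 2 • W₂ q := by
  have hO1 : ∀ u ∈ I, ∀ x : E3, ‖x‖ = 1 →
      (fun r => W (ray u x r)) =O[atTop] fun r : ℝ => r⁻¹ := fun u hu x hx =>
    (hO u hu x hx).trans <| IsBigO.of_bound 1 <| by
      filter_upwards [eventually_ge_atTop 1] with r hr
      have : 0 < r := by linarith
      rw [one_mul, norm_inv, norm_inv, Real.norm_of_nonneg (by positivity),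
        Real.norm_of_nonneg this.le]
      exact inv_anti₀ this (by nlinarith)
  obtain ⟨W₁, h1, h2, h3⟩ := exists_factor hI hr hW (eq_zero_of_isBigO hI hr hW hhom hO1)
  obtain ⟨W₂, h4, h5, -⟩ := exists_factor hI hr h1 (by
    intro u hu y hy
    have hx := norm_dir hy
    -- Decay is known only at unit vectors. At ρ = 0 the quotient W₁ is the ρ-derivative of W and
    -- inherits its invariance along the rays of `E3`.
    have e1 : W₁ (u, 0, y) = W₁ (u, 0, dir y) := by
      rw [h3, h3]
      have d1 := line_hasDerivAt hI hW (zero_mem_dom hr hu hy)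
      have d2 := line_hasDerivAt hI hW (zero_mem_dom hr hu (dir_ne_zero hy))
      refine d1.unique (d2.congr_of_eventuallyEq ?_)
      filter_upwards [isOpen_Iio.mem_nhds (show (0 : ℝ) < 1 / r₀ by positivity)] with ρ hρ
      exact (hhom u ρ y (mem_dom.2 ⟨hu, hρ, hy⟩)).symm
    rw [e1]
    refine tendsto_nhds_unique (tendsto_along_ray hI hr h1 hu hx) ?_
    have h6 : (fun r => W₁ (ray u (dir y) r)) =O[atTop] fun r : ℝ => r⁻¹ := by
      have h7 : (fun r : ℝ => r • W (ray u (dir y) r)) =O[atTop] fun r : ℝ => r • (r ^ 2)⁻¹ :=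
        (isBigO_refl _ _).smul (hO u hu _ hx)
      refine h7.congr' ?_ ?_
      · filter_upwards [eventually_gt_atTop r₀] with r hr'
        have : r ≠ 0 := (hr.trans hr').ne'
        rw [h2 _ (ray_mem_dom hr hu hx hr'), smul_smul]
        simp [ray, this]
      · filter_upwards [eventually_gt_atTop 0] with r hr'
        simp only [smul_eq_mul]
        field_simp
    exact h6.trans_tendsto tendsto_inv_atTop_zero)
  refine ⟨W₂, h4, fun q hq => ?_⟩
  rw [h2 q hq, h5 q hq, smul_smul, pow_two]

end

/-- The extension of an expandable function across `ρ = 0`. -/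
lemma ExpandsInInverseRadius.exists_extension {G : Type*} [NormedAddCommGroup G] [NormedSpace ℝ G]
    {I : Set ℝ} {r₀ : ℝ} {F : ℝ → ℝ → E3 → G} (h : ExpandsInInverseRadius I r₀ F) :
    ∃ W : Conf → G, ContDiffOn ℝ ∞ W (dom I r₀) ∧
      (∀ u ρ y, W (u, ρ, dir y) = W (u, ρ, y)) ∧
      ∀ u ∈ I, ∀ r : ℝ, r₀ < r → ∀ x : E3, ‖x‖ = 1 → F u r x = W (u, r⁻¹, x) := by
  obtain ⟨Fh, h1, h2⟩ := h
  refine ⟨fun q => Fh (q.1, q.2.1, dir q.2.2), ?_, fun u ρ y => by simp only [dir_dir], ?_⟩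
  · refine h1.comp (contDiffOn_fst.prodMk ((contDiff_fst.comp contDiff_snd).contDiffOn.prodMk
      (contDiffOn_dir.comp (contDiff_snd.comp contDiff_snd).contDiffOn fun q hq => hq.2.2))) ?_
    exact fun q hq => ⟨hq.1, hq.2.1, dir_ne_zero hq.2.2⟩
  · intro u hu r hr x hx
    have := h2 u hu r hr x (ne_zero_of_norm_eq_one hx)
    rw [one_div] at this
    change F u r (dir x) = _ at this
    rw [dir_of_norm_eq_one hx] at this
    simp only [dir_of_norm_eq_one hx, this]

/-! ### The expansion of a Bondi–Sachs metric -/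

/-- The coordinates `(u, 1/r, x)` of a point of the space-time region. -/
def conf (p : Spacetime) : Conf := (p.1, ‖p.2‖⁻¹, dir p.2)

/-- The bilinear form `(v, w) ↦ vⁱ wʲ`. -/
def coordForm (i j : Fin 3) : CForm3 :=
  (EuclideanSpace.proj i : E3 →L[ℝ] ℝ).smulRight (EuclideanSpace.proj j : E3 →L[ℝ] ℝ)

@[simp] lemma coordForm_apply (i j : Fin 3) (v w : E3) : coordForm i j v w = v i * w j := by
  simp [coordForm]

/-- The metric of the unit sphere at the direction of `y`. -/
def roundForm (y : E3) : CForm3 :=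
  ∑ i, coordForm i i - (innerSL ℝ (dir y)).smulRight (innerSL ℝ (dir y))

lemma roundForm_apply (y v w : E3) :
    roundForm y v w = inner ℝ v w - inner ℝ (dir y) v * inner ℝ (dir y) w := by
  simp [roundForm, Fin.sum_univ_three, inner_eq v w]

lemma contDiffOn_roundForm : ContDiffOn ℝ ∞ roundForm {0}ᶜ := by
  have h : ContDiffOn ℝ ∞ (fun y => innerSL ℝ (dir y)) {0}ᶜ :=
    (innerSL ℝ (E := E3)).contDiff.comp_contDiffOn contDiffOn_dir
  exact contDiffOn_const.sub (h.smulRight h)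

lemma qForm_apply {x : E3} (hx : ‖x‖ = 1) (v w : E3) :
    qForm x v w = inner ℝ v w - inner ℝ x v * inner ℝ x w := by
  simp only [qForm, LinearMap.compl₁₂_apply, ContinuousLinearMap.coe_coe, innerₗ_apply_apply,
    tanProj_apply, inner_sub_left, inner_sub_right, inner_smul_left, inner_smul_right,
    real_inner_self_eq_norm_sq, hx, conj_trivial, real_inner_comm x v]
  ring

lemma roundForm_eq_qForm {x : E3} (hx : ‖x‖ = 1) (v w : E3) : roundForm x v w = qForm x v w := by
  rw [roundForm_apply, qForm_apply hx, dir_of_norm_eq_one hx]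

lemma form_expand (B : Form3) (v w : E3) :
    B v w = ∑ i, ∑ j, B (EuclideanSpace.single i 1) (EuclideanSpace.single j 1) * (v i * w j) := by
  have hv : ∀ v : E3, v = ∑ i, v i • EuclideanSpace.single i (1 : ℝ) := fun v => by
    ext k; simp [Fin.sum_univ_three]; fin_cases k <;> simp
  conv_lhs => rw [hv v, hv w]
  simp only [map_sum, map_smul, LinearMap.sum_apply, LinearMap.smul_apply, smul_eq_mul]
  simp only [Finset.mul_sum]
  rw [Finset.sum_comm]
  refine Finset.sum_congr rfl fun i _ => Finset.sum_congr rfl fun j _ => by ring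

section

variable {V : Type*} [NormedAddCommGroup V] [NormedSpace ℝ V]

lemma contDiffOn_sum_smul {E : Type*} [NormedAddCommGroup E] [NormedSpace ℝ E] {s : Set E}
    {f : Fin 3 → Fin 3 → E → ℝ} (hf : ∀ i j, ContDiffOn ℝ ∞ (f i j) s) (B : Fin 3 → Fin 3 → V) :
    ContDiffOn ℝ ∞ (fun x => ∑ i, ∑ j, f i j x • B i j) s :=
  ContDiffOn.sum fun i _ => ContDiffOn.sum fun j _ => (hf i j).smul contDiffOn_const

lemma isBigO_sum_smul {f : Fin 3 → Fin 3 → ℝ → ℝ} {g : ℝ → ℝ}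
    (hf : ∀ i j, f i j =O[atTop] g) (B : Fin 3 → Fin 3 → V) :
    (fun r => ∑ i, ∑ j, f i j r • B i j) =O[atTop] g := by
  refine IsBigO.fun_sum fun i _ => IsBigO.fun_sum fun j _ => ?_
  have h3 := (hf i j).smul (isBigO_const_const (B i j) (one_ne_zero (α := ℝ)) atTop)
  simpa using h3

end

/-- The smooth extension of the metric functions `a = e^{2β} V/r`, `b = e^{2β}`, `U`, `H = h` across
`ρ = 1/r = 0`, and their first terms there. -/
structure MetricExpansion (S : MetricData) where
  a : Conf → ℝ
  b : Conf → ℝ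
  U : Conf → E3
  H : Conf → CForm3
  a₁ : Conf → ℝ
  b₂ : Conf → ℝ
  U₂ : Conf → E3
  H₁ : Conf → CForm3
  smooth_a : ContDiffOn ℝ ∞ a (dom S.I S.r₀)
  smooth_b : ContDiffOn ℝ ∞ b (dom S.I S.r₀)
  smooth_U : ContDiffOn ℝ ∞ U (dom S.I S.r₀)
  smooth_H : ContDiffOn ℝ ∞ H (dom S.I S.r₀)
  smooth_a₁ : ContDiffOn ℝ ∞ a₁ (dom S.I S.r₀)
  smooth_b₂ : ContDiffOn ℝ ∞ b₂ (dom S.I S.r₀)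
  smooth_U₂ : ContDiffOn ℝ ∞ U₂ (dom S.I S.r₀)
  smooth_H₁ : ContDiffOn ℝ ∞ H₁ (dom S.I S.r₀)
  metric_eq : ∀ p ∈ S.region, ∀ v w, S.metric p v w =
    modelMetric (fun p => a (conf p)) (fun p => b (conf p)) (fun p => U (conf p))
      (fun p => H (conf p)) p v w
  b_ne : ∀ q, b q ≠ 0
  U_ray : ∀ u ∈ S.I, ∀ r : ℝ, S.r₀ < r → ∀ x : E3, ‖x‖ = 1 → U (ray u x r) = S.U u r x
  H_ray : ∀ u ∈ S.I, ∀ r : ℝ, S.r₀ < r → ∀ x : E3, ‖x‖ = 1 → ∀ v w,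
    H (ray u x r) v w = S.h u r x v w
  a_eq : ∀ q ∈ dom S.I S.r₀, a q = 1 + q.2.1 * a₁ q
  b_eq : ∀ q ∈ dom S.I S.r₀, b q = 1 + q.2.1 ^ 2 * b₂ q
  U_eq : ∀ q ∈ dom S.I S.r₀, U q = q.2.1 ^ 2 • U₂ q
  H_eq : ∀ q ∈ dom S.I S.r₀, H q = roundForm q.2.2 + q.2.1 • H₁ q

lemma isBigO_inv_sq_inv : (fun r : ℝ => (r ^ 2)⁻¹) =O[atTop] fun r : ℝ => r⁻¹ :=
  IsBigO.of_bound 1 <| by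
    filter_upwards [eventually_ge_atTop 1] with r hr
    have : 0 < r := by linarith
    rw [one_mul, norm_inv, norm_inv, Real.norm_of_nonneg (by positivity),
      Real.norm_of_nonneg this.le]
    exact inv_anti₀ this (by nlinarith)

lemma isBigO_inv_cube_inv_sq :
    (fun r : ℝ => (r ^ 3)⁻¹) =O[atTop] fun r : ℝ => (r ^ 2)⁻¹ :=
  IsBigO.of_bound 1 <| by
    filter_upwards [eventually_ge_atTop 1] with r hr
    have : 0 < r := by linarith
    rw [one_mul, norm_inv, norm_inv, Real.norm_of_nonneg (by positivity),
      Real.norm_of_nonneg (by positivity)]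
    exact inv_anti₀ (by positivity) (pow_le_pow_right₀ hr (by norm_num))

lemma isBigO_const_mul_self' (c : ℝ) (g : ℝ → ℝ) : (fun r => c * g r) =O[atTop] g :=
  isBigO_const_mul_self c g atTop

/-- The boundary conditions enter as orders of vanishing: each one makes the smooth extension of a
metric function, minus its limit, divisible by ρ or ρ². -/
theorem nonempty_metricExpansion {S : MetricData} (hS : S.IsBondiSachs)
    (hA : S.IsAsymptoticallyFlat) : Nonempty (MetricExpansion S) := by
  have hI := hS.isOpen_I
  have hr := hS.r₀_pos
  obtain ⟨M, c, hA⟩ := hA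
  obtain ⟨β, sβ, hβ, eβ⟩ := hS.β_expands.exists_extension
  obtain ⟨V, sV, hV, eV⟩ := hS.V_expands.exists_extension
  obtain ⟨U, sU, hU, eU⟩ := hS.U_expands.exists_extension
  -- The form h is expandable one pair of vectors at a time; its extension is assembled from the
  -- nine matrix entries.
  have hh := fun i j : Fin 3 => (hS.h_expands (EuclideanSpace.single i 1)
    (EuclideanSpace.single j 1)).exists_extension
  choose h sh hh eh using hh
  set b : Conf → ℝ := fun q => Real.exp (2 * β q) with hb
  set a : Conf → ℝ := fun q => b q * V q with ha
  set H : Conf → CForm3 := fun q => ∑ i, ∑ j, h i j q • coordForm i j with hH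
  have sb : ContDiffOn ℝ ∞ b (dom S.I S.r₀) := (contDiffOn_const.mul sβ).exp
  have sa : ContDiffOn ℝ ∞ a (dom S.I S.r₀) := sb.mul sV
  have sH : ContDiffOn ℝ ∞ H (dom S.I S.r₀) :=
    contDiffOn_sum_smul sh coordForm
  have sq : ContDiffOn ℝ ∞ (fun q : Conf => roundForm q.2.2) (dom S.I S.r₀) :=
    contDiffOn_roundForm.comp (contDiff_snd.comp contDiff_snd).contDiffOn fun q hq => hq.2.2
  have H_ray : ∀ u ∈ S.I, ∀ r : ℝ, S.r₀ < r → ∀ x : E3, ‖x‖ = 1 → ∀ v w,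
      H (ray u x r) v w = S.h u r x v w := by
    intro u hu r hr x hx v w
    rw [form_expand (S.h u r x), hH]
    simp only [sum_apply, smul_apply, coordForm_apply, smul_eq_mul]
    refine Finset.sum_congr rfl fun i _ => Finset.sum_congr rfl fun j _ => ?_
    rw [eh i j u hu r hr x hx, ray]
  have hev : ∀ᶠ r : ℝ in atTop, S.r₀ < r := eventually_gt_atTop _
  have Oβ : ∀ u ∈ S.I, ∀ x : E3, ‖x‖ = 1 →
      (fun r => β (ray u x r)) =O[atTop] fun r : ℝ => (r ^ 2)⁻¹ := by
    intro u hu x hx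
    have h1 := (hA u hu x hx).2.2.1.trans isBigO_inv_cube_inv_sq
    have h2 := h1.sub (isBigO_const_mul_self' (formSq (c u x) / 32) fun r : ℝ => (r ^ 2)⁻¹)
    refine h2.congr' ?_ EventuallyEq.rfl
    filter_upwards [hev] with r hr'
    rw [eβ u hu r hr' x hx, ray]
    field_simp
    ring
  have Ob : ∀ u ∈ S.I, ∀ x : E3, ‖x‖ = 1 →
      (fun r => b (ray u x r) - 1) =O[atTop] fun r : ℝ => (r ^ 2)⁻¹ := by
    intro u hu x hx
    have h1 : (fun z : ℝ => Real.exp (2 * z) - 1) =O[𝓝 0] fun z => z := by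
      have := ((hasDerivAt_id (0 : ℝ)).const_mul 2).exp.isBigO_sub
      simpa using this
    have h2 : Tendsto (fun r => β (ray u x r)) atTop (𝓝 0) :=
      (Oβ u hu x hx).trans_tendsto
        (tendsto_inv_atTop_zero.comp (tendsto_pow_atTop two_ne_zero))
    exact (h1.comp_tendsto h2).trans (Oβ u hu x hx)
  have OV : ∀ u ∈ S.I, ∀ x : E3, ‖x‖ = 1 →
      (fun r => V (ray u x r) - 1) =O[atTop] fun r : ℝ => r⁻¹ := by
    intro u hu x hx
    have h1 := (hA u hu x hx).1
    have h2 : (fun r : ℝ => r⁻¹ * (S.V u r x - (r - 2 * M u x)))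
        =O[atTop] fun r : ℝ => r⁻¹ * r⁻¹ := (isBigO_refl _ _).mul h1
    have h3 : (fun r : ℝ => r⁻¹ * r⁻¹) =O[atTop] fun r : ℝ => r⁻¹ := by
      simpa [pow_two] using isBigO_inv_sq_inv
    have h4 := (h2.trans h3).sub (isBigO_const_mul_self' (2 * M u x) fun r : ℝ => r⁻¹)
    refine h4.congr' ?_ EventuallyEq.rfl
    filter_upwards [hev] with r hr'
    have : r ≠ 0 := (hr.trans hr').ne'
    rw [ray, ← eV u hu r hr' x hx]
    field_simp
    ring
  have Oa : ∀ u ∈ S.I, ∀ x : E3, ‖x‖ = 1 →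
      (fun r => a (ray u x r) - 1) =O[atTop] fun r : ℝ => r⁻¹ := by
    intro u hu x hx
    have h1 := ((Ob u hu x hx).trans isBigO_inv_sq_inv).mul
      ((tendsto_along_ray hI hr sV hu hx).isBigO_one ℝ)
    simp only [mul_one] at h1
    refine (h1.add (OV u hu x hx)).congr_left fun r => ?_
    rw [ha]; ring
  have OU : ∀ u ∈ S.I, ∀ x : E3, ‖x‖ = 1 →
      (fun r => U (ray u x r)) =O[atTop] fun r : ℝ => (r ^ 2)⁻¹ := by
    intro u hu x hx
    have h1 : ∀ w, Tangent x w →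
        (fun r => inner ℝ (S.U u r x) w) =O[atTop] fun r : ℝ => (r ^ 2)⁻¹ := by
      intro w hw
      have h2 := ((hA u hu x hx).2.2.2 w hw).trans isBigO_inv_cube_inv_sq
      have h3 := h2.sub
        (isBigO_const_mul_self' (sphDivForm (c u) x w / 2) fun r : ℝ => (r ^ 2)⁻¹)
      refine h3.congr_left fun r => ?_
      field_simp
      ring
    -- The decay of U is known only against tangent vectors. As U is tangent, pairing it with the
    -- projections of the basis vectors recovers all its components.
    have h2 : (fun r => ∑ i, inner ℝ (S.U u r x) (tanProj x (EuclideanSpace.single i 1)) •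
        EuclideanSpace.single i (1 : ℝ)) =O[atTop] fun r : ℝ => (r ^ 2)⁻¹ := by
      refine IsBigO.fun_sum fun i _ => ?_
      have h3 := (h1 _ (tangent_tanProj hx (EuclideanSpace.single i 1))).smul
        (isBigO_const_const (EuclideanSpace.single i (1 : ℝ)) (one_ne_zero (α := ℝ)) atTop)
      simpa using h3
    refine h2.congr' ?_ EventuallyEq.rfl
    filter_upwards [hev] with r hr'
    rw [ray, ← eU u hu r hr' x hx]
    have ht := hS.U_tangent u hu r hr' x hx
    have h4 : inner ℝ (S.U u r x) x = 0 := by rw [real_inner_comm]; exact ht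
    ext k
    simp only [tanProj_apply, inner_sub_right, inner_smul_right, h4, mul_zero, sub_zero]
    simp [Fin.sum_univ_three, EuclideanSpace.inner_single_right]
    fin_cases k <;> simp
  have OH : ∀ u ∈ S.I, ∀ x : E3, ‖x‖ = 1 →
      (fun r => H (ray u x r) - roundForm x) =O[atTop] fun r : ℝ => r⁻¹ := by
    intro u hu x hx
    have h1 : ∀ v w, (fun r => S.h u r x v w - qForm x v w) =O[atTop] fun r : ℝ => r⁻¹ := by
      intro v w
      have h2 := ((hA u hu x hx).2.1 v w).trans isBigO_inv_sq_inv
      have h3 := h2.add (isBigO_const_mul_self' (c u x v w) fun r : ℝ => r⁻¹)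
      refine h3.congr_left fun r => ?_
      ring
    have h2 : (fun r => ∑ i, ∑ j, (S.h u r x (EuclideanSpace.single i 1)
        (EuclideanSpace.single j 1) - qForm x (EuclideanSpace.single i 1)
        (EuclideanSpace.single j 1)) • coordForm i j) =O[atTop] fun r : ℝ => r⁻¹ :=
      isBigO_sum_smul (fun i j => h1 _ _) coordForm
    refine h2.congr' ?_ EventuallyEq.rfl
    filter_upwards [hev] with r hr'
    ext v w
    rw [sub_apply, sub_apply, H_ray u hu r hr' x hx, roundForm_eq_qForm hx,
      form_expand (S.h u r x) v w, form_expand (qForm x) v w, ← Finset.sum_sub_distrib]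
    simp only [sum_apply, smul_apply, coordForm_apply, smul_eq_mul, ← Finset.sum_sub_distrib,
      sub_mul]
  obtain ⟨a₁, sa₁, ea₁⟩ := exists_factor_of_isBigO hI hr (sa.sub contDiffOn_const)
    (fun u ρ y _ => by simp only [ha, hb, hβ, hV]) Oa
  obtain ⟨b₂, sb₂, eb₂⟩ := exists_factor_sq_of_isBigO hI hr (sb.sub contDiffOn_const)
    (fun u ρ y _ => by simp only [hb, hβ]) Ob
  obtain ⟨U₂, sU₂, eU₂⟩ := exists_factor_sq_of_isBigO hI hr sU (fun u ρ y _ => hU u ρ y) OU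
  obtain ⟨H₁, sH₁, eH₁⟩ := exists_factor_of_isBigO hI hr (sH.sub sq)
    (fun u ρ y _ => by simp only [hH, hh, roundForm, dir_dir]) OH
  refine ⟨⟨a, b, U, H, a₁, b₂, U₂, H₁, sa, sb, sU, sH, sa₁, sb₂, sU₂, sH₁, ?_,
    fun q => (Real.exp_pos _).ne', fun u hu r hr' x hx => (eU u hu r hr' x hx).symm, H_ray,
    fun q hq => ?_, fun q hq => ?_, eU₂, fun q hq => ?_⟩⟩
  · intro p hp v w
    have hp0 : p.2 ≠ 0 := norm_pos_iff.1 (hr.trans hp.2)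
    have hx := norm_dir hp0
    have e1 := eβ p.1 hp.1 ‖p.2‖ hp.2 _ hx
    have e2 := eV p.1 hp.1 ‖p.2‖ hp.2 _ hx
    have e3 := eU p.1 hp.1 ‖p.2‖ hp.2 _ hx
    have e4 := H_ray p.1 hp.1 ‖p.2‖ hp.2 _ hx
    simp only [MetricData.metric, modelMetric, shiftedForm, conf, ha, hb]
    change Real.exp (2 * S.β p.1 ‖p.2‖ (dir p.2)) * (S.V p.1 ‖p.2‖ (dir p.2) / ‖p.2‖) * _
      + Real.exp (2 * S.β p.1 ‖p.2‖ (dir p.2)) * _ - ‖p.2‖ ^ 2 * S.h p.1 ‖p.2‖ (dir p.2)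
      (dx p.2 v - du v • S.U p.1 ‖p.2‖ (dir p.2)) (dx p.2 w - du w • S.U p.1 ‖p.2‖ (dir p.2)) = _
    rw [e1, e2, e3, ← e4]
    rfl
  · have := ea₁ q hq
    simp only [smul_eq_mul] at this
    linarith
  · have := eb₂ q hq
    simp only [smul_eq_mul] at this
    linarith
  · rw [← eH₁ q hq]
    abel

/-! ### The variation in terms of the expansions -/

lemma isOpen_region {S : MetricData} (hS : S.IsBondiSachs) : IsOpen S.region :=
  (hS.isOpen_I.preimage continuous_fst).inter
    (isOpen_Ioi.preimage (continuous_norm.comp continuous_snd))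

lemma snd_ne_zero_of_mem_region {S : MetricData} (hS : S.IsBondiSachs) {p : Spacetime}
    (hp : p ∈ S.region) : p.2 ≠ 0 := norm_pos_iff.1 (hS.r₀_pos.trans hp.2)

lemma conf_mem_dom {S : MetricData} (hS : S.IsBondiSachs) {p : Spacetime}
    (hp : p ∈ S.region) : conf p ∈ dom S.I S.r₀ :=
  mem_dom.2 ⟨hp.1, by rw [inv_eq_one_div]; exact one_div_lt_one_div_of_lt hS.r₀_pos hp.2,
    dir_ne_zero (snd_ne_zero_of_mem_region hS hp)⟩

/-- The part `ρ > 0` of the domain. -/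
def domPos (I : Set ℝ) (r₀ : ℝ) : Set Conf := dom I r₀ ∩ {q | 0 < q.2.1}

lemma isOpen_domPos {I : Set ℝ} (hI : IsOpen I) (r₀ : ℝ) : IsOpen (domPos I r₀) :=
  (isOpen_dom hI r₀).inter (isOpen_Ioi.preimage (continuous_fst.comp continuous_snd))

lemma domPos_subset (I : Set ℝ) (r₀ : ℝ) : domPos I r₀ ⊆ dom I r₀ := Set.inter_subset_left

lemma conf_mem_domPos {S : MetricData} (hS : S.IsBondiSachs) {p : Spacetime}
    (hp : p ∈ S.region) : conf p ∈ domPos S.I S.r₀ :=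
  ⟨conf_mem_dom hS hp, inv_pos.2 (hS.r₀_pos.trans hp.2)⟩

lemma ray_mem_domPos {I : Set ℝ} {r₀ : ℝ} (hr : 0 < r₀) {u : ℝ} (hu : u ∈ I) {x : E3}
    (hx : ‖x‖ = 1) {r : ℝ} (h : r₀ < r) : ray u x r ∈ domPos I r₀ :=
  ⟨ray_mem_dom hr hu hx h, inv_pos.2 (hr.trans h)⟩

lemma pt_mem_region {S : MetricData} (hS : S.IsBondiSachs) {u r : ℝ} (hu : u ∈ S.I)
    (hr : S.r₀ < r) {x : E3} (hx : ‖x‖ = 1) : pt u r x ∈ S.region := by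
  refine ⟨hu, ?_⟩
  rw [pt, norm_smul_unit (hS.r₀_pos.trans hr) hx]
  exact hr

lemma conf_pt (u : ℝ) {r : ℝ} (hr : 0 < r) {x : E3} (hx : ‖x‖ = 1) :
    conf (pt u r x) = ray u x r := by
  simp only [conf, pt, norm_smul_unit hr hx, dir_smul_unit hr hx, ray]

/-- The differential of `conf`. -/
def dconf (p : Spacetime) : Spacetime →L[ℝ] Conf :=
  du.prod ((-(‖p.2‖ ^ 2)⁻¹ • dr p.2).prod (dx p.2))

lemma dconf_apply (p v : Spacetime) :
    dconf p v = (du v, -(‖p.2‖ ^ 2)⁻¹ * dr p.2 v, dx p.2 v) := rfl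

lemma hasFDerivAt_conf {p : Spacetime} (hp : p.2 ≠ 0) : HasFDerivAt conf (dconf p) p := by
  have h1 : HasFDerivAt (fun p : Spacetime => ‖p.2‖⁻¹) (-(‖p.2‖ ^ 2)⁻¹ • dr p.2) p :=
    (hasDerivAt_inv (norm_ne_zero_iff.2 hp)).comp_hasFDerivAt p (hasFDerivAt_radius hp)
  exact hasFDerivAt_fst.prodMk (h1.prodMk (hasFDerivAt_direction hp))

lemma hasFDerivAt_comp_conf {G : Type*} [NormedAddCommGroup G] [NormedSpace ℝ G] {S : MetricData}
    (hS : S.IsBondiSachs) {W : Conf → G} (hW : ContDiffOn ℝ ∞ W (domPos S.I S.r₀)) {p : Spacetime}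
    (hp : p ∈ S.region) :
    HasFDerivAt (fun p => W (conf p)) ((fderiv ℝ W (conf p)).comp (dconf p)) p :=
  (((hW.contDiffAt ((isOpen_domPos hS.isOpen_I S.r₀).mem_nhds (conf_mem_domPos hS hp)
    )).differentiableAt (by simp)).hasFDerivAt).comp p (hasFDerivAt_conf (snd_ne_zero_of_mem_region hS hp))

/-! ### The coordinate vectors ∂_u, ∂_r, ∂_A in terms of du, dr, dx and of (u, ρ, x) -/

section Coordinates

variable (u : ℝ) {r : ℝ} (hr : 0 < r) {x : E3} (hx : ‖x‖ = 1)
include hr hx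

lemma dr_pt (v : Spacetime) : dr (pt u r x).2 v = inner ℝ x v.2 := by
  have : ‖(pt u r x).2‖⁻¹ • (pt u r x).2 = x := dir_smul_unit hr hx
  simp [dr, this]

lemma dx_pt (v : Spacetime) : dx (pt u r x).2 v = r⁻¹ • tanProj x v.2 := by
  have h1 : ‖(pt u r x).2‖⁻¹ • (pt u r x).2 = x := dir_smul_unit hr hx
  have h2 : ‖(pt u r x).2‖ = r := norm_smul_unit hr hx
  rw [h2] at h1
  simp only [dx, h2, h1]
  rfl

lemma dr_partialU : dr (pt u r x).2 partialU = 0 := by simp [dr_pt u hr hx, partialU]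
lemma dr_partialR : dr (pt u r x).2 (partialR x) = 1 := by simp [dr_pt u hr hx, partialR, hx]
lemma dr_partialAng {e : E3} (he : Tangent x e) : dr (pt u r x).2 (partialAng r e) = 0 := by
  rw [dr_pt u hr hx, partialAng]
  exact tangent_smul r he
lemma dx_partialU : dx (pt u r x).2 partialU = 0 := by simp [dx_pt u hr hx, partialU]
lemma dx_partialR : dx (pt u r x).2 (partialR x) = 0 := by
  simp [dx_pt u hr hx, partialR, tanProj_self hx]
lemma dx_partialAng {e : E3} (he : Tangent x e) : dx (pt u r x).2 (partialAng r e) = e := by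
  rw [dx_pt u hr hx, partialAng, tanProj_of_tangent (tangent_smul r he), smul_smul,
    inv_mul_cancel₀ hr.ne', one_smul]

omit hr hx in
lemma du_partialU : du partialU = 1 := rfl
omit hr hx in
lemma du_partialR (x : E3) : du (partialR x) = 0 := rfl
omit hr hx in
lemma du_partialAng (r : ℝ) (e : E3) : du (partialAng r e) = 0 := rfl

lemma dconf_partialU : dconf (pt u r x) partialU = (1, 0, 0) := by
  rw [dconf_apply, dr_partialU u hr hx, dx_partialU u hr hx, du_partialU, mul_zero]

lemma dconf_partialR : dconf (pt u r x) (partialR x) = (0, -(r ^ 2)⁻¹, 0) := by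
  rw [dconf_apply, dr_partialR u hr hx, dx_partialR u hr hx, du_partialR, mul_one,
    show ‖(pt u r x).2‖ = r from norm_smul_unit hr hx]

lemma dconf_partialAng {e : E3} (he : Tangent x e) :
    dconf (pt u r x) (partialAng r e) = (0, 0, e) := by
  rw [dconf_apply, dr_partialAng u hr hx he, dx_partialAng u hr hx he, du_partialAng, mul_zero]

end Coordinates

/-- The components of the smooth vector field `ξ` are `ξ^u = F`, `ξ^r = r X`, `ξ^A = Y`, as functions
of `(u, ρ, x)`. -/
structure HasComponents (S : MetricData) (ξ : Spacetime → Spacetime) (F X : Conf → ℝ)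
    (Y : Conf → E3) : Prop where
  smooth : ContDiffOn ℝ ∞ ξ S.region
  smooth_F : ContDiffOn ℝ ∞ F (domPos S.I S.r₀)
  smooth_X : ContDiffOn ℝ ∞ X (domPos S.I S.r₀)
  smooth_Y : ContDiffOn ℝ ∞ Y (domPos S.I S.r₀)
  comp_u : ∀ p ∈ S.region, du (ξ p) = F (conf p)
  comp_r : ∀ p ∈ S.region, dr p.2 (ξ p) = ‖p.2‖ * X (conf p)
  comp_ang : ∀ p ∈ S.region, dx p.2 (ξ p) = Y (conf p)

/-- The vector field with components `F`, `X`, `Y` in the coordinates `(u, ρ, x)`. -/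
def confField (F X : Conf → ℝ) (Y : Conf → E3) (q : Conf) : Conf := (F q, -(q.2.1 * X q), Y q)

/-- The Lie derivative of `dx^A - U^A du` in the coordinates `(u, ρ, x)`. -/
def confLie (U : Conf → E3) (F X : Conf → ℝ) (Y : Conf → E3) (q w : Conf) : E3 :=
  fderiv ℝ Y q w - w.1 • fderiv ℝ U q (confField F X Y q) - fderiv ℝ F q w • U q

section Variation

variable {S : MetricData} (hS : S.IsBondiSachs) (E : MetricExpansion S)
include hS

lemma variation_eq_model {ξ : Spacetime → Spacetime} {p : Spacetime} (hp : p ∈ S.region)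
    (v w : Spacetime) :
    variation S.metric ξ p v w = variation (modelMetric (fun p => E.a (conf p))
      (fun p => E.b (conf p)) (fun p => E.U (conf p)) (fun p => E.H (conf p))) ξ p v w := by
  have h : (fun p' => S.metric p' v w) =ᶠ[𝓝 p] fun p' => modelMetric (fun p => E.a (conf p))
      (fun p => E.b (conf p)) (fun p => E.U (conf p)) (fun p => E.H (conf p)) p' v w := by
    filter_upwards [(isOpen_region hS).mem_nhds hp] with p' hp' using E.metric_eq p' hp' v w
  rw [variation, variation, h.fderiv_eq, E.metric_eq p hp, E.metric_eq p hp]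

lemma variation_eq_of_smooth {ξ : Spacetime → Spacetime} (hξ : ContDiffOn ℝ ∞ ξ S.region)
    {p : Spacetime} (hp : p ∈ S.region) (v w : Spacetime) :
    variation S.metric ξ p v w =
      -(fderiv ℝ (fun p => E.a (conf p)) p (ξ p) * (du v * du w)
        + E.a (conf p) * (fderiv ℝ (fun p => du (ξ p)) p v * du w
          + du v * fderiv ℝ (fun p => du (ξ p)) p w)
        + fderiv ℝ (fun p => E.b (conf p)) p (ξ p) * (du v * dr p.2 w + dr p.2 v * du w)
        + E.b (conf p) * (fderiv ℝ (fun p => du (ξ p)) p v * dr p.2 w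
          + du v * fderiv ℝ (fun p => dr p.2 (ξ p)) p w
          + fderiv ℝ (fun p => dr p.2 (ξ p)) p v * du w
          + dr p.2 v * fderiv ℝ (fun p => du (ξ p)) p w)
        - 2 * ‖p.2‖ * dr p.2 (ξ p) * E.H (conf p) (shiftedForm (fun p => E.U (conf p)) p v)
            (shiftedForm (fun p => E.U (conf p)) p w)
        - ‖p.2‖ ^ 2 * (fderiv ℝ (fun p => E.H (conf p)) p (ξ p)
            (shiftedForm (fun p => E.U (conf p)) p v) (shiftedForm (fun p => E.U (conf p)) p w)
          + E.H (conf p) (lieShifted (fun p => E.U (conf p)) ξ p v)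
            (shiftedForm (fun p => E.U (conf p)) p w)
          + E.H (conf p) (shiftedForm (fun p => E.U (conf p)) p v)
            (lieShifted (fun p => E.U (conf p)) ξ p w))) := by
  rw [variation_eq_model hS E hp]
  exact variation_modelMetric (snd_ne_zero_of_mem_region hS hp)
    (hasFDerivAt_comp_conf hS (E.smooth_a.mono (domPos_subset _ _)) hp).differentiableAt
    (hasFDerivAt_comp_conf hS (E.smooth_b.mono (domPos_subset _ _)) hp).differentiableAt
    (hasFDerivAt_comp_conf hS (E.smooth_U.mono (domPos_subset _ _)) hp).differentiableAt
    (hasFDerivAt_comp_conf hS (E.smooth_H.mono (domPos_subset _ _)) hp).differentiableAt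
    ((hξ.contDiffAt ((isOpen_region hS).mem_nhds hp)).differentiableAt (by simp)) v w

variable {ξ : Spacetime → Spacetime} {F X : Conf → ℝ} {Y : Conf → E3}
  (hξ : HasComponents S ξ F X Y)
include hξ

/-- As dρ = -ρ² dr and ξ^r = X/ρ, the ρ-component of ξ is -ρX. When X extends to ρ = 0 this
component vanishes there, so ξ becomes tangent to the boundary. -/
lemma dconf_field {p : Spacetime} (hp : p ∈ S.region) :
    dconf p (ξ p) = confField F X Y (conf p) := by
  have hn : ‖p.2‖ ≠ 0 := norm_ne_zero_iff.2 (snd_ne_zero_of_mem_region hS hp)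
  rw [dconf_apply, hξ.comp_u p hp, hξ.comp_r p hp, hξ.comp_ang p hp, confField]
  simp only [conf, Prod.mk.injEq, true_and, and_true]
  field_simp

lemma fderiv_field {G : Type*} [NormedAddCommGroup G] [NormedSpace ℝ G] {W : Conf → G}
    (hW : ContDiffOn ℝ ∞ W (dom S.I S.r₀)) {p : Spacetime} (hp : p ∈ S.region) :
    fderiv ℝ (fun p => W (conf p)) p (ξ p) =
      fderiv ℝ W (conf p) (confField F X Y (conf p)) := by
  rw [(hasFDerivAt_comp_conf hS (hW.mono (domPos_subset _ _)) hp).fderiv,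
    ContinuousLinearMap.comp_apply, dconf_field hS hξ hp]

lemma fderiv_comp_u {p : Spacetime} (hp : p ∈ S.region) (v : Spacetime) :
    fderiv ℝ (fun p => du (ξ p)) p v = fderiv ℝ F (conf p) (dconf p v) := by
  have h : (fun p => du (ξ p)) =ᶠ[𝓝 p] fun p => F (conf p) := by
    filter_upwards [(isOpen_region hS).mem_nhds hp] with p' hp' using hξ.comp_u p' hp'
  rw [h.fderiv_eq, (hasFDerivAt_comp_conf hS hξ.smooth_F hp).fderiv]
  rfl

lemma fderiv_comp_ang {p : Spacetime} (hp : p ∈ S.region) (v : Spacetime) :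
    fderiv ℝ (fun p => dx p.2 (ξ p)) p v = fderiv ℝ Y (conf p) (dconf p v) := by
  have h : (fun p => dx p.2 (ξ p)) =ᶠ[𝓝 p] fun p => Y (conf p) := by
    filter_upwards [(isOpen_region hS).mem_nhds hp] with p' hp' using hξ.comp_ang p' hp'
  rw [h.fderiv_eq, (hasFDerivAt_comp_conf hS hξ.smooth_Y hp).fderiv]
  rfl

lemma fderiv_comp_r {p : Spacetime} (hp : p ∈ S.region) (v : Spacetime) :
    fderiv ℝ (fun p => dr p.2 (ξ p)) p v =
      ‖p.2‖ * fderiv ℝ X (conf p) (dconf p v) + dr p.2 v * X (conf p) := by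
  have h : (fun p => dr p.2 (ξ p)) =ᶠ[𝓝 p] fun p => ‖p.2‖ * X (conf p) := by
    filter_upwards [(isOpen_region hS).mem_nhds hp] with p' hp' using hξ.comp_r p' hp'
  have h2 := (hasFDerivAt_radius (snd_ne_zero_of_mem_region hS hp)).mul
    (hasFDerivAt_comp_conf hS hξ.smooth_X hp)
  rw [h.fderiv_eq]
  refine (congrArg (fun L => L v) h2.fderiv).trans ?_
  simp
  ring

lemma lieShifted_eq {p : Spacetime} (hp : p ∈ S.region) (v : Spacetime) :
    lieShifted (fun p => E.U (conf p)) ξ p v = confLie E.U F X Y (conf p) (dconf p v) := by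
  rw [lieShifted, fderiv_comp_ang hS hξ hp, fderiv_comp_u hS hξ hp,
    fderiv_field hS hξ E.smooth_U hp, confLie, dconf_apply]

variable {u : ℝ} (hu : u ∈ S.I) {r : ℝ} (hr : S.r₀ < r) {x : E3} (hx : ‖x‖ = 1)
include hu hr hx

omit hξ hu in
lemma shiftedForm_partialU :
    shiftedForm (fun p => E.U (conf p)) (pt u r x) partialU = -E.U (ray u x r) := by
  have hr' := hS.r₀_pos.trans hr
  rw [shiftedForm, dx_partialU u hr' hx, du_partialU, conf_pt u hr' hx, one_smul, zero_sub]

omit hξ hu in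
lemma shiftedForm_partialR :
    shiftedForm (fun p => E.U (conf p)) (pt u r x) (partialR x) = 0 := by
  have hr' := hS.r₀_pos.trans hr
  rw [shiftedForm, dx_partialR u hr' hx, du_partialR, zero_smul, sub_zero]

omit hξ hu in
lemma shiftedForm_partialAng {e : E3} (he : Tangent x e) :
    shiftedForm (fun p => E.U (conf p)) (pt u r x) (partialAng r e) = e := by
  have hr' := hS.r₀_pos.trans hr
  rw [shiftedForm, dx_partialAng u hr' hx he, du_partialAng, zero_smul, sub_zero]

omit hS hξ hu hr hx in
/-- The derivative of `W` in the direction of `∂_r`. -/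
lemma fderiv_partialR {G : Type*} [NormedAddCommGroup G] [NormedSpace ℝ G] (W : Conf → G) (q : Conf)
    (r : ℝ) : fderiv ℝ W q (0, -(r ^ 2)⁻¹, 0) = -(r ^ 2)⁻¹ • fderiv ℝ W q (0, 1, 0) := by
  rw [← map_smul]
  simp

omit hξ in
lemma confLie_partialR (hF : ∀ q ∈ domPos S.I S.r₀, fderiv ℝ F q (0, 1, 0) = 0) :
    confLie E.U F X Y (ray u x r) (0, -(r ^ 2)⁻¹, 0) =
    -(r ^ 2)⁻¹ • fderiv ℝ Y (ray u x r) (0, 1, 0) := by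
  rw [confLie, fderiv_partialR, fderiv_partialR,
    hF _ (ray_mem_domPos hS.r₀_pos hu hx hr), smul_zero, zero_smul, zero_smul, sub_zero,
    sub_zero]

include E in
-- The vector ∂_r is annihilated by du and by dx - U du, so only the du dr part of the metric
-- contributes. As b ≠ 0, the condition δg_rr = 0 says that F does not depend on ρ.
lemma variation_rr :
    variation S.metric ξ (pt u r x) (partialR x) (partialR x) =
      2 * (r ^ 2)⁻¹ * E.b (ray u x r) * fderiv ℝ F (ray u x r) (0, 1, 0) := by
  have hr' := hS.r₀_pos.trans hr
  have hp := pt_mem_region hS hu hr hx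
  have hn : ‖(pt u r x).2‖ = r := norm_smul_unit hr' hx
  rw [variation_eq_of_smooth hS E hξ.smooth hp]
  simp only [fderiv_field hS hξ E.smooth_a hp, fderiv_field hS hξ E.smooth_b hp, fderiv_field hS
    hξ E.smooth_H hp, hξ.comp_r _ hp, fderiv_comp_u hS hξ hp, fderiv_comp_r hS hξ hp,
    lieShifted_eq hS E hξ hp, conf_pt u hr' hx, hn, du_partialR,
    shiftedForm_partialR hS E hr hx, dr_partialR u hr' hx, dconf_partialR u hr' hx,
    fderiv_partialR, map_zero,
    zero_apply, smul_eq_mul]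
  ring

/-- The factor r² of the angular metric cancels the factor in ∂_r = -ρ² ∂_ρ. What remains is the
equation h_{AB} ∂_ρ Y^B = -e^{2β} ∂_A F, which is regular at ρ = 0. -/
lemma variation_rA (hF : ∀ q ∈ domPos S.I S.r₀, fderiv ℝ F q (0, 1, 0) = 0) {e : E3} (he : Tangent x e) :
    variation S.metric ξ (pt u r x) (partialR x) (partialAng r e) =
      -(E.b (ray u x r) * fderiv ℝ F (ray u x r) (0, 0, e)
        + E.H (ray u x r) (fderiv ℝ Y (ray u x r) (0, 1, 0)) e) := by
  have hr' := hS.r₀_pos.trans hr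
  have hp := pt_mem_region hS hu hr hx
  have hn : ‖(pt u r x).2‖ = r := norm_smul_unit hr' hx
  have hF' := hF _ (ray_mem_domPos hS.r₀_pos hu hx hr)
  rw [variation_eq_of_smooth hS E hξ.smooth hp]
  simp only [fderiv_field hS hξ E.smooth_a hp, fderiv_field hS hξ E.smooth_b hp, fderiv_field hS
    hξ E.smooth_H hp, hξ.comp_r _ hp, fderiv_comp_u hS hξ hp, fderiv_comp_r hS hξ hp,
    lieShifted_eq hS E hξ hp, conf_pt u hr' hx, hn, du_partialR, du_partialAng,
    shiftedForm_partialR hS E hr hx, dr_partialR u hr' hx, dconf_partialR u hr' hx,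
    confLie_partialR hS E hu hr hx hF, fderiv_partialR, hF', shiftedForm_partialAng hS E hr hx
    he, dr_partialAng u hr' hx he, dconf_partialAng u hr' hx he, map_zero, map_smul,
    zero_apply, smul_apply, smul_eq_mul]
  field_simp
  ring

/-- The condition δg_AB = O(r) concerns the bracket: when it extends smoothly, its value at ρ = 0
has to vanish. -/
lemma variation_AB {e e' : E3} (he : Tangent x e) (he' : Tangent x e') :
    variation S.metric ξ (pt u r x) (partialAng r e) (partialAng r e') =
      r ^ 2 * (2 * X (ray u x r) * E.H (ray u x r) e e'
        + fderiv ℝ E.H (ray u x r) (confField F X Y (ray u x r)) e e'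
        + E.H (ray u x r) (confLie E.U F X Y (ray u x r) (0, 0, e)) e'
        + E.H (ray u x r) e (confLie E.U F X Y (ray u x r) (0, 0, e'))) := by
  have hr' := hS.r₀_pos.trans hr
  have hp := pt_mem_region hS hu hr hx
  have hn : ‖(pt u r x).2‖ = r := norm_smul_unit hr' hx
  rw [variation_eq_of_smooth hS E hξ.smooth hp]
  simp only [fderiv_field hS hξ E.smooth_a hp, fderiv_field hS hξ E.smooth_b hp, fderiv_field hS
    hξ E.smooth_H hp, hξ.comp_r _ hp, fderiv_comp_u hS hξ hp, fderiv_comp_r hS hξ hp,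
    lieShifted_eq hS E hξ hp, conf_pt u hr' hx, hn, du_partialAng,
    shiftedForm_partialAng hS E hr hx he, dr_partialAng u hr' hx he, dconf_partialAng u hr' hx
    he, shiftedForm_partialAng hS E hr hx he', dr_partialAng u hr' hx he', dconf_partialAng u
    hr' hx he']
  ring

/-- With U = O(ρ²) the prefactor r² of the bracket is harmless; the dangerous term is r ∂_u X. -/
lemma variation_uu :
    variation S.metric ξ (pt u r x) partialU partialU =
      -(fderiv ℝ E.a (ray u x r) (confField F X Y (ray u x r))
        + 2 * E.a (ray u x r) * fderiv ℝ F (ray u x r) (1, 0, 0)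
        + 2 * E.b (ray u x r) * (r * fderiv ℝ X (ray u x r) (1, 0, 0))
        - r ^ 2 * (2 * X (ray u x r) * E.H (ray u x r) (E.U (ray u x r)) (E.U (ray u x r))
          + fderiv ℝ E.H (ray u x r) (confField F X Y (ray u x r)) (E.U (ray u x r))
            (E.U (ray u x r))
          - E.H (ray u x r) (confLie E.U F X Y (ray u x r) (1, 0, 0)) (E.U (ray u x r))
          - E.H (ray u x r) (E.U (ray u x r)) (confLie E.U F X Y (ray u x r) (1, 0, 0)))) := by
  have hr' := hS.r₀_pos.trans hr
  have hp := pt_mem_region hS hu hr hx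
  have hn : ‖(pt u r x).2‖ = r := norm_smul_unit hr' hx
  rw [variation_eq_of_smooth hS E hξ.smooth hp]
  simp only [fderiv_field hS hξ E.smooth_a hp, fderiv_field hS hξ E.smooth_b hp, fderiv_field hS
    hξ E.smooth_H hp, hξ.comp_r _ hp, fderiv_comp_u hS hξ hp, fderiv_comp_r hS hξ hp,
    lieShifted_eq hS E hξ hp, conf_pt u hr' hx, hn, du_partialU,
    shiftedForm_partialU hS E hr hx, dr_partialU u hr' hx, dconf_partialU u hr' hx, map_neg,
    neg_apply]
  ring

/-- At order r² only the u-derivative of Y at ρ = 0 survives, because U = O(ρ²). -/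
lemma variation_uA {e : E3} (he : Tangent x e) :
    variation S.metric ξ (pt u r x) partialU (partialAng r e) =
      -(E.a (ray u x r) * fderiv ℝ F (ray u x r) (0, 0, e)
        + E.b (ray u x r) * (r * fderiv ℝ X (ray u x r) (0, 0, e))
        + r ^ 2 * (2 * X (ray u x r) * E.H (ray u x r) (E.U (ray u x r)) e
          + fderiv ℝ E.H (ray u x r) (confField F X Y (ray u x r)) (E.U (ray u x r)) e
          - E.H (ray u x r) (confLie E.U F X Y (ray u x r) (1, 0, 0)) e
          + E.H (ray u x r) (E.U (ray u x r)) (confLie E.U F X Y (ray u x r) (0, 0, e)))) := by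
  have hr' := hS.r₀_pos.trans hr
  have hp := pt_mem_region hS hu hr hx
  have hn : ‖(pt u r x).2‖ = r := norm_smul_unit hr' hx
  rw [variation_eq_of_smooth hS E hξ.smooth hp]
  simp only [fderiv_field hS hξ E.smooth_a hp, fderiv_field hS hξ E.smooth_b hp, fderiv_field hS
    hξ E.smooth_H hp, hξ.comp_r _ hp, fderiv_comp_u hS hξ hp, fderiv_comp_r hS hξ hp,
    lieShifted_eq hS E hξ hp, conf_pt u hr' hx, hn, du_partialU, du_partialAng,
    shiftedForm_partialU hS E hr hx, dr_partialU u hr' hx, dconf_partialU u hr' hx,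
    shiftedForm_partialAng hS E hr hx he, dr_partialAng u hr' hx he, dconf_partialAng u hr' hx
    he, map_neg, neg_apply]
  ring

/-- The limit at ρ = 0 is -(∂_u F + X), which links the u-dependence of F to the divergence of Y. -/
lemma variation_ur (hF : ∀ q ∈ domPos S.I S.r₀, fderiv ℝ F q (0, 1, 0) = 0) :
    variation S.metric ξ (pt u r x) partialU (partialR x) =
      -(fderiv ℝ E.b (ray u x r) (confField F X Y (ray u x r))
        + E.b (ray u x r) * (fderiv ℝ F (ray u x r) (1, 0, 0) + X (ray u x r)
          - r⁻¹ * fderiv ℝ X (ray u x r) (0, 1, 0))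
        - E.H (ray u x r) (E.U (ray u x r)) (fderiv ℝ Y (ray u x r) (0, 1, 0))) := by
  have hr' := hS.r₀_pos.trans hr
  have hp := pt_mem_region hS hu hr hx
  have hn : ‖(pt u r x).2‖ = r := norm_smul_unit hr' hx
  have hF' := hF _ (ray_mem_domPos hS.r₀_pos hu hx hr)
  rw [variation_eq_of_smooth hS E hξ.smooth hp]
  simp only [fderiv_field hS hξ E.smooth_a hp, fderiv_field hS hξ E.smooth_b hp, fderiv_field hS
    hξ E.smooth_H hp, hξ.comp_r _ hp, fderiv_comp_u hS hξ hp, fderiv_comp_r hS hξ hp,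
    lieShifted_eq hS E hξ hp, conf_pt u hr' hx, hn, du_partialU, du_partialR,
    shiftedForm_partialU hS E hr hx, dr_partialU u hr' hx, dconf_partialU u hr' hx,
    shiftedForm_partialR hS E hr hx, dr_partialR u hr' hx, dconf_partialR u hr' hx,
    confLie_partialR hS E hu hr hx hF, fderiv_partialR, hF', map_neg, map_zero, map_smul,
    neg_apply, smul_eq_mul]
  field_simp
  ring

end Variation

/-! ### The trace of the angular variation -/

namespace IsFrame

variable {x e₁ e₂ : E3} (h : IsFrame x e₁ e₂)
include h

lemma inner_cross (a b : E3) :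
    inner ℝ x (cross a b) = inner ℝ e₁ a * inner ℝ e₂ b - inner ℝ e₂ a * inner ℝ e₁ b := by
  obtain ⟨-, h2, h3⟩ := h.eqs
  have e : e₂ = cross x e₁ := h.snd_eq
  simp only [e, inner_eq, cross_zero', cross_one', cross_two']
  linear_combination
    -(x 0 * (a 1 * b 2 - a 2 * b 1) + x 1 * (a 2 * b 0 - a 0 * b 2)
      + x 2 * (a 0 * b 1 - a 1 * b 0)) * h2
    + (e₁ 0 * (a 1 * b 2 - a 2 * b 1) + e₁ 1 * (a 2 * b 0 - a 0 * b 2)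
      + e₁ 2 * (a 0 * b 1 - a 1 * b 0)) * h3

lemma cross_fst_snd : cross e₁ e₂ = x := by
  obtain ⟨-, h2, h3⟩ := h.eqs
  have e : e₂ = cross x e₁ := h.snd_eq
  simp only [e]
  apply ext_three <;> simp only [cross_zero', cross_one', cross_two']
  · linear_combination x 0 * h2 - e₁ 0 * h3
  · linear_combination x 1 * h2 - e₁ 1 * h3
  · linear_combination x 2 * h2 - e₁ 2 * h3

lemma inner_fst_fst : inner ℝ e₁ e₁ = (1 : ℝ) := by
  rw [real_inner_self_eq_norm_sq, h.norm_fst, one_pow]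

lemma inner_snd_snd : inner ℝ e₂ e₂ = (1 : ℝ) := by
  rw [real_inner_self_eq_norm_sq, h.norm_snd, one_pow]

end IsFrame

/-- For a symmetric form `B` with `det B = 1` on the span of `e₁`, `e₂`, the trace of `L` there. -/
def adjTrace (B L : E3 → E3 → ℝ) (e₁ e₂ : E3) : ℝ :=
  B e₂ e₂ * L e₁ e₁ - B e₁ e₂ * (L e₁ e₂ + L e₂ e₁) + B e₁ e₁ * L e₂ e₂

/-- A bilinear map, unbundled. -/
def IsBilin (B : E3 → E3 → ℝ) : Prop :=
  ∀ (a b c d : ℝ) (v w v' w' : E3), B (a • v + b • w) (c • v' + d • w') =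
    a * c * B v v' + a * d * B v w' + b * c * B w v' + b * d * B w w'

lemma isBilin_form (B : CForm3) : IsBilin fun v w => B v w := by
  intro a b c d v w v' w'
  simp only [map_add, map_smul, add_apply, smul_apply, smul_eq_mul]
  ring

/-- The adjugate of the 2 × 2 matrix of `B` turns the change of basis into the square of its
determinant. A vanishing trace need therefore be established in one orthonormal frame only. -/
lemma adjTrace_comb {B L : E3 → E3 → ℝ} (hB : IsBilin B) (hL : IsBilin L)
    (hs : ∀ v w, B v w = B w v) (a b c d : ℝ) (e₁ e₂ : E3) :
    adjTrace B L (a • e₁ + b • e₂) (c • e₁ + d • e₂) =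
      (a * d - b * c) ^ 2 * adjTrace B L e₁ e₂ := by
  simp only [adjTrace, hB _ _ _ _ e₁ e₂ e₁ e₂, hL _ _ _ _ e₁ e₂ e₁ e₂, hs e₂ e₁]
  ring

section

variable {S : MetricData} (hS : S.IsBondiSachs) (E : MetricExpansion S)
include hS

lemma H_symm {p : Spacetime} (hp : p ∈ S.region) (v w : E3) :
    E.H (conf p) v w = E.H (conf p) w v := by
  have hx := norm_dir (snd_ne_zero_of_mem_region hS hp)
  have e : conf p = ray p.1 (dir p.2) ‖p.2‖ := rfl
  rw [e, E.H_ray p.1 hp.1 _ hp.2 _ hx, E.H_ray p.1 hp.1 _ hp.2 _ hx]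
  exact hS.h_symm p.1 hp.1 _ hp.2 _ hx v w

lemma H_normal {p : Spacetime} (hp : p ∈ S.region) (w : E3) :
    E.H (conf p) (dir p.2) w = 0 := by
  have hx := norm_dir (snd_ne_zero_of_mem_region hS hp)
  have e : conf p = ray p.1 (dir p.2) ‖p.2‖ := rfl
  rw [e, E.H_ray p.1 hp.1 _ hp.2 _ hx]
  exact hS.h_normal p.1 hp.1 _ hp.2 _ hx w

lemma H_frame {p : Spacetime} (hp : p ∈ S.region) {e₁ e₂ : E3} (h : IsFrame (dir p.2) e₁ e₂) :
    E.H (conf p) e₁ e₁ * E.H (conf p) e₂ e₂ - E.H (conf p) e₁ e₂ ^ 2 = 1 := by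
  have hx := norm_dir (snd_ne_zero_of_mem_region hS hp)
  have e : conf p = ray p.1 (dir p.2) ‖p.2‖ := rfl
  have h1 := hS.h_det p.1 hp.1 _ hp.2 _ hx ![e₁, e₂] h.orthonormal_pair
    (Fin.forall_fin_two.2 ⟨h.tangent_fst, h.tangent_snd⟩)
  rw [Matrix.det_fin_two] at h1
  simp only [Matrix.of_apply, Matrix.cons_val_zero, Matrix.cons_val_one] at h1
  simp only [← E.H_ray p.1 hp.1 _ hp.2 _ hx, ← e] at h1
  rw [H_symm hS E hp e₂ e₁] at h1
  linarith

lemma H_expand {p : Spacetime} (hp : p ∈ S.region) {e₁ e₂ : E3} (h : IsFrame (dir p.2) e₁ e₂)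
    (v w : E3) : E.H (conf p) v w =
      E.H (conf p) (inner ℝ e₁ v • e₁ + inner ℝ e₂ v • e₂)
        (inner ℝ e₁ w • e₁ + inner ℝ e₂ w • e₂) := by
  have hn := H_normal hS E hp
  conv_lhs => rw [h.expand v, h.expand w]
  simp only [map_add _ _ (inner ℝ (dir p.2) v • dir p.2),
    map_add _ _ (inner ℝ (dir p.2) w • dir p.2), map_smul _ _ (dir p.2), add_apply, smul_apply, hn,
    H_symm hS E hp _ (dir p.2), smul_zero, add_zero]

/-- The determinant of `h` on the plane spanned by two vectors. -/
lemma H_det_cross {p : Spacetime} (hp : p ∈ S.region) (v w : E3) :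
    E.H (conf p) v v * E.H (conf p) w w - E.H (conf p) v w * E.H (conf p) v w =
      inner ℝ (dir p.2) (cross v w) ^ 2 := by
  obtain ⟨e₁, e₂, h⟩ := exists_frame (norm_dir (snd_ne_zero_of_mem_region hS hp))
  have h1 := H_frame hS E hp h
  have hB := isBilin_form (E.H (conf p))
  simp only [IsBilin] at hB
  rw [h.inner_cross, H_expand hS E hp h v v, H_expand hS E hp h v w, H_expand hS E hp h w w,
    hB, hB, hB, H_symm hS E hp e₂ e₁]
  linear_combination (inner ℝ e₁ v * inner ℝ e₂ w - inner ℝ e₂ v * inner ℝ e₁ w) ^ 2 * h1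

/-- Differentiating `det h = 1`. -/
lemma adjTrace_fderiv_H {p : Spacetime} (hp : p ∈ S.region) {e₁ e₂ : E3}
    (h : IsFrame (dir p.2) e₁ e₂) (v : Spacetime) :
    adjTrace (fun v w => E.H (conf p) v w)
      (fun a b => fderiv ℝ (fun p => E.H (conf p)) p v a b) e₁ e₂ = 0 := by
  have hH : HasFDerivAt (fun p => E.H (conf p)) (fderiv ℝ (fun p => E.H (conf p)) p) p :=
    (hasFDerivAt_comp_conf hS (E.smooth_H.mono (domPos_subset _ _)) hp
      ).differentiableAt.hasFDerivAt
  have hB : ∀ a b : E3, HasFDerivAt (fun p => E.H (conf p) a b) _ p := fun a b =>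
    (hH.clm_apply (hasFDerivAt_const a p)).clm_apply (hasFDerivAt_const b p)
  have h1 := ((hB e₁ e₁).mul (hB e₂ e₂)).sub ((hB e₁ e₂).mul (hB e₁ e₂))
  -- The tangent plane moves with the point while e₁, e₂ stay fixed, so their determinant is ⟨x, e₁
  -- × e₂⟩² rather than 1. At the point itself e₁ × e₂ = x, and the derivative vanishes because dx
  -- is tangent.
  have h2 : HasFDerivAt (fun p : Spacetime => inner ℝ (dir p.2) (cross e₁ e₂) ^ 2) _ p :=
    ((hasFDerivAt_direction (snd_ne_zero_of_mem_region hS hp)).inner ℝ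
      (hasFDerivAt_const (cross e₁ e₂) p)).pow 2
  have h3 := h1.unique (h2.congr_of_eventuallyEq (by
    filter_upwards [(isOpen_region hS).mem_nhds hp] with p' hp' using
      H_det_cross hS E hp' e₁ e₂))
  have h4 := congrArg (fun L => L v) h3
  have h5 : inner ℝ (dx p.2 v) (dir p.2) = (0 : ℝ) := by
    rw [real_inner_comm]
    exact tangent_smul _ (tangent_tanProj h.norm_x _)
  simp [h.cross_fst_snd, h5] at h4
  have hs : fderiv ℝ (fun p => E.H (conf p)) p v e₂ e₁ = fderiv ℝ (fun p => E.H (conf p)) p v e₁ e₂ := by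
    have h6 := (hB e₁ e₂).unique ((hB e₂ e₁).congr_of_eventuallyEq (by
      filter_upwards [(isOpen_region hS).mem_nhds hp] with p' hp' using H_symm hS E hp' e₁ e₂))
    have h7 := congrArg (fun L => L v) h6
    simp at h7
    exact h7.symm
  rw [adjTrace, hs]
  linear_combination h4

lemma dir_pt_snd {u : ℝ} {r : ℝ} (hr : S.r₀ < r) {x : E3} (hx : ‖x‖ = 1) :
    dir (pt u r x).2 = x := dir_smul_unit (hS.r₀_pos.trans hr) hx

/-- The bracket in the angular variation. -/
def angForm (E : MetricExpansion S) (F X : Conf → ℝ) (Y : Conf → E3) (q : Conf) (e e' : E3) : ℝ :=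
  2 * X q * E.H q e e' + fderiv ℝ E.H q (confField F X Y q) e e'
    + E.H q (confLie E.U F X Y q (0, 0, e)) e' + E.H q e (confLie E.U F X Y q (0, 0, e'))

omit hS in
lemma confLie_ang (U : Conf → E3) (F X : Conf → ℝ) (Y : Conf → E3) (q : Conf) (e : E3) :
    confLie U F X Y q (0, 0, e) = fderiv ℝ Y q (0, 0, e) - fderiv ℝ F q (0, 0, e) • U q := by
  simp [confLie]

omit hS in
lemma confLie_comb (U : Conf → E3) (F X : Conf → ℝ) (Y : Conf → E3) (q : Conf) (a b : ℝ)
    (v w : E3) : confLie U F X Y q (0, 0, a • v + b • w) =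
      a • confLie U F X Y q (0, 0, v) + b • confLie U F X Y q (0, 0, w) := by
  have e : ((0, 0, a • v + b • w) : Conf) = a • (0, 0, v) + b • (0, 0, w) := by simp
  rw [confLie_ang, confLie_ang, confLie_ang, e, map_add, map_add, map_smul, map_smul, map_smul,
    map_smul, smul_eq_mul, smul_eq_mul]
  module

omit hS in
lemma isBilin_angForm (F X : Conf → ℝ) (Y : Conf → E3) (q : Conf) :
    IsBilin (angForm E F X Y q) := by
  intro a b c d v w v' w'
  simp only [angForm, confLie_comb, map_add, map_smul, add_apply, smul_apply, smul_eq_mul]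
  ring

/-- The divergence of `Y - U^A F` at fixed `u`, `ρ` in a frame. -/
lemma adjTrace_angForm {ξ : Spacetime → Spacetime} {F X : Conf → ℝ} {Y : Conf → E3}
    (hξ : HasComponents S ξ F X Y) {u : ℝ} (hu : u ∈ S.I) {r : ℝ} (hr : S.r₀ < r) {x : E3}
    (hx : ‖x‖ = 1) {e₁ e₂ : E3} (h : IsFrame x e₁ e₂) :
    adjTrace (fun v w => E.H (ray u x r) v w) (angForm E F X Y (ray u x r)) e₁ e₂ =
      4 * X (ray u x r) + 2 * (inner ℝ e₁ (fderiv ℝ Y (ray u x r) (0, 0, e₁))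
        + inner ℝ e₂ (fderiv ℝ Y (ray u x r) (0, 0, e₂))
        - fderiv ℝ F (ray u x r) (0, 0, E.U (ray u x r))) := by
  have hp := pt_mem_region hS hu hr hx
  have hc : conf (pt u r x) = ray u x r := conf_pt u (hS.r₀_pos.trans hr) hx
  have hd : IsFrame (dir (pt u r x).2) e₁ e₂ := by rwa [dir_pt_snd hS hr hx]
  have h1 := adjTrace_fderiv_H hS E hp hd (ξ (pt u r x))
  rw [fderiv_field hS hξ E.smooth_H hp] at h1
  have h2 := H_frame hS E hp hd
  have hs := H_symm hS E hp e₂ e₁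
  have hB := isBilin_form (E.H (conf (pt u r x)))
  simp only [IsBilin] at hB
  have hex := H_expand hS E hp hd
  rw [hc] at h1 h2 hs hB hex
  have hL : ∀ e e' : E3, E.H (ray u x r) (confLie E.U F X Y (ray u x r) (0, 0, e)) e' =
      E.H (ray u x r) (inner ℝ e₁ (confLie E.U F X Y (ray u x r) (0, 0, e)) • e₁
        + inner ℝ e₂ (confLie E.U F X Y (ray u x r) (0, 0, e)) • e₂)
        (inner ℝ e₁ e' • e₁ + inner ℝ e₂ e' • e₂) := fun e e' => hex _ _
  have hR : ∀ e e' : E3, E.H (ray u x r) e (confLie E.U F X Y (ray u x r) (0, 0, e')) =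
      E.H (ray u x r) (inner ℝ e₁ e • e₁ + inner ℝ e₂ e • e₂)
       (inner ℝ e₁ (confLie E.U F X Y (ray u x r) (0, 0, e')) • e₁
        + inner ℝ e₂ (confLie E.U F X Y (ray u x r) (0, 0, e')) • e₂) := fun e e' => hex _ _
  have hU : E.U (ray u x r) = inner ℝ e₁ (E.U (ray u x r)) • e₁
      + inner ℝ e₂ (E.U (ray u x r)) • e₂ := by
    refine h.expand_of_tangent ?_
    rw [E.U_ray u hu r hr x hx]
    exact hS.U_tangent u hu r hr x hx
  have hFU : fderiv ℝ F (ray u x r) (0, 0, E.U (ray u x r)) =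
      inner ℝ e₁ (E.U (ray u x r)) * fderiv ℝ F (ray u x r) (0, 0, e₁)
      + inner ℝ e₂ (E.U (ray u x r)) * fderiv ℝ F (ray u x r) (0, 0, e₂) := by
    have e : ((0, 0, E.U (ray u x r)) : Conf) = inner ℝ e₁ (E.U (ray u x r)) • (0, 0, e₁)
        + inner ℝ e₂ (E.U (ray u x r)) • (0, 0, e₂) := by
      simp only [Prod.smul_mk, Prod.mk_add_mk, smul_zero, add_zero, ← hU]
    rw [e, map_add, map_smul, map_smul, smul_eq_mul, smul_eq_mul]
  rw [hFU]
  simp only [adjTrace] at h1 ⊢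
  simp only [angForm, hL, hR, hB, hs, h.inner_fst_fst, h.inner_snd_snd, h.inner_fst_snd,
    real_inner_comm e₁ e₂]
  simp only [confLie_ang, inner_sub_right, inner_smul_right]
  generalize inner ℝ e₁ (fderiv ℝ Y (ray u x r) (0, 0, e₁)) = y11
  generalize inner ℝ e₂ (fderiv ℝ Y (ray u x r) (0, 0, e₂)) = y22
  generalize inner ℝ e₁ (fderiv ℝ Y (ray u x r) (0, 0, e₂)) = y12
  generalize inner ℝ e₂ (fderiv ℝ Y (ray u x r) (0, 0, e₁)) = y21
  -- For an endomorphism L of the tangent plane the `adjTrace` of B(Lv, w) + B(v, Lw) is 2 det(B)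
  -- tr(L), and that of 2XB is 4X det(B). Here det(B) = 1, and the derivative of h drops out by
  -- `h1`.
  linear_combination h1 + (4 * X (ray u x r) + 2 * (y11 + y22
    - inner ℝ e₁ (E.U (ray u x r)) * fderiv ℝ F (ray u x r) (0, 0, e₁)
    - inner ℝ e₂ (E.U (ray u x r)) * fderiv ℝ F (ray u x r) (0, 0, e₂))) * h2

lemma metric_ang {u : ℝ} (hu : u ∈ S.I) {r : ℝ} (hr : S.r₀ < r) {x : E3} (hx : ‖x‖ = 1)
    {e e' : E3} (he : Tangent x e) (he' : Tangent x e') :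
    S.metric (pt u r x) (partialAng r e) (partialAng r e') =
      -r ^ 2 * E.H (ray u x r) e e' := by
  have hr' := hS.r₀_pos.trans hr
  rw [E.metric_eq _ (pt_mem_region hS hu hr hx), modelMetric,
    shiftedForm_partialAng hS E hr hx he, shiftedForm_partialAng hS E hr hx he',
    show ‖(pt u r x).2‖ = r from norm_smul_unit hr' hx, conf_pt u hr' hx]
  simp [du_partialAng]

/-- The trace of the angular variation, in an arbitrary basis of the tangent space. -/
lemma trace_variation {ξ : Spacetime → Spacetime} {F X : Conf → ℝ} {Y : Conf → E3}
    (hξ : HasComponents S ξ F X Y) {u : ℝ} (hu : u ∈ S.I) {r : ℝ} (hr : S.r₀ < r) {x : E3}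
    (hx : ‖x‖ = 1) (e : Fin 2 → E3) (he : ∀ a, Tangent x (e a)) :
    ∑ a, ∑ b, (Matrix.of fun a b =>
        S.metric (pt u r x) (partialAng r (e a)) (partialAng r (e b)))⁻¹ a b *
      variation S.metric ξ (pt u r x) (partialAng r (e a)) (partialAng r (e b)) =
    -((Matrix.of fun a b => S.metric (pt u r x) (partialAng r (e a)) (partialAng r (e b))).det)⁻¹ *
      r ^ 4 * adjTrace (fun v w => E.H (ray u x r) v w) (angForm E F X Y (ray u x r))
        (e 0) (e 1) := by
  have hs := H_symm hS E (pt_mem_region hS hu hr hx) (e 1) (e 0)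
  rw [conf_pt u (hS.r₀_pos.trans hr) hx] at hs
  simp only [Matrix.inv_def, Matrix.adjugate_fin_two, Ring.inverse_eq_inv', Fin.sum_univ_two,
    Matrix.smul_apply, Matrix.of_apply, Matrix.cons_val_zero, Matrix.cons_val_one,
    smul_eq_mul, Matrix.cons_val', Matrix.cons_val_fin_one,
    variation_AB hS E hξ hu hr hx (he _) (he _), metric_ang hS E hu hr hx (he _) (he _), hs,
    adjTrace, angForm]
  ring

end

/-! ### Solving the gauge conditions -/

/-- Replace `y` by its direction. -/
def unitize (q : Conf) : Conf := (q.1, q.2.1, dir q.2.2)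

section

variable {G : Type*} [NormedAddCommGroup G] [NormedSpace ℝ G] {I : Set ℝ} {r₀ : ℝ}

lemma unitize_mem_dom {q : Conf} (hq : q ∈ dom I r₀) : unitize q ∈ dom I r₀ :=
  ⟨hq.1, hq.2.1, dir_ne_zero hq.2.2⟩

lemma unitize_of_norm_eq_one {u ρ : ℝ} {x : E3} (hx : ‖x‖ = 1) :
    unitize (u, ρ, x) = (u, ρ, x) := by
  rw [unitize, dir_of_norm_eq_one hx]

lemma unitize_unitize (q : Conf) : unitize (unitize q) = unitize q := by
  simp [unitize, dir_dir]

lemma contDiffOn_unitize : ContDiffOn ℝ ∞ unitize (dom I r₀) :=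
  contDiffOn_fst.prodMk ((contDiff_fst.comp contDiff_snd).contDiffOn.prodMk
    (contDiffOn_dir.comp (contDiff_snd.comp contDiff_snd).contDiffOn fun _ hq => hq.2.2))

lemma contDiffOn_comp_unitize {W : Conf → G} (hW : ContDiffOn ℝ ∞ W (dom I r₀)) :
    ContDiffOn ℝ ∞ (fun q => W (unitize q)) (dom I r₀) :=
  hW.comp contDiffOn_unitize fun _ hq => unitize_mem_dom hq

/-- `W` is constant along the rays of `E3`. -/
def IsRadial (W : Conf → G) : Prop := ∀ q, W (unitize q) = W q

omit [NormedAddCommGroup G] [NormedSpace ℝ G] in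
lemma isRadial_comp_unitize (W : Conf → G) : IsRadial fun q => W (unitize q) := fun q => by
  simp only [unitize_unitize]

/-- The inclusion of the angular directions. -/
def angIncl : E3 →L[ℝ] Conf :=
  (ContinuousLinearMap.inr ℝ ℝ (ℝ × E3)).comp (ContinuousLinearMap.inr ℝ ℝ E3)

lemma hasFDerivAt_slice (hI : IsOpen I) {W : Conf → G} (hW : ContDiffOn ℝ ∞ W (dom I r₀))
    {u ρ : ℝ} {y : E3} (hq : (u, ρ, y) ∈ dom I r₀) :
    HasFDerivAt (fun y => W (u, ρ, y)) ((fderiv ℝ W (u, ρ, y)).comp angIncl) y := by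
  have h : HasFDerivAt (fun y : E3 => ((u, ρ, y) : Conf)) angIncl y :=
    (hasFDerivAt_prodMk_right u (ρ, y)).comp y (hasFDerivAt_prodMk_right ρ y)
  exact (hasFDerivAt_of_dom hI hW hq).comp y h

omit [NormedAddCommGroup G] [NormedSpace ℝ G] in
lemma radExt_slice {W : Conf → G} (h : IsRadial W) (u ρ : ℝ) :
    radExt (fun y => W (u, ρ, y)) = fun y => W (u, ρ, y) := funext fun y => h (u, ρ, y)

lemma sphD_slice (hI : IsOpen I) {W : Conf → G} (hW : ContDiffOn ℝ ∞ W (dom I r₀))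
    (h : IsRadial W) {u ρ : ℝ} {x : E3} (hq : (u, ρ, x) ∈ dom I r₀) (v : E3) :
    sphD (fun y => W (u, ρ, y)) x v = fderiv ℝ W (u, ρ, x) (0, 0, v) := by
  rw [sphD, radExt_slice h, (hasFDerivAt_slice hI hW hq).fderiv]
  rfl

lemma smoothOnSphere_slice {W : Conf → G} (hW : ContDiffOn ℝ ∞ W (dom I r₀))
    (h : IsRadial W) {u ρ : ℝ} (hu : u ∈ I) (hρ : ρ < 1 / r₀) :
    SmoothOnSphere fun y => W (u, ρ, y) := by
  rw [SmoothOnSphere, radExt_slice h]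
  exact hW.comp (contDiffOn_const.prodMk (contDiffOn_const.prodMk contDiffOn_id))
    fun y hy => ⟨hu, hρ, hy⟩

lemma SmoothOnSphere.comp_conf {φ : E3 → G} (hφ : SmoothOnSphere φ) :
    ContDiffOn ℝ ∞ (fun q : Conf => radExt φ q.2.2) (dom I r₀) :=
  ContDiffOn.comp (g := radExt φ) (t := {0}ᶜ) hφ
    (contDiff_snd.comp contDiff_snd).contDiffOn fun _ hq => hq.2.2

/-- `W` depends only on `u` and the direction of `y`. -/
def IsStatic (W : Conf → G) : Prop := ∀ q, W (q.1, 0, dir q.2.2) = W q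

omit [NormedAddCommGroup G] [NormedSpace ℝ G] in
lemma IsStatic.isRadial {W : Conf → G} (h : IsStatic W) : IsRadial W := fun q => by
  rw [← h q, ← h (unitize q)]
  simp [unitize, dir_dir]

omit [NormedAddCommGroup G] [NormedSpace ℝ G] in
lemma IsStatic.eq {W : Conf → G} (h : IsStatic W) (u ρ ρ' : ℝ) (y : E3) :
    W (u, ρ, y) = W (u, ρ', y) := (h (u, ρ, y)).symm.trans (h (u, ρ', y))

end

lemma IsStatic.fderiv_rho {G : Type} [NormedAddCommGroup G] [NormedSpace ℝ G] {I : Set ℝ} {r₀ : ℝ}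
    (hI : IsOpen I) {W : Conf → G} (hW : ContDiffOn ℝ ∞ W (dom I r₀)) (h : IsStatic W) {q : Conf}
    (hq : q ∈ dom I r₀) : fderiv ℝ W q (0, 1, 0) = 0 := by
  obtain ⟨u, ρ, y⟩ := q
  refine (line_hasDerivAt hI hW hq).unique ?_
  have : (fun ρ => W (u, ρ, y)) = fun _ => W (u, 0, y) := funext fun ρ => h.eq _ _ _ _
  rw [this]
  exact hasDerivAt_const _ _

/-- The divergence in the angular directions. -/
def angDiv (Z : Conf → E3) (q : Conf) : ℝ :=
  ∑ i : Fin 3, (fderiv ℝ Z q (0, 0, EuclideanSpace.single i 1)) i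

lemma sphDiv_slice {I : Set ℝ} {r₀ : ℝ} (hI : IsOpen I) {Z : Conf → E3}
    (hZ : ContDiffOn ℝ ∞ Z (dom I r₀)) (h : IsRadial Z) {u ρ : ℝ} {x : E3}
    (hq : (u, ρ, x) ∈ dom I r₀) : sphDiv (fun y => Z (u, ρ, y)) x = angDiv Z (u, ρ, x) := by
  simp only [sphDiv, angDiv, sphD_slice hI hZ h hq]

/-- The gradient in the angular directions. -/
def angGrad (F : Conf → ℝ) (q : Conf) : E3 :=
  (InnerProductSpace.toDual ℝ E3).symm ((fderiv ℝ F q).comp angIncl)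

lemma inner_angGrad (F : Conf → ℝ) (q : Conf) (v : E3) :
    inner ℝ (angGrad F q) v = fderiv ℝ F q (0, 0, v) := by
  rw [angGrad, InnerProductSpace.toDual_symm_apply]
  rfl

/-- The cross product as a bilinear map. -/
def crossLeft (v : E3) : E3 →L[ℝ] E3 :=
  LinearMap.toContinuousLinearMap
    { toFun := cross v
      map_add' := fun a b => by
        apply ext_three <;> simp <;> ring
      map_smul' := fun a b => by
        apply ext_three <;> simp <;> ring }

@[simp] lemma crossLeft_apply (v w : E3) : crossLeft v w = cross v w := rfl

lemma contDiff_cross : ContDiff ℝ ∞ fun p : E3 × E3 => cross p.1 p.2 := by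
  have h : ∀ (i : Fin 3), ContDiff ℝ ∞ fun v : E3 => v i := fun i =>
    (EuclideanSpace.proj i : E3 →L[ℝ] ℝ).contDiff
  have h1 := fun i => (h i).comp (contDiff_fst (𝕜 := ℝ) (E := E3) (F := E3) (n := ∞))
  have h2 := fun i => (h i).comp (contDiff_snd (𝕜 := ℝ) (E := E3) (F := E3) (n := ∞))
  refine contDiff_euclidean.2 fun i => ?_
  fin_cases i
  · exact ((h1 1).mul (h2 2)).sub ((h1 2).mul (h2 1))
  · exact ((h1 2).mul (h2 0)).sub ((h1 0).mul (h2 2))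
  · exact ((h1 0).mul (h2 1)).sub ((h1 1).mul (h2 0))

section

variable {S : MetricData} (hS : S.IsBondiSachs) (E : MetricExpansion S)

/-- The vector field `e^{2β} h^{AB} ∂_B F`, at a point with unit angular part; the inverse of `h` is
`h` conjugated by the rotation by a right angle, as `det h = 1`. -/
def raiseUnit (F : Conf → ℝ) (q : Conf) : E3 :=
  E.b q • (InnerProductSpace.toDual ℝ E3).symm
    ((E.H q (cross q.2.2 (angGrad F q))).comp (crossLeft q.2.2))

/-- The vector field `e^{2β} h^{AB} ∂_B F`. -/
def raise (F : Conf → ℝ) (q : Conf) : E3 := raiseUnit E F (unitize q)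

lemma isRadial_raise (F : Conf → ℝ) : IsRadial (raise E F) := isRadial_comp_unitize _

lemma inner_raiseUnit (F : Conf → ℝ) (q : Conf) (v : E3) :
    inner ℝ (raiseUnit E F q) v =
      E.b q * E.H q (cross q.2.2 (angGrad F q)) (cross q.2.2 v) := by
  rw [raiseUnit, inner_smul_left, InnerProductSpace.toDual_symm_apply]
  rfl

lemma contDiffOn_angGrad {I : Set ℝ} (hI : IsOpen I) {r₀ : ℝ} {F : Conf → ℝ}
    (hF : ContDiffOn ℝ ∞ F (dom I r₀)) : ContDiffOn ℝ ∞ (angGrad F) (dom I r₀) :=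
  (InnerProductSpace.toDual ℝ E3).symm.contDiff.comp_contDiffOn
    ((hF.fderiv_of_isOpen (isOpen_dom hI r₀) (by simp)).clm_comp contDiffOn_const)

lemma contDiffOn_angDiv {I : Set ℝ} (hI : IsOpen I) {r₀ : ℝ} {Z : Conf → E3}
    (hZ : ContDiffOn ℝ ∞ Z (dom I r₀)) : ContDiffOn ℝ ∞ (angDiv Z) (dom I r₀) :=
  ContDiffOn.sum fun i _ => (EuclideanSpace.proj i : E3 →L[ℝ] ℝ).contDiff.comp_contDiffOn
    (contDiffOn_fderiv_apply hI hZ _)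

lemma contDiff_crossLeft : ContDiff ℝ ∞ crossLeft := by
  refine contDiff_clm_apply_iff.2 fun w => ?_
  exact contDiff_cross.comp (contDiff_id.prodMk contDiff_const)

include hS in
lemma contDiffOn_raise {F : Conf → ℝ} (hF : ContDiffOn ℝ ∞ F (dom S.I S.r₀)) :
    ContDiffOn ℝ ∞ (raise E F) (dom S.I S.r₀) := by
  refine contDiffOn_comp_unitize (E.smooth_b.smul ?_)
  have hy : ContDiffOn ℝ ∞ (fun q : Conf => q.2.2) (dom S.I S.r₀) :=
    (contDiff_snd.comp contDiff_snd).contDiffOn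
  refine (InnerProductSpace.toDual ℝ E3).symm.contDiff.comp_contDiffOn ?_
  refine ContDiffOn.clm_comp ?_ (contDiff_crossLeft.comp_contDiffOn hy)
  exact E.smooth_H.clm_apply
    (contDiff_cross.comp_contDiffOn (hy.prodMk (contDiffOn_angGrad hS.isOpen_I hF)))

lemma raise_of_norm_eq_one (F : Conf → ℝ) {u ρ : ℝ} {x : E3} (hx : ‖x‖ = 1) :
    raise E F (u, ρ, x) = raiseUnit E F (u, ρ, x) := by
  rw [raise, unitize_of_norm_eq_one hx]

lemma tangent_raise (F : Conf → ℝ) (q : Conf) :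
    Tangent (dir q.2.2) (raise E F q) := by
  rw [Tangent, real_inner_comm, raise, inner_raiseUnit]
  have : cross (unitize q).2.2 (dir q.2.2) = 0 := by
    apply ext_three <;> simp [unitize] <;> ring
  rw [this, map_zero, mul_zero]

include hS in
/-- `raise E F` solves `h_{AB} W^B = e^{2β} ∂_A F`. -/
lemma H_raise (F : Conf → ℝ) {u : ℝ} (hu : u ∈ S.I) {r : ℝ} (hr : S.r₀ < r) {x : E3}
    (hx : ‖x‖ = 1) {e : E3} (he : Tangent x e) :
    E.H (ray u x r) (raise E F (ray u x r)) e =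
      E.b (ray u x r) * fderiv ℝ F (ray u x r) (0, 0, e) := by
  obtain ⟨e₁, e₂, h⟩ := exists_frame hx
  have hp := pt_mem_region hS hu hr hx
  have hd : IsFrame (dir (pt u r x).2) e₁ e₂ := by rwa [dir_pt_snd hS hr hx]
  have h2 := H_frame hS E hp hd
  have hs := H_symm hS E hp e₂ e₁
  have hB := isBilin_form (E.H (conf (pt u r x)))
  simp only [IsBilin] at hB
  rw [conf_pt u (hS.r₀_pos.trans hr) hx] at h2 hs hB
  have hW : ∀ v, inner ℝ v (raise E F (ray u x r)) = E.b (ray u x r) *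
      E.H (ray u x r) (cross x (angGrad F (ray u x r))) (cross x v) := fun v => by
    rw [real_inner_comm, ray, raise_of_norm_eq_one E F hx, inner_raiseUnit]
  have hcr : cross x (angGrad F (ray u x r)) =
      (-inner ℝ e₂ (angGrad F (ray u x r))) • e₁ + inner ℝ e₁ (angGrad F (ray u x r)) • e₂ := by
    have hxx : crossLeft x x = 0 := by apply ext_three <;> simp <;> ring
    have := congrArg (crossLeft x) (h.expand (angGrad F (ray u x r)))
    rw [map_add, map_add, map_smul, map_smul, map_smul, hxx, crossLeft_apply, crossLeft_apply,
      crossLeft_apply, h.cross_fst, h.cross_snd] at this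
    rw [this]
    module
  have hWt : Tangent x (raise E F (ray u x r)) := by
    have := tangent_raise E F (ray u x r)
    rwa [show (ray u x r).2.2 = x from rfl, dir_of_norm_eq_one hx] at this
  have hB1 : ∀ w, E.H (ray u x r) (cross x (angGrad F (ray u x r))) w =
      -inner ℝ e₂ (angGrad F (ray u x r)) * E.H (ray u x r) e₁ w +
      inner ℝ e₁ (angGrad F (ray u x r)) * E.H (ray u x r) e₂ w := fun w => by
    rw [hcr]
    simp only [map_add, map_smul, add_apply, smul_apply, smul_eq_mul]
  have hFe : fderiv ℝ F (ray u x r) (0, 0, e) =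
      inner ℝ e₁ e * inner ℝ e₁ (angGrad F (ray u x r))
      + inner ℝ e₂ e * inner ℝ e₂ (angGrad F (ray u x r)) := by
    rw [← inner_angGrad]
    conv_lhs => rw [h.expand_of_tangent he]
    rw [inner_add_right, inner_smul_right, inner_smul_right,
      real_inner_comm e₁, real_inner_comm e₂]
  -- In the frame `raise` is b times the adjugate of the matrix of h applied to the gradient, so
  -- multiplication by h leaves the determinant, which is 1.
  conv_lhs => rw [h.expand_of_tangent hWt, h.expand_of_tangent he, hB]
  rw [hW, hW, h.cross_fst, h.cross_snd, hB1, hB1, map_neg, map_neg, hs, hFe]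
  linear_combination E.b (ray u x r) * (inner ℝ e₁ e * inner ℝ e₁ (angGrad F (ray u x r))
      + inner ℝ e₂ e * inner ℝ e₂ (angGrad F (ray u x r))) * h2

include hS in
lemma H_zero {u : ℝ} (hu : u ∈ S.I) {x : E3} (hx : ‖x‖ = 1) (v w : E3) :
    E.H (u, 0, x) v w = inner ℝ v w - inner ℝ x v * inner ℝ x w := by
  rw [E.H_eq _ (zero_mem_dom hS.r₀_pos hu (ne_zero_of_norm_eq_one hx)), add_apply, add_apply,
    smul_apply, smul_apply, zero_smul, add_zero, roundForm_apply, dir_of_norm_eq_one hx]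

include hS in
lemma b_zero {u : ℝ} (hu : u ∈ S.I) {x : E3} (hx : ‖x‖ = 1) : E.b (u, 0, x) = 1 := by
  simp [E.b_eq _ (zero_mem_dom hS.r₀_pos hu (ne_zero_of_norm_eq_one hx))]

include hS in
/-- At `ρ = 0` the vector field `raise E F` is the gradient of `F` on the unit sphere. -/
lemma raise_zero {F : Conf → ℝ} (hF : ContDiffOn ℝ ∞ F (dom S.I S.r₀)) (hF' : IsRadial F)
    {u : ℝ} (hu : u ∈ S.I) {x : E3} (hx : ‖x‖ = 1) :
    raise E F (u, 0, x) = sphGrad (fun y => F (u, 0, y)) x := by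
  have hq := zero_mem_dom hS.r₀_pos hu (ne_zero_of_norm_eq_one hx)
  refine ext_inner_right ℝ fun v => ?_
  rw [inner_sphGrad, raise_of_norm_eq_one E F hx, inner_raiseUnit, b_zero hS E hu hx,
    H_zero hS E hu hx, sphD_slice hS.isOpen_I hF hF' hq, ← inner_angGrad]
  have hxg : inner ℝ x (angGrad F (u, 0, x)) = 0 := by
    rw [real_inner_comm, inner_angGrad, ← sphD_slice hS.isOpen_I hF hF' hq, sphD_self _ hx]
  obtain ⟨h1⟩ : Nonempty (x 0 ^ 2 + x 1 ^ 2 + x 2 ^ 2 = 1) :=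
    ⟨by rw [← norm_sq_eq, hx, one_pow]⟩
  rw [inner_eq] at hxg
  simp only [inner_eq, cross_zero', cross_one', cross_two']
  generalize angGrad F (u, 0, x) = g at *
  linear_combination (g 0 * v 0 + g 1 * v 1 + g 2 * v 2) * h1
    - (x 0 * v 0 + x 1 * v 1 + x 2 * v 2) * hxg

end

/-! ### The expansion of the solutions of the gauge conditions -/

lemma isBigO_ray_sub {G : Type} [NormedAddCommGroup G] [NormedSpace ℝ G] {I : Set ℝ}
    (hI : IsOpen I) {r₀ : ℝ} (hr : 0 < r₀) {W : Conf → G} (hW : ContDiffOn ℝ ∞ W (dom I r₀))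
    {u : ℝ} (hu : u ∈ I) {x : E3} (hx : ‖x‖ = 1) :
    (fun r => W (ray u x r) - W (u, 0, x)) =O[atTop] fun r : ℝ => r⁻¹ := by
  have h := (line_hasDerivAt hI hW (zero_mem_dom hr hu (ne_zero_of_norm_eq_one hx))).isBigO_sub
  have := h.comp_tendsto tendsto_inv_atTop_zero
  refine this.congr_right fun r => ?_
  simp

lemma isBigO_ray_one {G : Type} [NormedAddCommGroup G] [NormedSpace ℝ G] {I : Set ℝ}
    (hI : IsOpen I) {r₀ : ℝ} (hr : 0 < r₀) {W : Conf → G} (hW : ContDiffOn ℝ ∞ W (dom I r₀))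
    {u : ℝ} (hu : u ∈ I) {x : E3} (hx : ‖x‖ = 1) :
    (fun r => W (ray u x r)) =O[atTop] fun _ : ℝ => (1 : ℝ) :=
  (tendsto_along_ray hI hr hW hu hx).isBigO_one ℝ

lemma isRadial_avg {G : Type} [NormedAddCommGroup G] [NormedSpace ℝ G] {W : Conf → G}
    (h : IsRadial W) : IsRadial (avg W) := fun q => by
  rw [avg, avg]
  congr 1
  funext s
  exact h (q.1, s * q.2.1, q.2.2)

lemma IsFrame.angDiv_eq {I : Set ℝ} {r₀ : ℝ} (hI : IsOpen I) {Z : Conf → E3}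
    (hZ : ContDiffOn ℝ ∞ Z (dom I r₀)) (hZ' : IsRadial Z) {u ρ : ℝ} {x e₁ e₂ : E3}
    (h : IsFrame x e₁ e₂) (hq : (u, ρ, x) ∈ dom I r₀) :
    angDiv Z (u, ρ, x) = inner ℝ e₁ (fderiv ℝ Z (u, ρ, x) (0, 0, e₁))
      + inner ℝ e₂ (fderiv ℝ Z (u, ρ, x) (0, 0, e₂)) := by
  rw [← sphDiv_slice hI hZ hZ' hq, h.sphDiv_eq, sphD_slice hI hZ hZ' hq, sphD_slice hI hZ hZ' hq,
    real_inner_comm, real_inner_comm (fderiv ℝ Z (u, ρ, x) (0, 0, e₂))]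

section

variable {S : MetricData} (E : MetricExpansion S)

/-- The angular part of the vector field with `ξ^u = F` which preserves the gauge, with value `Y₀`
at `ρ = 0`. -/
def gaugeAng (F : Conf → ℝ) (Y₀ : Conf → E3) (q : Conf) : E3 :=
  Y₀ q - q.2.1 • avg (raise E F) q

/-- The radial part (divided by `r`) of the vector field with `ξ^u = F`, `ξ^A = Y` which preserves
the gauge. -/
def gaugeRad (F : Conf → ℝ) (Y : Conf → E3) (q : Conf) : ℝ :=
  -(1 / 2) * (angDiv Y (unitize q) - fderiv ℝ F (unitize q) (0, 0, E.U (unitize q)))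

/-- The first correction to `gaugeRad` in powers of `ρ`. -/
def gaugeRadOne (F : Conf → ℝ) (q : Conf) : ℝ :=
  1 / 2 * (angDiv (avg (raise E F)) (unitize q)
    + q.2.1 * fderiv ℝ F (unitize q) (0, 0, E.U₂ (unitize q)))

variable {F : Conf → ℝ} {Y₀ : Conf → E3} (hS : S.IsBondiSachs)
  (hF : ContDiffOn ℝ ∞ F (dom S.I S.r₀)) (hF' : IsStatic F)
  (hY : ContDiffOn ℝ ∞ Y₀ (dom S.I S.r₀)) (hY' : IsStatic Y₀)

include hS hF in
lemma contDiffOn_avg_raise : ContDiffOn ℝ ∞ (avg (raise E F)) (dom S.I S.r₀) :=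
  contDiffOn_avg hS.isOpen_I hS.r₀_pos (contDiffOn_raise hS E hF)

include hS hF hY in
lemma contDiffOn_gaugeAng : ContDiffOn ℝ ∞ (gaugeAng E F Y₀) (dom S.I S.r₀) :=
  hY.sub ((contDiff_fst.comp contDiff_snd).contDiffOn.smul (contDiffOn_avg_raise E hS hF))

include hY' in
lemma isRadial_gaugeAng : IsRadial (gaugeAng E F Y₀) := fun q => by
  rw [gaugeAng, gaugeAng, hY'.isRadial q, isRadial_avg (isRadial_raise E F) q]
  rfl

include hS in
lemma contDiffOn_gaugeRad (hF : ContDiffOn ℝ ∞ F (dom S.I S.r₀)) {Y : Conf → E3}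
    (hY : ContDiffOn ℝ ∞ Y (dom S.I S.r₀)) :
    ContDiffOn ℝ ∞ (gaugeRad E F Y) (dom S.I S.r₀) := by
  have h1 := contDiffOn_angDiv hS.isOpen_I hY
  have h2 : ContDiffOn ℝ ∞ (fun q => fderiv ℝ F q (0, 0, E.U q)) (dom S.I S.r₀) :=
    (hF.fderiv_of_isOpen (isOpen_dom hS.isOpen_I _) (by simp)).clm_apply
      (contDiffOn_const.prodMk (contDiffOn_const.prodMk E.smooth_U))
  exact contDiffOn_const.mul (contDiffOn_comp_unitize (h1.sub h2))

include hS hF in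
lemma contDiffOn_gaugeRadOne : ContDiffOn ℝ ∞ (gaugeRadOne E F) (dom S.I S.r₀) := by
  have h1 := contDiffOn_angDiv hS.isOpen_I (contDiffOn_avg_raise E hS hF)
  have h2 : ContDiffOn ℝ ∞ (fun q => fderiv ℝ F q (0, 0, E.U₂ q)) (dom S.I S.r₀) :=
    (hF.fderiv_of_isOpen (isOpen_dom hS.isOpen_I _) (by simp)).clm_apply
      (contDiffOn_const.prodMk (contDiffOn_const.prodMk E.smooth_U₂))
  have h3 : ContDiffOn ℝ ∞ (fun q : Conf => q.2.1 * fderiv ℝ F q (0, 0, E.U₂ q))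
      (dom S.I S.r₀) := (contDiff_fst.comp contDiff_snd).contDiffOn.mul h2
  exact contDiffOn_const.mul (contDiffOn_comp_unitize (h1.add h3))

include hS hF in
-- Y₀ does not depend on ρ, and ρ times the average is a primitive of `raise E F`; so `gaugeAng`
-- solves the equation that δg_rA = 0 imposes.
lemma fderiv_gaugeAng_rho (hY : ContDiffOn ℝ ∞ Y₀ (dom S.I S.r₀)) (hY' : IsStatic Y₀) {q : Conf}
    (hq : q ∈ dom S.I S.r₀) : fderiv ℝ (gaugeAng E F Y₀) q (0, 1, 0) = -raise E F q := by
  obtain ⟨u, ρ, y⟩ := q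
  refine (line_hasDerivAt hS.isOpen_I (contDiffOn_gaugeAng E hS hF hY) hq).unique ?_
  have h1 := (line_hasDerivAt hS.isOpen_I hY hq).sub
    (hasDerivAt_smul_avg hS.isOpen_I hS.r₀_pos (contDiffOn_raise hS E hF) hq)
  rw [hY'.fderiv_rho hS.isOpen_I hY hq, zero_sub] at h1
  exact h1

lemma gaugeAng_zero (u : ℝ) (y : E3) : gaugeAng E F Y₀ (u, 0, y) = Y₀ (u, 0, y) := by
  simp [gaugeAng]

include hS hF hY in
lemma fderiv_gaugeAng {q : Conf} (hq : q ∈ dom S.I S.r₀) (v : Conf) :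
    fderiv ℝ (gaugeAng E F Y₀) q v = fderiv ℝ Y₀ q v
      - q.2.1 • fderiv ℝ (avg (raise E F)) q v - v.2.1 • avg (raise E F) q := by
  have h1 : HasFDerivAt (fun q : Conf => q.2.1)
      ((ContinuousLinearMap.fst ℝ ℝ E3).comp (ContinuousLinearMap.snd ℝ ℝ (ℝ × E3))) q :=
    hasFDerivAt_fst.comp q hasFDerivAt_snd
  have h2 := (hasFDerivAt_of_dom hS.isOpen_I hY hq).sub
    (h1.smul (hasFDerivAt_of_dom hS.isOpen_I (contDiffOn_avg_raise E hS hF) hq))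
  refine (congrArg (fun L => L v) h2.fderiv).trans ?_
  simp
  abel

include hS hF hY in
-- As U = ρ² U₂, the term U^A ∂_A F enters only through the correction, with a further factor ρ.
lemma gaugeRad_eq {q : Conf} (hq : q ∈ dom S.I S.r₀) :
    gaugeRad E F (gaugeAng E F Y₀) q = -(1 / 2) * angDiv Y₀ (unitize q)
      + q.2.1 * gaugeRadOne E F q := by
  have hq' := unitize_mem_dom hq
  have h1 : angDiv (gaugeAng E F Y₀) (unitize q) = angDiv Y₀ (unitize q)
      - q.2.1 * angDiv (avg (raise E F)) (unitize q) := by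
    simp only [angDiv, fderiv_gaugeAng E hS hF hY hq', zero_smul, sub_zero, PiLp.sub_apply,
      PiLp.smul_apply, smul_eq_mul, Finset.sum_sub_distrib, Finset.mul_sum]
    rfl
  have h2 : fderiv ℝ F (unitize q) (0, 0, E.U (unitize q)) =
      q.2.1 ^ 2 * fderiv ℝ F (unitize q) (0, 0, E.U₂ (unitize q)) := by
    rw [E.U_eq _ hq', ← smul_eq_mul, ← map_smul]
    simp [unitize]
  rw [gaugeRad, gaugeRadOne, h1, h2]
  ring

include hS hY hY' in
lemma angDiv_static {q : Conf} (hq : q ∈ dom S.I S.r₀) :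
    angDiv Y₀ (unitize q) = sphDiv (fun y => Y₀ (q.1, 0, y)) (dir q.2.2) := by
  have h : (fun y => Y₀ (q.1, 0, y)) = fun y => Y₀ (q.1, q.2.1, y) :=
    funext fun y => hY'.eq _ _ _ _
  rw [h, sphDiv_slice hS.isOpen_I hY hY'.isRadial (unitize_mem_dom hq)]
  rfl

include hS hF hF' in
-- At ρ = 0 the average of `raise E F` is the gradient of F on the unit sphere, and its divergence
-- is the Laplacian; this is the source of the term (1/2) D_C D^C F in ξ^r.
lemma gaugeRadOne_zero {u : ℝ} (hu : u ∈ S.I) {x : E3} (hx : ‖x‖ = 1) :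
    gaugeRadOne E F (u, 0, x) = sphDiv (sphGrad fun y => F (u, 0, y)) x / 2 := by
  have hq := zero_mem_dom hS.r₀_pos hu (ne_zero_of_norm_eq_one hx)
  have h1 := sphDiv_slice hS.isOpen_I (contDiffOn_avg_raise E hS hF)
    (isRadial_avg (isRadial_raise E F)) hq
  rw [gaugeRadOne, unitize_of_norm_eq_one hx, ← h1, zero_mul, add_zero,
    sphDiv_congr (fun y hy => (avg_zero (raise E F) u y).trans
      (raise_zero hS E hF hF'.isRadial hu hy)) hx]
  ring

end

/-- The vector field `ξ` has the components `ξ^u = F`, and `ξ^r`, `ξ^A` which the gauge conditions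
determine from `F` and the value `Y₀` of `ξ^A` at `ρ = 0`. -/
structure IsGaugeField (S : MetricData) (E : MetricExpansion S) (ξ : Spacetime → Spacetime)
    (F : Conf → ℝ) (Y₀ : Conf → E3) : Prop where
  smooth_F : ContDiffOn ℝ ∞ F (dom S.I S.r₀)
  static_F : IsStatic F
  smooth_Y : ContDiffOn ℝ ∞ Y₀ (dom S.I S.r₀)
  static_Y : IsStatic Y₀
  components : HasComponents S ξ F (gaugeRad E F (gaugeAng E F Y₀)) (gaugeAng E F Y₀)

lemma contDiffOn_fderiv_vec {G : Type} [NormedAddCommGroup G] [NormedSpace ℝ G] {I : Set ℝ}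
    (hI : IsOpen I) {r₀ : ℝ} {W : Conf → G} (hW : ContDiffOn ℝ ∞ W (dom I r₀)) {v : Conf → Conf}
    (hv : ContDiffOn ℝ ∞ v (dom I r₀)) :
    ContDiffOn ℝ ∞ (fun q => fderiv ℝ W q (v q)) (dom I r₀) :=
  (hW.fderiv_of_isOpen (isOpen_dom hI _) (by simp)).clm_apply hv

/-- The derivative of `B + ρⁿ C`. -/
lemma fderiv_of_eq_add_pow {G : Type} [NormedAddCommGroup G] [NormedSpace ℝ G] {I : Set ℝ}
    (hI : IsOpen I) {r₀ : ℝ} {W B C : Conf → G} (hB : ContDiffOn ℝ ∞ B (dom I r₀))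
    (hC : ContDiffOn ℝ ∞ C (dom I r₀)) (n : ℕ)
    (h : ∀ q ∈ dom I r₀, W q = B q + q.2.1 ^ n • C q) {q : Conf} (hq : q ∈ dom I r₀) (v : Conf) :
    fderiv ℝ W q v = fderiv ℝ B q v + q.2.1 ^ n • fderiv ℝ C q v
      + (n * q.2.1 ^ (n - 1) * v.2.1) • C q := by
  have h1 : HasFDerivAt (fun q : Conf => q.2.1)
      ((ContinuousLinearMap.fst ℝ ℝ E3).comp (ContinuousLinearMap.snd ℝ ℝ (ℝ × E3))) q :=
    hasFDerivAt_fst.comp q hasFDerivAt_snd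
  have h2 := (hasFDerivAt_of_dom hI hB hq).add
    ((h1.pow n).smul (hasFDerivAt_of_dom hI hC hq))
  have h3 := h2.congr_of_eventuallyEq (by
    filter_upwards [(isOpen_dom hI r₀).mem_nhds hq] with q' hq' using h q' hq')
  refine (congrArg (fun L => L v) h3.fderiv).trans ?_
  simp [add_assoc]

/-! ### Gauge conditions and asymptotic expansion of the fields determined by F and Y₀ -/

namespace IsGaugeField

variable {S : MetricData} (hS : S.IsBondiSachs) {E : MetricExpansion S}
  {ξ : Spacetime → Spacetime} {F : Conf → ℝ} {Y₀ : Conf → E3} (h : IsGaugeField S E ξ F Y₀)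
include hS h

lemma smooth_ang : ContDiffOn ℝ ∞ (gaugeAng E F Y₀) (dom S.I S.r₀) :=
  contDiffOn_gaugeAng E hS h.smooth_F h.smooth_Y

lemma smooth_rad : ContDiffOn ℝ ∞ (gaugeRad E F (gaugeAng E F Y₀)) (dom S.I S.r₀) :=
  contDiffOn_gaugeRad E hS h.smooth_F (h.smooth_ang hS)

lemma F_rho : ∀ q ∈ domPos S.I S.r₀, fderiv ℝ F q (0, 1, 0) = 0 := fun _ hq =>
  h.static_F.fderiv_rho hS.isOpen_I h.smooth_F hq.1

section Gauge

variable {u : ℝ} (hu : u ∈ S.I) {r : ℝ} (hr : S.r₀ < r) {x : E3} (hx : ‖x‖ = 1)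
include hu hr hx

lemma gauge_rr : variation S.metric ξ (pt u r x) (partialR x) (partialR x) = 0 := by
  rw [variation_rr hS E h.components hu hr hx,
    h.F_rho hS _ (ray_mem_domPos hS.r₀_pos hu hx hr), mul_zero]

lemma gauge_rA {e : E3} (he : Tangent x e) :
    variation S.metric ξ (pt u r x) (partialR x) (partialAng r e) = 0 := by
  rw [variation_rA hS E h.components hu hr hx (h.F_rho hS) he,
    fderiv_gaugeAng_rho E hS h.smooth_F h.smooth_Y h.static_Y
      (ray_mem_dom hS.r₀_pos hu hx hr), map_neg, neg_apply, H_raise hS E F hu hr hx he]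
  ring

/-- Any basis of the tangent plane is compared with an orthonormal frame by `adjTrace_comb`; in the
frame the trace is 4X plus twice the divergence expression, and the choice of `gaugeRad` makes it
vanish. -/
lemma gauge_trace (e : Fin 2 → E3) (he : ∀ a, Tangent x (e a)) :
    ∑ a, ∑ b, (Matrix.of fun a b =>
        S.metric (pt u r x) (partialAng r (e a)) (partialAng r (e b)))⁻¹ a b *
      variation S.metric ξ (pt u r x) (partialAng r (e a)) (partialAng r (e b)) = 0 := by
  obtain ⟨e₁, e₂, hf⟩ := exists_frame hx
  have hs : ∀ v w, E.H (ray u x r) v w = E.H (ray u x r) w v := fun v w => by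
    have := H_symm hS E (pt_mem_region hS hu hr hx) v w
    rwa [conf_pt u (hS.r₀_pos.trans hr) hx] at this
  rw [trace_variation hS E h.components hu hr hx e he, hf.expand_of_tangent (he 0),
    hf.expand_of_tangent (he 1), adjTrace_comb (isBilin_form _) (isBilin_angForm _ _ _ _ _) hs,
    adjTrace_angForm hS E h.components hu hr hx hf]
  have hX : gaugeRad E F (gaugeAng E F Y₀) (ray u x r) = -(1 / 2) *
      (inner ℝ e₁ (fderiv ℝ (gaugeAng E F Y₀) (ray u x r) (0, 0, e₁))
        + inner ℝ e₂ (fderiv ℝ (gaugeAng E F Y₀) (ray u x r) (0, 0, e₂))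
        - fderiv ℝ F (ray u x r) (0, 0, E.U (ray u x r))) := by
    rw [gaugeRad, ray, unitize_of_norm_eq_one hx, hf.angDiv_eq hS.isOpen_I (h.smooth_ang hS)
      (isRadial_gaugeAng E h.static_Y) (ray_mem_dom hS.r₀_pos hu hx hr)]
  rw [hX]
  ring

end Gauge

lemma rad_eq {q : Conf} (hq : q ∈ dom S.I S.r₀) :
    gaugeRad E F (gaugeAng E F Y₀) q =
      -(1 / 2) * sphDiv (fun y => Y₀ (q.1, 0, y)) (dir q.2.2) + q.2.1 * gaugeRadOne E F q := by
  rw [gaugeRad_eq E hS h.smooth_F h.smooth_Y hq, angDiv_static hS h.smooth_Y h.static_Y hq]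

section Zero

variable {u : ℝ} (hu : u ∈ S.I) {x : E3} (hx : ‖x‖ = 1)
include hu hx

lemma rad_zero : gaugeRad E F (gaugeAng E F Y₀) (u, 0, x) =
    -(1 / 2) * sphDiv (fun y => Y₀ (u, 0, y)) x := by
  rw [h.rad_eq hS (zero_mem_dom hS.r₀_pos hu (ne_zero_of_norm_eq_one hx)),
    dir_of_norm_eq_one hx, zero_mul, add_zero]

/-- Both expansions are first-order Taylor estimates at ρ = 0: of the average of `raise E F`, with
the additional factor 1/r in ξ^A, and of `gaugeRadOne`. -/
lemma hasAsymptoticForm_at : (fun r : ℝ => compAng ξ u r x -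
      (Y₀ (u, 0, x) - r⁻¹ • sphGrad (fun y => F (u, 0, y)) x))
      =O[atTop] (fun r : ℝ => (r ^ 2)⁻¹) ∧
    (fun r : ℝ => compR ξ u r x - (-(r / 2) * sphDiv (fun y => Y₀ (u, 0, y)) x +
      sphDiv (sphGrad (fun y => F (u, 0, y))) x / 2)) =O[atTop] fun r : ℝ => r⁻¹ := by
  have hev : ∀ᶠ r : ℝ in atTop, S.r₀ < r := eventually_gt_atTop _
  constructor
  · have h1 := isBigO_ray_sub hS.isOpen_I hS.r₀_pos (contDiffOn_avg_raise E hS h.smooth_F) hu hx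
    rw [avg_zero, raise_zero hS E h.smooth_F h.static_F.isRadial hu hx] at h1
    have h2 : (fun r : ℝ => (-r⁻¹) • (avg (raise E F) (ray u x r)
        - sphGrad (fun y => F (u, 0, y)) x)) =O[atTop] fun r : ℝ => r⁻¹ • r⁻¹ :=
      (isBigO_refl _ _).neg_left.smul h1
    refine h2.congr' ?_ ?_
    · filter_upwards [hev] with r hr
      have hr' := hS.r₀_pos.trans hr
      have := h.components.comp_ang _ (pt_mem_region hS hu hr hx)
      rw [conf_pt u hr' hx] at this
      rw [compAng, show r • x = (pt u r x).2 from rfl, this, gaugeAng, ray,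
        h.static_Y.eq u r⁻¹ 0 x]
      module
    · filter_upwards with r
      rw [smul_eq_mul, ← mul_inv, pow_two]
  · have h1 := isBigO_ray_sub hS.isOpen_I hS.r₀_pos (contDiffOn_gaugeRadOne E hS h.smooth_F) hu hx
    rw [gaugeRadOne_zero E hS h.smooth_F h.static_F hu hx] at h1
    refine h1.congr' ?_ EventuallyEq.rfl
    filter_upwards [hev] with r hr
    have hr' := hS.r₀_pos.trans hr
    have := h.components.comp_r _ (pt_mem_region hS hu hr hx)
    rw [conf_pt u hr' hx, h.rad_eq hS (ray_mem_dom hS.r₀_pos hu hx hr),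
      show ‖(pt u r x).2‖ = r from norm_smul_unit hr' hx] at this
    rw [compR, show r • x = (pt u r x).2 from rfl, this]
    simp only [ray, dir_of_norm_eq_one hx]
    field_simp
    ring

omit h in
lemma U_zero : E.U (u, 0, x) = 0 := by
  simp [E.U_eq _ (zero_mem_dom hS.r₀_pos hu (ne_zero_of_norm_eq_one hx))]

omit h in
-- On ρ = 0 the form is the round metric ⟨e, e'⟩ - ⟨x, e⟩⟨x, e'⟩ for every u. At a point where e and
-- e' are tangent, both factors of the second term vanish, so its derivative along ρ = 0 is zero.
lemma fderiv_H_zero (w : Conf) (hw : w.2.1 = 0) {e e' : E3} (he : Tangent x e)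
    (he' : Tangent x e') : fderiv ℝ E.H (u, 0, x) w e e' = 0 := by
  have hq := zero_mem_dom hS.r₀_pos hu (ne_zero_of_norm_eq_one hx)
  have hg : ∀ e : E3, ContDiffOn ℝ ∞ (fun q : Conf => inner ℝ (dir q.2.2) e)
      (dom S.I S.r₀) := fun e =>
    (contDiffOn_dir.comp (contDiff_snd.comp contDiff_snd).contDiffOn
      fun _ hq => hq.2.2).inner ℝ contDiffOn_const
  have hd : ∀ e : E3, DifferentiableAt ℝ (fun q : Conf => inner ℝ (dir q.2.2) e) (u, 0, x) :=
    fun e => (hasFDerivAt_of_dom hS.isOpen_I (hg e) hq).differentiableAt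
  have h0 : ∀ {e : E3}, Tangent x e → inner ℝ (dir ((u, 0, x) : Conf).2.2) e = (0 : ℝ) :=
    fun he => by rw [dir_of_norm_eq_one hx]; exact he
  have h1 := fderiv_of_eq_add_pow hS.isOpen_I (W := fun q => E.H q e e')
    (B := fun q => inner ℝ e e' + -1 * (inner ℝ (dir q.2.2) e * inner ℝ (dir q.2.2) e'))
    (C := fun q => E.H₁ q e e')
    (contDiffOn_const.add (contDiffOn_const.mul ((hg e).mul (hg e'))))
    ((E.smooth_H₁.clm_apply contDiffOn_const).clm_apply contDiffOn_const) 1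
    (fun q hq => by
      simp only [E.H_eq q hq, add_apply, smul_apply, roundForm_apply, pow_one]
      ring) hq w
  have h2 : fderiv ℝ (fun q : Conf => inner ℝ e e' +
      -1 * (inner ℝ (dir q.2.2) e * inner ℝ (dir q.2.2) e')) (u, 0, x) = 0 := by
    rw [fderiv_const_add, fderiv_const_mul ((hd e).fun_mul (hd e')), fderiv_fun_mul (hd e) (hd e'),
      h0 he, h0 he', zero_smul, zero_smul, add_zero, smul_zero]
  have h3 : fderiv ℝ (fun q => E.H q e e') (u, 0, x) w = fderiv ℝ E.H (u, 0, x) w e e' :=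
    (congrArg (fun L => L w) (((hasFDerivAt_of_dom hS.isOpen_I E.smooth_H hq).clm_apply
      (hasFDerivAt_const e _)).clm_apply (hasFDerivAt_const e' _)).fderiv).trans (by simp)
  rw [← h3, h1, h2, hw]
  simp

/-- At ρ = 0 the terms with U and with the derivative of h disappear, and X is minus half the
divergence. The bracket reduces to the conformal Killing operator of the unit sphere applied to Y₀.
-/
lemma angForm_zero {e e' : E3} (he : Tangent x e) (he' : Tangent x e') :
    angForm E F (gaugeRad E F (gaugeAng E F Y₀)) (gaugeAng E F Y₀) (u, 0, x) e e' =
      -sphDiv (fun y => Y₀ (u, 0, y)) x * inner ℝ e e'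
      + inner ℝ (sphD (fun y => Y₀ (u, 0, y)) x e) e'
      + inner ℝ e (sphD (fun y => Y₀ (u, 0, y)) x e') := by
  have hq := zero_mem_dom hS.r₀_pos hu (ne_zero_of_norm_eq_one hx)
  have he0 : inner ℝ x e = (0 : ℝ) := he
  have he0' : inner ℝ x e' = (0 : ℝ) := he'
  rw [angForm, h.rad_zero hS hu hx, fderiv_H_zero hS hu hx _ (by simp [confField]) he he',
    confLie_ang, confLie_ang, U_zero hS hu hx, smul_zero, sub_zero, smul_zero, sub_zero,
    fderiv_gaugeAng E hS h.smooth_F h.smooth_Y hq, fderiv_gaugeAng E hS h.smooth_F h.smooth_Y hq,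
    sphD_slice hS.isOpen_I h.smooth_Y h.static_Y.isRadial hq,
    sphD_slice hS.isOpen_I h.smooth_Y h.static_Y.isRadial hq, H_zero hS E hu hx,
    H_zero hS E hu hx, H_zero hS E hu hx, he0, he0']
  simp only [zero_smul, sub_zero, zero_mul, mul_zero]
  ring

end Zero

lemma hasAsymptoticForm {α : E3 → ℝ} {f : E3 → E3}
    (hF : ∀ u ∈ S.I, ∀ x : E3, ‖x‖ = 1 → F (u, 0, x) = timeShift α f u x)
    (hY : ∀ u ∈ S.I, ∀ x : E3, ‖x‖ = 1 → Y₀ (u, 0, x) = f x) :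
    HasAsymptoticForm S ξ α f := by
  have hG : ∀ u ∈ S.I, ∀ x : E3, ‖x‖ = 1 →
      sphGrad (fun y => F (u, 0, y)) x = sphGrad (timeShift α f u) x := fun u hu x hx => by
    rw [sphGrad_eq, sphGrad_eq, sphD_congr (hF u hu) hx]
  have hu_eq : ∀ u ∈ S.I, ∀ r : ℝ, S.r₀ < r → ∀ x : E3, ‖x‖ = 1 →
      compU ξ u r x = timeShift α f u x := by
    intro u hu r hr x hx
    rw [compU, h.components.comp_u _ (pt_mem_region hS hu hr hx),
      conf_pt u (hS.r₀_pos.trans hr) hx, ← hF u hu x hx]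
    exact h.static_F.eq _ _ _ _
  refine ⟨fun u hu x hx => ?_, hu_eq, fun u hu x hx => ?_, fun u hu x hx => ?_⟩
  · refine Tendsto.prodMk_nhds ?_ ?_
    · refine tendsto_const_nhds.congr' ?_
      filter_upwards [eventually_gt_atTop S.r₀] with r hr using (hu_eq u hu r hr x hx).symm
    · have h1 := tendsto_along_ray hS.isOpen_I hS.r₀_pos (h.smooth_ang hS) hu hx
      rw [gaugeAng_zero, hY u hu x hx] at h1
      refine h1.congr' ?_
      filter_upwards [eventually_gt_atTop S.r₀] with r hr
      have := h.components.comp_ang _ (pt_mem_region hS hu hr hx)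
      rw [conf_pt u (hS.r₀_pos.trans hr) hx] at this
      exact this.symm
  · have := (h.hasAsymptoticForm_at hS hu hx).1
    rwa [hY u hu x hx, hG u hu x hx] at this
  · have := (h.hasAsymptoticForm_at hS hu hx).2
    rwa [sphDiv_congr (hY u hu) hx, sphDiv_congr (hG u hu) hx] at this

end IsGaugeField

/-! ### Smoothness across ρ = 0 of the expressions in the variation -/

section

variable {I : Set ℝ} (hI : IsOpen I) {r₀ : ℝ} {U : Conf → E3} {F X : Conf → ℝ} {Y : Conf → E3}
  (hF : ContDiffOn ℝ ∞ F (dom I r₀)) (hX : ContDiffOn ℝ ∞ X (dom I r₀))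
  (hY : ContDiffOn ℝ ∞ Y (dom I r₀))
include hF hX hY

lemma contDiffOn_confField : ContDiffOn ℝ ∞ (confField F X Y) (dom I r₀) := by
  unfold confField
  fun_prop

include hI in
lemma contDiffOn_fderiv_confField {G : Type} [NormedAddCommGroup G] [NormedSpace ℝ G]
    {W : Conf → G} (hW : ContDiffOn ℝ ∞ W (dom I r₀)) :
    ContDiffOn ℝ ∞ (fun q => fderiv ℝ W q (confField F X Y q)) (dom I r₀) :=
  contDiffOn_fderiv_vec hI hW (contDiffOn_confField hF hX hY)

include hI in
lemma contDiffOn_confLie (hU : ContDiffOn ℝ ∞ U (dom I r₀)) (w : Conf) :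
    ContDiffOn ℝ ∞ (fun q => confLie U F X Y q w) (dom I r₀) :=
  ((contDiffOn_fderiv_apply hI hY w).sub
    ((contDiffOn_fderiv_confField hI hF hX hY hU).const_smul w.1)).sub
    ((contDiffOn_fderiv_apply hI hF w).smul hU)

end

namespace MetricExpansion

variable {S : MetricData} (hS : S.IsBondiSachs) (E : MetricExpansion S)
include hS

lemma contDiffOn_angForm {F X : Conf → ℝ} {Y : Conf → E3}
    (hF : ContDiffOn ℝ ∞ F (dom S.I S.r₀)) (hX : ContDiffOn ℝ ∞ X (dom S.I S.r₀))
    (hY : ContDiffOn ℝ ∞ Y (dom S.I S.r₀)) (e e' : E3) :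
    ContDiffOn ℝ ∞ (fun q => angForm E F X Y q e e') (dom S.I S.r₀) := by
  have hH := E.smooth_H
  have h1 := ((contDiffOn_fderiv_confField hS.isOpen_I hF hX hY hH).clm_apply
    (contDiffOn_const (c := e))).clm_apply (contDiffOn_const (c := e'))
  have h2 := contDiffOn_confLie hS.isOpen_I hF hX hY E.smooth_U (0, 0, e)
  have h3 := contDiffOn_confLie hS.isOpen_I hF hX hY E.smooth_U (0, 0, e')
  refine ContDiffOn.add (ContDiffOn.add (ContDiffOn.add ?_ h1) ?_) ?_ <;> fun_prop

lemma fderiv_a {q : Conf} (hq : q ∈ dom S.I S.r₀) (v : Conf) :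
    fderiv ℝ E.a q v = q.2.1 * fderiv ℝ E.a₁ q v + v.2.1 * E.a₁ q := by
  have := fderiv_of_eq_add_pow hS.isOpen_I (B := fun _ => (1 : ℝ)) contDiffOn_const E.smooth_a₁ 1
    (fun q hq => by simpa using E.a_eq q hq) hq v
  simpa using this

lemma fderiv_b {q : Conf} (hq : q ∈ dom S.I S.r₀) (v : Conf) :
    fderiv ℝ E.b q v = q.2.1 ^ 2 * fderiv ℝ E.b₂ q v + 2 * q.2.1 * v.2.1 * E.b₂ q := by
  have := fderiv_of_eq_add_pow hS.isOpen_I (B := fun _ => (1 : ℝ)) contDiffOn_const E.smooth_b₂ 2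
    (fun q hq => by simpa using E.b_eq q hq) hq v
  simpa using this

lemma fderiv_U {q : Conf} (hq : q ∈ dom S.I S.r₀) (v : Conf) :
    fderiv ℝ E.U q v = q.2.1 ^ 2 • fderiv ℝ E.U₂ q v + (2 * q.2.1 * v.2.1) • E.U₂ q := by
  have := fderiv_of_eq_add_pow hS.isOpen_I (B := fun _ => (0 : E3)) contDiffOn_const E.smooth_U₂ 2
    (fun q hq => by simpa using E.U_eq q hq) hq v
  simpa using this

/-- The Lie derivative of `dx^A - U^A du` in the direction `∂_u`. -/
lemma confLie_u (F X : Conf → ℝ) (Y : Conf → E3) {q : Conf} (hq : q ∈ dom S.I S.r₀) :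
    confLie E.U F X Y q (1, 0, 0) = fderiv ℝ Y q (1, 0, 0) -
      q.2.1 ^ 2 • (fderiv ℝ E.U₂ q (confField F X Y q) - (2 * X q) • E.U₂ q
        + fderiv ℝ F q (1, 0, 0) • E.U₂ q) := by
  rw [confLie, E.fderiv_U hS hq, E.U_eq q hq]
  simp only [confField]
  module

end MetricExpansion

/-! ### Construction of asymptotic Killing vectors -/

lemma contDiffOn_conf {S : MetricData} (hS : S.IsBondiSachs) : ContDiffOn ℝ ∞ conf S.region := by
  have hn : ContDiffOn ℝ ∞ (fun p : Spacetime => ‖p.2‖) S.region := fun p hp =>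
    ((contDiffAt_norm ℝ (snd_ne_zero_of_mem_region hS hp)).comp p
      contDiffAt_snd).contDiffWithinAt
  refine contDiffOn_fst.prodMk ((hn.inv fun p hp =>
    norm_ne_zero_iff.2 (snd_ne_zero_of_mem_region hS hp)).prodMk ?_)
  exact contDiffOn_dir.comp contDiffOn_snd fun p hp => snd_ne_zero_of_mem_region hS hp

/-- The vector field with the given components. -/
def ofComponents (F X : Conf → ℝ) (Y : Conf → E3) (p : Spacetime) : Spacetime :=
  (F (conf p), (‖p.2‖ * X (conf p)) • dir p.2 + ‖p.2‖ • Y (conf p))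

lemma hasComponents_ofComponents {S : MetricData} (hS : S.IsBondiSachs) {F X : Conf → ℝ}
    {Y : Conf → E3} (hF : ContDiffOn ℝ ∞ F (dom S.I S.r₀)) (hX : ContDiffOn ℝ ∞ X (dom S.I S.r₀))
    (hY : ContDiffOn ℝ ∞ Y (dom S.I S.r₀))
    (hT : ∀ q ∈ dom S.I S.r₀, Tangent (dir q.2.2) (Y q)) :
    HasComponents S (ofComponents F X Y) F X Y := by
  have hc := contDiffOn_conf hS
  have hm : Set.MapsTo conf S.region (dom S.I S.r₀) := fun p hp => conf_mem_dom hS hp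
  have hn : ContDiffOn ℝ ∞ (fun p : Spacetime => ‖p.2‖) S.region := fun p hp =>
    ((contDiffAt_norm ℝ (snd_ne_zero_of_mem_region hS hp)).comp p
      contDiffAt_snd).contDiffWithinAt
  have hd : ContDiffOn ℝ ∞ (fun p : Spacetime => dir p.2) S.region :=
    contDiffOn_dir.comp contDiffOn_snd fun p hp => snd_ne_zero_of_mem_region hS hp
  have ht : ∀ p ∈ S.region, Tangent (dir p.2) (Y (conf p)) := fun p hp => by
    have := hT _ (conf_mem_dom hS hp)
    rwa [conf, dir_dir] at this
  refine ⟨?_, hF.mono (domPos_subset _ _), hX.mono (domPos_subset _ _),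
    hY.mono (domPos_subset _ _), fun p _ => rfl, fun p hp => ?_, fun p hp => ?_⟩
  · exact (hF.comp hc hm).prodMk (((hn.mul (hX.comp hc hm)).smul hd).add
      (hn.smul (hY.comp hc hm)))
  · have h1 := norm_dir (snd_ne_zero_of_mem_region hS hp)
    have h2 : inner ℝ (dir p.2) (Y (conf p)) = (0 : ℝ) := ht p hp
    change inner ℝ (dir p.2) ((‖p.2‖ * X (conf p)) • dir p.2 + ‖p.2‖ • Y (conf p)) = _
    simp only [inner_add_right, inner_smul_right, h2,
      real_inner_self_eq_norm_sq, h1]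
    ring
  · have h1 := norm_dir (snd_ne_zero_of_mem_region hS hp)
    have h0 : ‖p.2‖ ≠ 0 := norm_ne_zero_iff.2 (snd_ne_zero_of_mem_region hS hp)
    change ‖p.2‖⁻¹ • tanProj (dir p.2)
      ((‖p.2‖ * X (conf p)) • dir p.2 + ‖p.2‖ • Y (conf p)) = _
    simp only [map_add, map_smul, tanProj_self h1, tanProj_of_tangent (ht p hp),
      smul_zero, zero_add]
    rw [smul_smul, inv_mul_cancel₀ h0, one_smul]

/-- The direction is constant along the segment of integration, so the integrand stays orthogonal to
one fixed vector. -/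
lemma tangent_avg_raise {S : MetricData} (hS : S.IsBondiSachs) (E : MetricExpansion S)
    {F : Conf → ℝ} (hF : ContDiffOn ℝ ∞ F (dom S.I S.r₀)) {q : Conf} (hq : q ∈ dom S.I S.r₀) :
    Tangent (dir q.2.2) (avg (raise E F) q) := by
  obtain ⟨u, ρ, y⟩ := q
  have hc : ContinuousOn (fun s : ℝ => raise E F (u, s * ρ, y)) (Set.uIcc 0 1) := by
    rw [Set.uIcc_of_le zero_le_one]
    refine (contDiffOn_raise hS E hF).continuousOn.comp (by fun_prop) fun s hs =>
      segment_mem_dom hS.r₀_pos hq hs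
  have := (innerSL ℝ (dir y)).intervalIntegral_comp_comm
    (μ := MeasureTheory.volume) hc.intervalIntegrable
  rw [Tangent, avg]
  refine this.symm.trans ?_
  have h0 : ∀ s : ℝ, innerSL ℝ (dir y) (raise E F (u, s * ρ, y)) = 0 := fun s =>
    tangent_raise E F (u, s * ρ, y)
  simp only [h0, intervalIntegral.integral_zero]

lemma tangent_gaugeAng {S : MetricData} (hS : S.IsBondiSachs) (E : MetricExpansion S)
    {F : Conf → ℝ} (hF : ContDiffOn ℝ ∞ F (dom S.I S.r₀)) {Y₀ : Conf → E3}
    (hY : ∀ q ∈ dom S.I S.r₀, Tangent (dir q.2.2) (Y₀ q)) {q : Conf} (hq : q ∈ dom S.I S.r₀) :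
    Tangent (dir q.2.2) (gaugeAng E F Y₀ q) := by
  rw [gaugeAng, sub_eq_add_neg, ← neg_smul]
  exact tangent_add (hY q hq) (tangent_smul _ (tangent_avg_raise hS E hF hq))

/-! ### The components belonging to a pair α, f -/

section Generator

variable {α : E3 → ℝ} {f : E3 → E3} (hα : SmoothOnSphere α) (hf : IsConformalKilling f)

/-- The component `ξ^u` of the asymptotic Killing vector of `α` and `f`. -/
def genTime (α : E3 → ℝ) (f : E3 → E3) (q : Conf) : ℝ := radExt (timeShift α f q.1) q.2.2

/-- The component `ξ^A` at `ρ = 0` of the asymptotic Killing vector of `α` and `f`. -/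
def genAng (f : E3 → E3) (q : Conf) : E3 := radExt f q.2.2

/-- The divergence of `f`. -/
def genDiv (f : E3 → E3) (q : Conf) : ℝ := radExt (sphDiv f) q.2.2

lemma isStatic_genTime : IsStatic (genTime α f) := fun _ => radExt_dir _ _

lemma isStatic_genAng : IsStatic (genAng f) := fun _ => radExt_dir _ _

lemma genTime_eq (q : Conf) :
    genTime α f q = radExt α q.2.2 + q.1 / 2 * genDiv f q := rfl

include hf in
lemma contDiffOn_genDiv (I : Set ℝ) (r₀ : ℝ) : ContDiffOn ℝ ∞ (genDiv f) (dom I r₀) :=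
  hf.1.1.sphDiv.comp_conf

include hf in
lemma contDiffOn_genAng (I : Set ℝ) (r₀ : ℝ) : ContDiffOn ℝ ∞ (genAng f) (dom I r₀) :=
  hf.1.1.comp_conf

include hα hf in
lemma contDiffOn_genTime (I : Set ℝ) (r₀ : ℝ) : ContDiffOn ℝ ∞ (genTime α f) (dom I r₀) :=
  ContDiffOn.add hα.comp_conf
    ((contDiffOn_fst.div_const 2).mul (contDiffOn_genDiv hf I r₀))

lemma fderiv_comp_snd {G : Type} [NormedAddCommGroup G] [NormedSpace ℝ G] {φ : E3 → G}
    (hφ : SmoothOnSphere φ) {q : Conf} (hq : q.2.2 ≠ 0) (v : Conf) :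
    fderiv ℝ (fun q : Conf => radExt φ q.2.2) q v = fderiv ℝ (radExt φ) q.2.2 v.2.2 := by
  have h1 : HasFDerivAt (fun q : Conf => q.2.2)
      ((ContinuousLinearMap.snd ℝ ℝ E3).comp (ContinuousLinearMap.snd ℝ ℝ (ℝ × E3))) q :=
    hasFDerivAt_snd.comp _ hasFDerivAt_snd
  exact congrArg (fun L => L v) ((hφ.differentiableAt hq).hasFDerivAt.comp q h1).fderiv

include hα hf in
lemma fderiv_genTime_u {q : Conf} (hq : q.2.2 ≠ 0) :
    fderiv ℝ (genTime α f) q (1, 0, 0) = genDiv f q / 2 := by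
  have h1 : HasDerivAt (fun t : ℝ => genTime α f (q + t • (1, 0, 0))) (genDiv f q / 2) 0 := by
    have h2 : (fun t : ℝ => genTime α f (q + t • (1, 0, 0))) =
        fun t => radExt α q.2.2 + (q.1 + t) / 2 * genDiv f q := funext fun t => by
      simp [genTime_eq, genDiv]
    rw [h2]
    have h3 := ((((hasDerivAt_id (0 : ℝ)).const_add q.1).div_const 2).mul_const
      (genDiv f q)).const_add (radExt α q.2.2)
    refine h3.congr_deriv ?_
    ring
  have h4 : DifferentiableAt ℝ (genTime α f) q := by
    -- The domain is chosen to contain the given point: 1/r₀ = ρ + 1 + |ρ| exceeds ρ.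
    have := (contDiffOn_genTime hα hf Set.univ (1 / (q.2.1 + 1 + |q.2.1|))).contDiffAt
      ((isOpen_dom isOpen_univ _).mem_nhds (x := q) ⟨trivial, by
        simp only [one_div_one_div, Set.mem_Iio]
        linarith [abs_nonneg q.2.1], hq⟩)
    exact this.differentiableAt (by simp)
  rw [← h4.lineDeriv_eq_fderiv]
  exact h1.deriv

include hf in
-- By the classification, ψ = -2⟨b, x⟩ is a first spherical harmonic. Its gradient is the boost with
-- vector -2b, whose divergence 4⟨b, x⟩ is -2ψ. The cancellation in δg_uu depends on this
-- eigenvalue.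
lemma sphD_genDiv_sphGrad {x : E3} (hx : ‖x‖ = 1) : sphDiv (sphGrad (sphDiv f)) x =
    -2 * sphDiv f x := by
  obtain ⟨a, b, hab⟩ := hf.exists_killingField
  have h1 : ∀ y : E3, ‖y‖ = 1 → sphDiv f y = -2 * inner ℝ b y := fun y hy =>
    sphDiv_eq_of_killing a b hab hy
  have h2 : ∀ y : E3, ‖y‖ = 1 → sphGrad (sphDiv f) y = killingField 0 (-(2 : ℝ) • b) y := by
    intro y hy
    refine ext_inner_right ℝ fun v => ?_
    have hd : HasFDerivAt (fun y : E3 => -2 * inner ℝ b y) ((-2 : ℝ) • innerSL ℝ b) y :=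
      (innerSL ℝ b).hasFDerivAt.const_mul (-2)
    rw [inner_sphGrad, sphD_congr h1 hy, sphD_eq_of_hasFDerivAt hy hd]
    simp only [killingField, ContinuousLinearMap.comp_apply, smul_apply, innerSL_apply_apply,
      tanProj_apply, smul_eq_mul, inner_eq, PiLp.add_apply, PiLp.sub_apply, PiLp.smul_apply,
      cross_zero', cross_one', cross_two', PiLp.zero_apply]
    ring
  rw [sphDiv_congr h2 hx, sphDiv_killingField _ _ hx, h1 x hx, inner_smul_left]
  simp

include hα hf in
lemma sphGrad_timeShift (u : ℝ) {x : E3} (hx : ‖x‖ = 1) :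
    sphGrad (timeShift α f u) x = sphGrad α x + (u / 2) • sphGrad (sphDiv f) x := by
  have h1 := hf.1.1.sphDiv.const_smul (u / 2)
  rw [← sphGrad_const_smul hf.1.1.sphDiv (u / 2) hx]
  exact sphGrad_add hα h1 hx

include hα hf in
lemma sphDiv_sphGrad_timeShift (u : ℝ) {x : E3} (hx : ‖x‖ = 1) :
    sphDiv (sphGrad (timeShift α f u)) x =
      sphDiv (sphGrad α) x - u * sphDiv f x := by
  rw [sphDiv_congr (fun y hy => sphGrad_timeShift hα hf u hy) hx,
    sphDiv_add hα.sphGrad (hf.1.1.sphDiv.sphGrad.const_smul _) hx,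
    sphDiv_const_smul hf.1.1.sphDiv.sphGrad _ hx, sphD_genDiv_sphGrad hf hx]
  ring

lemma sphGrad_genTime (u : ℝ) : (sphGrad fun y => genTime α f (u, 0, y)) =
    sphGrad (timeShift α f u) := by
  funext x
  have e : radExt (fun y => genTime α f (u, 0, y)) = radExt (timeShift α f u) :=
    radExt_radExt (timeShift α f u)
  rw [sphGrad, sphGrad, e]

lemma sphDiv_genAng (u : ℝ) : (sphDiv fun y => genAng f (u, 0, y)) = sphDiv f := by
  funext x
  simp only [sphDiv]
  refine Finset.sum_congr rfl fun i _ => ?_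
  have : sphD (fun y => genAng f (u, 0, y)) x = sphD f x := sphD_radExt _ _
  rw [this]

end Generator

/-! ### The fall-off conditions for the field of α and f -/

section

variable {S : MetricData} (hS : S.IsBondiSachs) (E : MetricExpansion S)
  {ξ : Spacetime → Spacetime} {α : E3 → ℝ} {f : E3 → E3} (hα : SmoothOnSphere α)
  (hf : IsConformalKilling f) (h : IsGaugeField S E ξ (genTime α f) (genAng f))

include hS h

lemma genRad_eq {q : Conf} (hq : q ∈ dom S.I S.r₀) :
    
      gaugeRad E (genTime α f) (gaugeAng E (genTime α f) (genAng f)) q = -(1 / 2) * genDiv f q + q.2.1 * gaugeRadOne E (genTime α f) q := by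
  rw [h.rad_eq hS hq, sphDiv_genAng]
  rfl

include hf

lemma fderiv_genRad {q : Conf} (hq : q ∈ dom S.I S.r₀) (v : Conf) :
    fderiv ℝ 
      (gaugeRad E (genTime α f) (gaugeAng E (genTime α f) (genAng f))) q v = -(1 / 2) * fderiv ℝ (radExt (sphDiv f)) q.2.2 v.2.2
      + q.2.1 * fderiv ℝ (gaugeRadOne E (genTime α f)) q v + v.2.1 * gaugeRadOne E (genTime α f) q := by
  have h1 := fderiv_of_eq_add_pow hS.isOpen_I
    (W := gaugeRad E (genTime α f) (gaugeAng E (genTime α f) (genAng f)))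
    (B := fun q => -(1 / 2) * genDiv f q) (contDiffOn_const.mul (contDiffOn_genDiv hf _ _))
    (contDiffOn_gaugeRadOne E hS h.smooth_F) 1
    (fun q hq => by rw [genRad_eq hS E h hq, pow_one, smul_eq_mul]) hq v
  have h2 : fderiv ℝ (fun q => -(1 / 2) * genDiv f q) q v =
      -(1 / 2) * fderiv ℝ (radExt (sphDiv f)) q.2.2 v.2.2 := by
    rw [fderiv_const_mul (hasFDerivAt_of_dom hS.isOpen_I
      (contDiffOn_genDiv hf _ _) hq).differentiableAt, smul_apply, smul_eq_mul]
    congr 1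
    exact fderiv_comp_snd hf.1.1.sphDiv hq.2.2 v
  rw [h1, h2]
  simp

lemma fderiv_genAng_u {q : Conf} (hq : q ∈ dom S.I S.r₀) :
    fderiv ℝ (gaugeAng E (genTime α f) (genAng f)) q (1, 0, 0) =
      -(q.2.1 • fderiv ℝ (avg (raise E (genTime α f))) q (1, 0, 0)) := by
  have h2 : fderiv ℝ (genAng f) q (1, 0, 0) = 0 := by
    refine (fderiv_comp_snd hf.1.1 hq.2.2 _).trans ?_
    simp
  rw [fderiv_gaugeAng E hS h.smooth_F h.smooth_Y hq, h2]
  simp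

include hα

lemma fderiv_genAngOne_u {u : ℝ} (hu : u ∈ S.I) {x : E3} (hx : ‖x‖ = 1) :
    fderiv ℝ (avg (raise E (genTime α f))) (u, 0, x) (1, 0, 0) = (1 / 2 : ℝ) • sphGrad (sphDiv f) x := by
  have hq := zero_mem_dom hS.r₀_pos hu (ne_zero_of_norm_eq_one hx)
  have h1 : HasDerivAt (fun u : ℝ => ((u, 0, x) : Conf)) (1, 0, 0) u :=
    (hasDerivAt_id u).prodMk (hasDerivAt_const u ((0, x) : ℝ × E3))
  have h2 := (hasFDerivAt_of_dom hS.isOpen_I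
    (contDiffOn_avg_raise E hS h.smooth_F) hq).comp_hasDerivAt u h1
  have h3 : HasDerivAt (fun u : ℝ => sphGrad α x + (u / 2) • sphGrad (sphDiv f) x)
      ((1 / 2 : ℝ) • sphGrad (sphDiv f) x) u :=
    (((hasDerivAt_id u).div_const 2).smul_const _).const_add _
  refine h2.unique (h3.congr_of_eventuallyEq ?_)
  filter_upwards [hS.isOpen_I.mem_nhds hu] with u' hu'
  rw [Function.comp_apply, avg_zero,
    raise_zero hS E h.smooth_F h.static_F.isRadial hu' hx, sphGrad_genTime,
    sphGrad_timeShift hα hf u' hx]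

lemma fderiv_genRadOne_u {u : ℝ} (hu : u ∈ S.I) {x : E3} (hx : ‖x‖ = 1) :
    fderiv ℝ (gaugeRadOne E (genTime α f)) (u, 0, x) (1, 0, 0) = -(1 / 2) * sphDiv f x := by
  have hq := zero_mem_dom hS.r₀_pos hu (ne_zero_of_norm_eq_one hx)
  have h1 : HasDerivAt (fun u : ℝ => ((u, 0, x) : Conf)) (1, 0, 0) u :=
    (hasDerivAt_id u).prodMk (hasDerivAt_const u ((0, x) : ℝ × E3))
  have h2 := (hasFDerivAt_of_dom hS.isOpen_I
    (contDiffOn_gaugeRadOne E hS h.smooth_F) hq).comp_hasDerivAt u h1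
  have h3 : HasDerivAt (fun u : ℝ => (sphDiv (sphGrad α) x - u * sphDiv f x) / 2)
      ((-(1 * sphDiv f x)) / 2) u :=
    (((hasDerivAt_id u).mul_const _).const_sub _).div_const 2
  rw [h2.unique (h3.congr_of_eventuallyEq ?_)]
  · ring
  · filter_upwards [hS.isOpen_I.mem_nhds hu] with u' hu'
    rw [Function.comp_apply, gaugeRadOne_zero E hS h.smooth_F h.static_F hu' hx,
      sphGrad_genTime, sphDiv_sphGrad_timeShift hα hf u' hx]

variable {u : ℝ} (hu : u ∈ S.I) {x : E3} (hx : ‖x‖ = 1)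
include hu hx

omit hα in
-- The bracket vanishes at ρ = 0 by the conformal Killing equation, hence is O(1/r), and it is
-- multiplied by r².
lemma falloff_AB {e e' : E3} (he : Tangent x e) (he' : Tangent x e') :
    (fun r : ℝ => variation S.metric ξ (pt u r x) (partialAng r e) (partialAng r e'))
      =O[atTop] fun r : ℝ => r := by
  have h1 := isBigO_ray_sub hS.isOpen_I hS.r₀_pos (E.contDiffOn_angForm hS h.smooth_F
    (h.smooth_rad hS) (h.smooth_ang hS) e e') hu hx
  have h2 : angForm E (genTime α f) 
      (gaugeRad E (genTime α f) (gaugeAng E (genTime α f) (genAng f))) (gaugeAng E (genTime α f) (genAng f))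
      (u, 0, x) e e' = 0 := by
    have h3 := hf.2 x hx e e' he he'
    have h4 : sphD (fun y => genAng f (u, 0, y)) x = sphD f x := sphD_radExt _ _
    rw [h.angForm_zero hS hu hx he he', sphDiv_genAng, h4]
    linarith
  rw [h2] at h1
  have h3 : (fun r : ℝ => r ^ 2 * (angForm E (genTime α f) 
      (gaugeRad E (genTime α f) (gaugeAng E (genTime α f) (genAng f)))
      (gaugeAng E (genTime α f) (genAng f)) (ray u x r) e e' - 0)) =O[atTop]
      fun r : ℝ => r ^ 2 * r⁻¹ := (isBigO_refl _ _).mul h1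
  refine h3.congr' ?_ ?_
  · filter_upwards [eventually_gt_atTop S.r₀] with r hr
    rw [variation_AB hS E h.components hu hr hx he he', sub_zero, angForm]
  · filter_upwards [eventually_gt_atTop 0] with r hr
    field_simp

/-- With X = -(1/2)ψ + ρX₁ the order-zero terms ∂_u F and -(1/2)ψ cancel, and X - ρ ∂_ρ X has no
linear term in ρ. As b - 1 and U are O(ρ²), everything else carries a factor ρ². -/
lemma falloff_ur : (fun r : ℝ => variation S.metric ξ (pt u r x) partialU (partialR x))
    =O[atTop] fun r : ℝ => (r ^ 2)⁻¹ := by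
  have hI := hS.isOpen_I
  have sX := h.smooth_rad hS
  have sY := h.smooth_ang hS
  have sb := E.smooth_b
  have sb₂ := E.smooth_b₂
  have sH := E.smooth_H
  have sU₂ := E.smooth_U₂
  have sDb := contDiffOn_fderiv_confField hI h.smooth_F sX sY sb₂
  have sX₁ := contDiffOn_fderiv_apply hI (contDiffOn_gaugeRadOne E hS h.smooth_F) (0, 1, 0)
  have sY' := contDiffOn_fderiv_apply hI sY (0, 1, 0)
  -- The quotient of δg_ur by ρ²; being smooth up to ρ = 0, it is bounded along rays.
  have s1 : ContDiffOn ℝ ∞ (fun q => -(fderiv ℝ E.b₂ q (confField (genTime α f) 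
      (gaugeRad E (genTime α f) (gaugeAng E (genTime α f) (genAng f)))
      (gaugeAng E (genTime α f) (genAng f)) q) - 2 * 
      gaugeRad E (genTime α f) (gaugeAng E (genTime α f) (genAng f)) q * E.b₂ q
      - E.b q * fderiv ℝ (gaugeRadOne E (genTime α f)) q (0, 1, 0)
      - E.H q (E.U₂ q) (fderiv ℝ (gaugeAng E (genTime α f) (genAng f)) q (0, 1, 0))))
      (dom S.I S.r₀) := by fun_prop
  have h3 := (isBigO_refl (fun r : ℝ => (r ^ 2)⁻¹) atTop).mul
    (isBigO_ray_one hI hS.r₀_pos s1 hu hx)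
  refine h3.congr' ?_ ?_
  · filter_upwards [eventually_gt_atTop S.r₀] with r hr
    have hq := ray_mem_dom hS.r₀_pos hu hx hr
    have hr' : r ≠ 0 := (hS.r₀_pos.trans hr).ne'
    have hq2 : (ray u x r).2.1 = r⁻¹ := rfl
    have hc : (confField (genTime α f) (gaugeRad E (genTime α f) (gaugeAng E (genTime α f)
        (genAng f))) (gaugeAng E (genTime α f) (genAng f)) (ray u x r)).2.1 = -(r⁻¹ *
        gaugeRad E (genTime α f) (gaugeAng E (genTime α f) (genAng f)) (ray u x r)) := rfl
    rw [variation_ur hS E h.components hu hr hx (h.F_rho hS), E.fderiv_b hS hq,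
      fderiv_genTime_u hα hf hq.2.2, fderiv_genRad hS E hf h hq, hc, genRad_eq hS E h hq,
      E.U_eq _ hq, map_smul, smul_apply, smul_eq_mul]
    simp only [hq2, map_zero]
    field_simp
    ring
  · filter_upwards with r
    ring

/-- There is no r² term since f does not depend on u. In the r term ∂_A X contributes -(1/2)∂_A ψ,
and the u-derivative of the gradient of F contributes +(1/2)∂_A ψ. -/
lemma falloff_uA {e : E3} (he : Tangent x e) :
    (fun r : ℝ => variation S.metric ξ (pt u r x) partialU (partialAng r e))
      =O[atTop] fun _ : ℝ => (1 : ℝ) := by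
  have hI := hS.isOpen_I
  have hq0 := zero_mem_dom hS.r₀_pos hu (ne_zero_of_norm_eq_one hx)
  set F := genTime α f with hFdef
  set X := gaugeRad E F (gaugeAng E F (genAng f)) with hXdef
  set Y := gaugeAng E F (genAng f) with hYdef
  have sF := h.smooth_F
  have sX : ContDiffOn ℝ ∞ X (dom S.I S.r₀) := h.smooth_rad hS
  have sY : ContDiffOn ℝ ∞ Y (dom S.I S.r₀) := h.smooth_ang hS
  have sa := E.smooth_a
  have sb := E.smooth_b
  have sH := E.smooth_H
  have sU₂ := E.smooth_U₂
  have sDU := contDiffOn_fderiv_confField hI sF sX sY sU₂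
  have sDH := ((contDiffOn_fderiv_confField hI sF sX sY sH).clm_apply
    sU₂).clm_apply (contDiffOn_const (c := e))
  have sFe := contDiffOn_fderiv_apply hI sF (0, 0, e)
  have sFu := contDiffOn_fderiv_apply hI sF (1, 0, 0)
  have sXe := contDiffOn_fderiv_apply hI sX (0, 0, e)
  have sZ := contDiffOn_fderiv_apply hI (contDiffOn_avg_raise E hS sF) (1, 0, 0)
  have sL := contDiffOn_confLie hI sF sX sY E.smooth_U (0, 0, e)
  have s1 : ContDiffOn ℝ ∞ (fun q =>
      q.2.1 * (E.a q * fderiv ℝ F q (0, 0, e) + 2 * X q * E.H q (E.U₂ q) e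
        + fderiv ℝ E.H q (confField F X Y q) (E.U₂ q) e
        + E.H q (fderiv ℝ E.U₂ q (confField F X Y q) - (2 * X q) • E.U₂ q
          + fderiv ℝ F q (1, 0, 0) • E.U₂ q) e + E.H q (E.U₂ q) (confLie E.U F X Y q (0, 0, e)))
      + E.b q * fderiv ℝ X q (0, 0, e)
      + E.H q (fderiv ℝ (avg (raise E F)) q (1, 0, 0)) e) (dom S.I S.r₀) := by
    refine ContDiffOn.add (ContDiffOn.add (ContDiffOn.mul (by fun_prop)
      (ContDiffOn.add (ContDiffOn.add (ContDiffOn.add (by fun_prop) sDH) ?_) ?_)) ?_) ?_ <;>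
    fun_prop
  have h1 := isBigO_ray_sub hI hS.r₀_pos s1 hu hx
  have h0 : E.b (u, 0, x) * fderiv ℝ X (u, 0, x) (0, 0, e)
      + E.H (u, 0, x) (fderiv ℝ (avg (raise E F)) (u, 0, x) (1, 0, 0)) e = 0 := by
    have h5 : inner ℝ x e = (0 : ℝ) := he
    rw [b_zero hS E hu hx, H_zero hS E hu hx, fderiv_genRad hS E hf h hq0, h5,
      fderiv_genAngOne_u hS E hα hf h hu hx, inner_smul_left, inner_sphGrad, sphD]
    simp
  simp only [zero_mul, zero_add, h0, sub_zero] at h1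
  have h2 := (isBigO_refl (fun r : ℝ => r) atTop).neg_left.mul h1
  refine h2.congr' ?_ ?_
  · filter_upwards [eventually_gt_atTop S.r₀] with r hr
    have hq := ray_mem_dom hS.r₀_pos hu hx hr
    have hr' : r ≠ 0 := (hS.r₀_pos.trans hr).ne'
    have hq2 : (ray u x r).2.1 = r⁻¹ := rfl
    rw [variation_uA hS E h.components hu hr hx he, E.confLie_u hS _ _ _ hq,
      fderiv_genAng_u hS E hf h hq, E.U_eq _ hq]
    simp only [map_smul, smul_apply, smul_eq_mul, hq2, map_sub, map_neg, sub_apply, neg_apply]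
    field_simp
    ring
  · filter_upwards [eventually_gt_atTop 0] with r hr
    rw [mul_inv_cancel₀ (ne_of_gt hr)]

/-- The order-r part of r ∂_u X vanishes because ψ does not depend on u. At order one 2 ∂_u F = ψ
meets 2 ∂_u X₁ = (1/2) D_A D^A ψ = -ψ. The terms with U vanish at ρ = 0. -/
lemma falloff_uu : (fun r : ℝ => variation S.metric ξ (pt u r x) partialU partialU)
    =O[atTop] fun r : ℝ => r⁻¹ := by
  have hI := hS.isOpen_I
  have hq0 := zero_mem_dom hS.r₀_pos hu (ne_zero_of_norm_eq_one hx)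
  set F := genTime α f with hFdef
  set X := gaugeRad E F (gaugeAng E F (genAng f)) with hXdef
  set Y := gaugeAng E F (genAng f) with hYdef
  have sF := h.smooth_F
  have sX : ContDiffOn ℝ ∞ X (dom S.I S.r₀) := h.smooth_rad hS
  have sY : ContDiffOn ℝ ∞ Y (dom S.I S.r₀) := h.smooth_ang hS
  have sa := E.smooth_a
  have sa₁ := E.smooth_a₁
  have sb := E.smooth_b
  have sH := E.smooth_H
  have sU₂ := E.smooth_U₂
  have sDa := contDiffOn_fderiv_confField hI sF sX sY sa₁
  have sDH := ((contDiffOn_fderiv_confField hI sF sX sY sH).clm_apply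
    sU₂).clm_apply sU₂
  have sFu := contDiffOn_fderiv_apply hI sF (1, 0, 0)
  have sX₁ := contDiffOn_fderiv_apply hI (contDiffOn_gaugeRadOne E hS sF) (1, 0, 0)
  have sL := contDiffOn_confLie hI sF sX sY E.smooth_U (1, 0, 0)
  have s1 : ContDiffOn ℝ ∞ (fun q =>
      q.2.1 * (fderiv ℝ E.a₁ q (confField F X Y q) - X q * E.a₁ q)
      + 2 * E.a q * fderiv ℝ F q (1, 0, 0)
      + 2 * E.b q * fderiv ℝ (gaugeRadOne E F) q (1, 0, 0)
      - q.2.1 ^ 2 * (2 * X q * E.H q (E.U₂ q) (E.U₂ q)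
        + fderiv ℝ E.H q (confField F X Y q) (E.U₂ q) (E.U₂ q))
      + E.H q (confLie E.U F X Y q (1, 0, 0)) (E.U₂ q)
      + E.H q (E.U₂ q) (confLie E.U F X Y q (1, 0, 0))) (dom S.I S.r₀) := by
    refine ContDiffOn.add (ContDiffOn.add (ContDiffOn.sub ?_ (ContDiffOn.mul ?_
      (ContDiffOn.add ?_ sDH))) ?_) ?_ <;> fun_prop
  have h1 := isBigO_ray_sub hI hS.r₀_pos s1 hu hx
  have hL : confLie E.U F X Y (u, 0, x) (1, 0, 0) = 0 := by
    rw [E.confLie_u hS F X Y hq0, fderiv_genAng_u hS E hf h hq0]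
    simp
  have h0 : 2 * E.a (u, 0, x) * fderiv ℝ F (u, 0, x) (1, 0, 0)
      + 2 * E.b (u, 0, x) * fderiv ℝ (gaugeRadOne E F) (u, 0, x) (1, 0, 0) = 0 := by
    rw [b_zero hS E hu hx, E.a_eq _ hq0, fderiv_genTime_u hα hf hq0.2.2,
      fderiv_genRadOne_u hS E hα hf h hu hx, genDiv, radExt_of_norm_eq_one _ hx]
    ring
  simp only [hL, map_zero, zero_apply, zero_mul, zero_add, h0, sub_zero, add_zero, ne_eq,
    OfNat.ofNat_ne_zero, not_false_eq_true, zero_pow] at h1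
  refine h1.neg_left.congr' ?_ EventuallyEq.rfl
  filter_upwards [eventually_gt_atTop S.r₀] with r hr
  have hq := ray_mem_dom hS.r₀_pos hu hx hr
  have hr' : r ≠ 0 := (hS.r₀_pos.trans hr).ne'
  have hq2 : (ray u x r).2.1 = r⁻¹ := rfl
  have hXu : fderiv ℝ X (ray u x r) (1, 0, 0) =
      r⁻¹ * fderiv ℝ (gaugeRadOne E F) (ray u x r) (1, 0, 0) := by
    rw [fderiv_genRad hS E hf h hq]
    simp only [hq2, map_zero, mul_zero, zero_mul, zero_add, add_zero]
    rfl
  have hc : (confField F X Y (ray u x r)).2.1 = -(r⁻¹ * X (ray u x r)) := rfl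
  rw [variation_uu (F := F) (X := X) (Y := Y) hS E h.components hu hr hx, E.fderiv_a hS hq,
    E.U_eq _ hq, hXu, hc]
  simp only [map_smul, smul_apply, smul_eq_mul, hq2]
  field_simp
  ring

include E in
omit hx hu h in
/-- Every `α` and every conformal Killing vector field `f` arise from an asymptotic Killing
vector. -/
theorem exists_asymptoticKilling :
    ∃ ξ : Spacetime → Spacetime, IsAsymptoticKilling S ξ ∧ HasAsymptoticForm S ξ α f := by
  have sF := contDiffOn_genTime hα hf S.I S.r₀
  have sY := contDiffOn_genAng hf S.I S.r₀
  have sA := contDiffOn_gaugeAng E hS sF sY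
  have sX := contDiffOn_gaugeRad E hS sF sA
  have hT : ∀ q ∈ dom S.I S.r₀, Tangent (dir q.2.2) (genAng f q) := fun q hq =>
    hf.1.2 _ (norm_dir hq.2.2)
  have h : IsGaugeField S E (ofComponents (genTime α f)
      (gaugeRad E (genTime α f) (gaugeAng E (genTime α f) (genAng f)))
      (gaugeAng E (genTime α f) (genAng f))) (genTime α f) (genAng f) :=
    ⟨sF, isStatic_genTime, sY, isStatic_genAng, hasComponents_ofComponents hS sF sX sA
      fun q hq => tangent_gaugeAng hS E sF hT hq⟩
  refine ⟨_, ⟨h.components.smooth, fun u hu r hr x hx => h.gauge_rr hS hu hr hx,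
    fun u hu r hr x hx e he => h.gauge_rA hS hu hr hx he,
    fun u hu r hr x hx e _ he => h.gauge_trace hS hu hr hx e he,
    fun u hu x hx => falloff_uu hS E hα hf h hu hx,
    fun u hu x hx e he => falloff_uA hS E hα hf h hu hx he,
    fun u hu x hx => falloff_ur hS E hα hf h hu hx,
    fun u hu x hx e e' he he' => falloff_AB hS E hf h hu hx he he'⟩, ?_⟩
  exact h.hasAsymptoticForm hS (fun u _ x hx => radExt_of_norm_eq_one _ hx)
    (fun u _ x hx => radExt_of_norm_eq_one _ hx)

end

/-! ### Asymptotic Killing vectors solve the gauge conditions -/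

/-- The point with coordinates `(u, 1/ρ, y / ‖y‖)`. -/
def unconf (q : Conf) : Spacetime := (q.1, q.2.1⁻¹ • dir q.2.2)

lemma unconf_conf {p : Spacetime} (hp : p.2 ≠ 0) : unconf (conf p) = p := by
  have h : ‖p.2‖ ≠ 0 := norm_ne_zero_iff.2 hp
  simp only [unconf, conf, inv_inv, dir_dir]
  rw [dir, smul_smul, mul_inv_cancel₀ h, one_smul]

lemma mapsTo_unconf {S : MetricData} (hS : S.IsBondiSachs) :
    Set.MapsTo unconf (domPos S.I S.r₀) S.region := by
  rintro ⟨u, ρ, y⟩ hq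
  have hρ : 0 < ρ := hq.2
  have h1 := (mem_dom.1 hq.1)
  refine ⟨h1.1, ?_⟩
  rw [unconf, norm_smul_unit (inv_pos.2 hρ) (norm_dir h1.2.2)]
  rw [one_div] at h1
  exact (lt_inv_comm₀ hρ hS.r₀_pos).1 h1.2.1

lemma contDiffOn_unconf (I : Set ℝ) (r₀ : ℝ) : ContDiffOn ℝ ∞ unconf (domPos I r₀) := by
  refine contDiffOn_fst.prodMk (ContDiffOn.smul (ContDiffOn.inv
    (contDiff_fst.comp contDiff_snd).contDiffOn fun q hq => (ne_of_gt hq.2)) ?_)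
  exact contDiffOn_dir.comp (contDiff_snd.comp contDiff_snd).contDiffOn fun _ hq => hq.1.2.2

/-- Every smooth vector field has components, as functions of `(u, ρ, x)` for `ρ > 0`. -/
lemma exists_hasComponents {S : MetricData} (hS : S.IsBondiSachs) {ξ : Spacetime → Spacetime}
    (hξ : ContDiffOn ℝ ∞ ξ S.region) :
    ∃ (F X : Conf → ℝ) (Y : Conf → E3), HasComponents S ξ F X Y ∧ IsRadial F ∧ IsRadial Y ∧
      ∀ q : Conf, q.2.2 ≠ 0 → Tangent (dir q.2.2) (Y q) := by
  have h1 : ContDiffOn ℝ ∞ (fun q => ξ (unconf q)) (domPos S.I S.r₀) :=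
    hξ.comp (contDiffOn_unconf _ _) (mapsTo_unconf hS)
  have hd : ContDiffOn ℝ ∞ (fun q : Conf => dir q.2.2) (domPos S.I S.r₀) :=
    contDiffOn_dir.comp (contDiff_snd.comp contDiff_snd).contDiffOn fun _ hq => hq.1.2.2
  have hρ : ContDiffOn ℝ ∞ (fun q : Conf => q.2.1) (domPos S.I S.r₀) :=
    (contDiff_fst.comp contDiff_snd).contDiffOn
  have hi : ContDiffOn ℝ ∞ (fun q => inner ℝ (dir q.2.2) (ξ (unconf q)).2) (domPos S.I S.r₀) :=
    hd.inner ℝ h1.snd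
  have hu : ∀ q, unconf (unitize q) = unconf q := fun q => by simp [unconf, unitize, dir_dir]
  refine ⟨fun q => du (ξ (unconf q)), fun q => q.2.1 * inner ℝ (dir q.2.2) (ξ (unconf q)).2,
    fun q => q.2.1 • tanProj (dir q.2.2) (ξ (unconf q)).2,
    ⟨hξ, h1.fst, hρ.mul hi, ?_, fun p hp => ?_, fun p hp => ?_, fun p hp => ?_⟩,
    fun q => by simp only [hu], fun q => ?_, fun q hq => ?_⟩
  · simp only [tanProj_apply]
    exact hρ.smul (h1.snd.sub (hi.smul hd))
  · simp only [unconf_conf (snd_ne_zero_of_mem_region hS hp)]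
  · have h0 := snd_ne_zero_of_mem_region hS hp
    have hn : ‖p.2‖ ≠ 0 := norm_ne_zero_iff.2 h0
    simp only [unconf_conf h0]
    simp only [conf, dir_dir]
    rw [← mul_assoc, mul_inv_cancel₀ hn, one_mul]
    rfl
  · simp only [unconf_conf (snd_ne_zero_of_mem_region hS hp)]
    simp only [conf, dir_dir]
    rfl
  · simp only [hu]
    simp only [unitize, dir_dir]
  · exact tangent_smul _ (tangent_tanProj (norm_dir hq) _)

section

variable {S : MetricData} (hS : S.IsBondiSachs) (E : MetricExpansion S)
  {ξ : Spacetime → Spacetime}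
include hS

lemma HasComponents.congr_ray {F F' X X' : Conf → ℝ} {Y Y' : Conf → E3}
    (h : HasComponents S ξ F X Y) (hF : ContDiffOn ℝ ∞ F' (domPos S.I S.r₀))
    (hX : ContDiffOn ℝ ∞ X' (domPos S.I S.r₀)) (hY : ContDiffOn ℝ ∞ Y' (domPos S.I S.r₀))
    (he : ∀ u ∈ S.I, ∀ r : ℝ, S.r₀ < r → ∀ x : E3, ‖x‖ = 1 → F (ray u x r) = F' (ray u x r) ∧
      X (ray u x r) = X' (ray u x r) ∧ Y (ray u x r) = Y' (ray u x r)) :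
    HasComponents S ξ F' X' Y' := by
  have he' : ∀ p ∈ S.region, F (conf p) = F' (conf p) ∧ X (conf p) = X' (conf p) ∧
      Y (conf p) = Y' (conf p) := fun p hp =>
    he p.1 hp.1 _ hp.2 _ (norm_dir (snd_ne_zero_of_mem_region hS hp))
  refine ⟨h.smooth, hF, hX, hY, fun p hp => ?_, fun p hp => ?_, fun p hp => ?_⟩
  · rw [h.comp_u p hp, (he' p hp).1]
  · rw [h.comp_r p hp, (he' p hp).2.1]
  · rw [h.comp_ang p hp, (he' p hp).2.2]

lemma line_hasDerivAt_pos {G : Type} [NormedAddCommGroup G] [NormedSpace ℝ G] {W : Conf → G}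
    (hW : ContDiffOn ℝ ∞ W (domPos S.I S.r₀)) {u ρ : ℝ} {y : E3}
    (hq : (u, ρ, y) ∈ domPos S.I S.r₀) :
    HasDerivAt (fun ρ => W (u, ρ, y)) (fderiv ℝ W (u, ρ, y) (0, 1, 0)) ρ := by
  have h1 : HasDerivAt (fun ρ : ℝ => (u, ρ, y)) (0, 1, 0) ρ :=
    (hasDerivAt_const ρ u).prodMk ((hasDerivAt_id ρ).prodMk (hasDerivAt_const ρ y))
  exact ((hW.contDiffAt ((isOpen_domPos hS.isOpen_I S.r₀).mem_nhds hq)).differentiableAt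
    (by simp)).hasFDerivAt.comp_hasDerivAt ρ h1

/-- The components of a general field are known only for ρ > 0, so the radial equations are
integrated on 0 < ρ < 1/r₀ from a finite radius `R` instead of from ρ = 0. -/
lemma ray_eq_of_line {G : Type} [NormedAddCommGroup G] [NormedSpace ℝ G] {W W' D : Conf → G}
    {u : ℝ} {x : E3}
    (hW : ∀ r, S.r₀ < r → HasDerivAt (fun ρ => W (u, ρ, x)) (D (ray u x r)) r⁻¹)
    (hW' : ∀ r, S.r₀ < r → HasDerivAt (fun ρ => W' (u, ρ, x)) (D (ray u x r)) r⁻¹)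
    {R : ℝ} (hR : S.r₀ < R) (he : W (ray u x R) = W' (ray u x R)) {r : ℝ} (hr : S.r₀ < r) :
    W (ray u x r) = W' (ray u x r) := by
  have h0 := hS.r₀_pos
  have hmem : ∀ {r : ℝ}, S.r₀ < r → r⁻¹ ∈ Set.Ioo 0 S.r₀⁻¹ := fun hr =>
    ⟨inv_pos.2 (h0.trans hr), (inv_lt_inv₀ (h0.trans hr) h0).2 hr⟩
  have hJ : ∀ ρ ∈ Set.Ioo 0 S.r₀⁻¹, S.r₀ < ρ⁻¹ := fun ρ hρ =>
    (lt_inv_comm₀ hρ.1 h0).1 hρ.2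
  refine eq_of_line_hasDerivAt (J := Set.Ioo 0 S.r₀⁻¹) isOpen_Ioo Set.ordConnected_Ioo
    (f := fun ρ => W (u, ρ, x)) (g := fun ρ => W' (u, ρ, x)) (f' := fun ρ => D (u, ρ, x))
    (fun ρ hρ => ?_) (fun ρ hρ => ?_) (hmem hR) he (hmem hr)
  · have := hW _ (hJ ρ hρ)
    rwa [ray, inv_inv] at this
  · have := hW' _ (hJ ρ hρ)
    rwa [ray, inv_inv] at this

include E in
lemma eq_zero_of_H {u : ℝ} (hu : u ∈ S.I) {r : ℝ} (hr : S.r₀ < r) {x : E3} (hx : ‖x‖ = 1)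
    {v : E3} (hv : Tangent x v) (h : E.H (ray u x r) v v = 0) : v = 0 := by
  by_contra h0
  rw [E.H_ray u hu r hr x hx] at h
  exact (hS.h_pos u hu r hr x hx v hv h0).ne' h

/-- Nothing is assumed about the behaviour of the components as r → ∞. The gauge conditions are
radial equations with coefficients smooth across ρ = 0, so values at one finite radius determine the
components, and the solution formulas extend them to ρ = 0. -/
theorem exists_isGaugeField (hξ : IsAsymptoticKilling S ξ) :
    ∃ (F : Conf → ℝ) (Y₀ : Conf → E3), IsGaugeField S E ξ F Y₀ ∧
      ∀ q : Conf, q ∈ dom S.I S.r₀ → Tangent (dir q.2.2) (Y₀ q) := by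
  obtain ⟨F', X', Y', h, radF, radY, tanY⟩ := exists_hasComponents hS hξ.smooth
  have hI := hS.isOpen_I
  have h0 := hS.r₀_pos
  -- Any radius greater than r₀ would do.
  set R := 2 * S.r₀ with hRdef
  have hR : S.r₀ < R := by linarith
  set m : Conf → Conf := fun q => (q.1, R⁻¹, q.2.2) with hm
  have hmaps : Set.MapsTo m (dom S.I S.r₀) (domPos S.I S.r₀) := fun q hq =>
    ⟨⟨hq.1, by
      rw [one_div]
      exact (inv_lt_inv₀ (h0.trans hR) h0).2 hR, hq.2.2⟩, inv_pos.2 (h0.trans hR)⟩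
  have hmc : ContDiff ℝ ∞ m := by fun_prop
  set F : Conf → ℝ := fun q => F' (m q) with hF
  have sF : ContDiffOn ℝ ∞ F (dom S.I S.r₀) := h.smooth_F.comp hmc.contDiffOn hmaps
  have stF : IsStatic F := fun q => radF (m q)
  have sFp := sF.mono (domPos_subset S.I S.r₀)
  have hFray : ∀ u ∈ S.I, ∀ r : ℝ, S.r₀ < r → ∀ x : E3, ‖x‖ = 1 →
      F' (ray u x r) = F (ray u x r) := by
    intro u hu r hr x hx
    refine ray_eq_of_line hS (D := fun _ => 0) (fun r hr => ?_) (fun r hr => ?_) hR ?_ hr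
    · have hq := ray_mem_domPos h0 hu hx hr
      have h1 := line_hasDerivAt_pos hS h.smooth_F hq
      have h2 := hξ.gauge_rr u hu r hr x hx
      rw [variation_rr hS E h hu hr hx] at h2
      have h3 : 2 * (r ^ 2)⁻¹ * E.b (ray u x r) ≠ 0 := by
        have := (h0.trans hr).ne'
        have := E.b_ne (ray u x r)
        positivity
      exact h1.congr_deriv ((mul_eq_zero.1 h2).resolve_left h3)
    · exact hasDerivAt_const r⁻¹ (F' (u, R⁻¹, x))
    · rfl
  have hF_rho : ∀ q ∈ domPos S.I S.r₀, fderiv ℝ F q (0, 1, 0) = 0 := fun _ hq =>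
    stF.fderiv_rho hI sF hq.1
  have hc1 : HasComponents S ξ F X' Y' := h.congr_ray hS sFp h.smooth_X h.smooth_Y
    fun u hu r hr x hx => ⟨hFray u hu r hr x hx, rfl, rfl⟩
  have sZ := contDiffOn_avg_raise E hS sF
  -- The constant of integration for which `gaugeAng E F Y₀` agrees with `Y'` at ρ = 1/R.
  set Y₀ : Conf → E3 := fun q => Y' (m q) + R⁻¹ • avg (raise E F) (m q) with hY₀
  have sY₀ : ContDiffOn ℝ ∞ Y₀ (dom S.I S.r₀) :=
    (h.smooth_Y.comp hmc.contDiffOn hmaps).add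
      ((sZ.comp hmc.contDiffOn fun q hq => (hmaps hq).1).const_smul _)
  have stY : IsStatic Y₀ := fun q => by
    have e1 := radY (m q)
    have e2 := isRadial_avg (isRadial_raise E F) (m q)
    simp only [hY₀]
    exact congrArg₂ (fun a b => a + R⁻¹ • b) e1 e2
  have sA := contDiffOn_gaugeAng E hS sF sY₀
  have hYray : ∀ u ∈ S.I, ∀ r : ℝ, S.r₀ < r → ∀ x : E3, ‖x‖ = 1 →
      Y' (ray u x r) = gaugeAng E F Y₀ (ray u x r) := by
    intro u hu r hr x hx
    refine ray_eq_of_line hS (D := fun q => -raise E F q) (fun r hr => ?_) (fun r hr => ?_)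
      hR ?_ hr
    · have hq := ray_mem_domPos h0 hu hx hr
      have h1 := line_hasDerivAt_pos hS h.smooth_Y hq
      have htan : Tangent x (fderiv ℝ Y' (ray u x r) (0, 1, 0)) := by
        have h2 := (innerSL ℝ x).hasFDerivAt.comp_hasDerivAt _ h1
        refine h2.unique ((hasDerivAt_const _ (0 : ℝ)).congr_of_eventuallyEq ?_)
        filter_upwards with ρ
        have := tanY (u, ρ, x) (ne_zero_of_norm_eq_one hx)
        rw [dir_of_norm_eq_one hx] at this
        exact this
      have htW : Tangent x (raise E F (ray u x r)) := by
        have := tangent_raise E F (ray u x r)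
        rwa [show (ray u x r).2.2 = x from rfl, dir_of_norm_eq_one hx] at this
      -- The condition δg_rA = 0 makes this tangent vector h-orthogonal to all tangent vectors, in
      -- particular to itself, and h is positive definite.
      have h3 : fderiv ℝ Y' (ray u x r) (0, 1, 0) + raise E F (ray u x r) = 0 := by
        have ht := tangent_add htan htW
        refine eq_zero_of_H hS E hu hr hx ht ?_
        have h4 := hξ.gauge_rA u hu r hr x hx _ ht
        rw [variation_rA hS E hc1 hu hr hx hF_rho ht] at h4
        have h5 := H_raise hS E F hu hr hx ht
        rw [map_add (E.H (ray u x r)), add_apply, h5]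
        linarith
      exact h1.congr_deriv (eq_neg_of_add_eq_zero_left h3)
    · have hq := ray_mem_dom h0 hu hx hr
      exact (line_hasDerivAt hI sA hq).congr_deriv (fderiv_gaugeAng_rho E hS sF sY₀ stY hq)
    · simp only [gaugeAng, hY₀, hm, ray]
      abel
  have hc2 : HasComponents S ξ F X' (gaugeAng E F Y₀) := hc1.congr_ray hS sFp h.smooth_X
    (sA.mono (domPos_subset _ _)) fun u hu r hr x hx => ⟨rfl, rfl, hYray u hu r hr x hx⟩
  have hXray : ∀ u ∈ S.I, ∀ r : ℝ, S.r₀ < r → ∀ x : E3, ‖x‖ = 1 →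
      X' (ray u x r) = gaugeRad E F (gaugeAng E F Y₀) (ray u x r) := by
    intro u hu r hr x hx
    have hp := pt_mem_region hS hu hr hx
    have hr' := h0.trans hr
    obtain ⟨e₁, e₂, hf⟩ := exists_frame hx
    have ht : ∀ a, Tangent x (![e₁, e₂] a) := Fin.forall_fin_two.2 ⟨hf.tangent_fst, hf.tangent_snd⟩
    have h1 := hξ.gauge_trace u hu r hr x hx ![e₁, e₂] hf.orthonormal_pair.linearIndependent ht
    rw [trace_variation hS E hc2 hu hr hx _ ht] at h1
    have hd : (Matrix.of fun a b => S.metric (pt u r x) (partialAng r (![e₁, e₂] a))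
        (partialAng r (![e₁, e₂] b))).det ≠ 0 := by
      have hfr : IsFrame (dir (pt u r x).2) e₁ e₂ := by rwa [dir_pt_snd hS hr hx]
      have h2 := H_frame hS E hp hfr
      have h3 := H_symm hS E hp e₂ e₁
      rw [conf_pt u hr' hx] at h2 h3
      rw [Matrix.det_fin_two]
      simp only [Matrix.of_apply, metric_ang hS E hu hr hx (ht _) (ht _), Matrix.cons_val_zero,
        Matrix.cons_val_one]
      rw [h3]
      have : r ^ 4 ≠ 0 := by positivity
      intro h4
      apply this
      -- The determinant of the angular metric is r⁴ det h = r⁴, so the trace condition forces the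
      -- `adjTrace` to vanish.
      linear_combination h4 - r ^ 4 * h2
    have h2 := (mul_eq_zero.1 h1).resolve_left
      (mul_ne_zero (neg_ne_zero.2 (inv_ne_zero hd)) (by positivity))
    simp only [Matrix.cons_val_zero, Matrix.cons_val_one] at h2
    rw [adjTrace_angForm hS E hc2 hu hr hx hf] at h2
    rw [gaugeRad, ray, unitize_of_norm_eq_one hx, hf.angDiv_eq hI sA
      (isRadial_gaugeAng E stY) (ray_mem_dom h0 hu hx hr)]
    simp only [ray] at h2 ⊢
    linarith
  refine ⟨F, Y₀, ⟨sF, stF, sY₀, stY, hc2.congr_ray hS sFp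
    ((contDiffOn_gaugeRad E hS sF sA).mono (domPos_subset _ _)) (sA.mono (domPos_subset _ _))
    fun u hu r hr x hx => ⟨rfl, hXray u hu r hr x hx, rfl⟩⟩, fun q hq => ?_⟩
  exact tangent_add (tanY (m q) hq.2.2)
    (tangent_smul _ (tangent_avg_raise hS E sF (hmaps hq).1))

end

/-! ### Consequences of the fall-off conditions -/

lemma eq_zero_of_isBigO_sq {I : Set ℝ} (hI : IsOpen I) {r₀ : ℝ} (hr : 0 < r₀) {W : Conf → ℝ}
    (hW : ContDiffOn ℝ ∞ W (dom I r₀)) {u : ℝ} (hu : u ∈ I) {x : E3} (hx : ‖x‖ = 1)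
    (hO : (fun r : ℝ => r ^ 2 * W (ray u x r)) =O[atTop] fun r : ℝ => r) : W (u, 0, x) = 0 := by
  refine tendsto_nhds_unique (tendsto_along_ray hI hr hW hu hx) ?_
  have h1 : (fun r : ℝ => (r ^ 2)⁻¹ * (r ^ 2 * W (ray u x r))) =O[atTop]
      fun r : ℝ => (r ^ 2)⁻¹ * r := (isBigO_refl _ _).mul hO
  have h2 : (fun r : ℝ => W (ray u x r)) =O[atTop] fun r : ℝ => r⁻¹ := by
    refine h1.congr' ?_ ?_
    · filter_upwards [eventually_gt_atTop 0] with r hr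
      field_simp
    · filter_upwards [eventually_gt_atTop 0] with r hr
      field_simp
  exact h2.trans_tendsto tendsto_inv_atTop_zero

namespace IsGaugeField

variable {S : MetricData} (hS : S.IsBondiSachs) {E : MetricExpansion S}
  {ξ : Spacetime → Spacetime} {F : Conf → ℝ} {Y₀ : Conf → E3} (h : IsGaugeField S E ξ F Y₀)
  (hξ : IsAsymptoticKilling S ξ)
include hS h hξ

section

variable {u : ℝ} (hu : u ∈ S.I) {x : E3} (hx : ‖x‖ = 1)
include hu hx

/-- The value of the bracket at ρ = 0 is the r² coefficient of δg_AB, which the fall-off forbids. -/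
lemma conformal_of_falloff {e e' : E3} (he : Tangent x e) (he' : Tangent x e') :
    inner ℝ (sphD (fun y => Y₀ (u, 0, y)) x e) e'
      + inner ℝ e (sphD (fun y => Y₀ (u, 0, y)) x e') =
    sphDiv (fun y => Y₀ (u, 0, y)) x * inner ℝ e e' := by
  have h1 := eq_zero_of_isBigO_sq hS.isOpen_I hS.r₀_pos (E.contDiffOn_angForm hS h.smooth_F
    (h.smooth_rad hS) (h.smooth_ang hS) e e') hu hx (by
      refine (hξ.falloff_AB u hu x hx e e' he he').congr' ?_ EventuallyEq.rfl
      filter_upwards [eventually_gt_atTop S.r₀] with r hr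
      rw [variation_AB hS E h.components hu hr hx he he', angForm])
  rw [h.angForm_zero hS hu hx he he'] at h1
  linarith

/-- The limit of δg_ur along a ray is -(∂_u F + X) at ρ = 0, where X is minus half the divergence of
Y₀. -/
lemma fderiv_time_of_falloff :
    fderiv ℝ F (u, 0, x) (1, 0, 0) = 1 / 2 * sphDiv (fun y => Y₀ (u, 0, y)) x := by
  have hI := hS.isOpen_I
  have hq0 := zero_mem_dom hS.r₀_pos hu (ne_zero_of_norm_eq_one hx)
  set Y := gaugeAng E F Y₀ with hYdef
  set X := gaugeRad E F Y with hXdef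
  have sF := h.smooth_F
  have sX : ContDiffOn ℝ ∞ X (dom S.I S.r₀) := h.smooth_rad hS
  have sY : ContDiffOn ℝ ∞ Y (dom S.I S.r₀) := h.smooth_ang hS
  have sb := E.smooth_b
  have sH := E.smooth_H
  have sU := E.smooth_U
  have sDb := contDiffOn_fderiv_confField hI sF sX sY sb
  have sFu := contDiffOn_fderiv_apply hI sF (1, 0, 0)
  have sX' := contDiffOn_fderiv_apply hI sX (0, 1, 0)
  have sY' := contDiffOn_fderiv_apply hI sY (0, 1, 0)
  have s1 : ContDiffOn ℝ ∞ (fun q => -(fderiv ℝ E.b q (confField F X Y q)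
      + E.b q * (fderiv ℝ F q (1, 0, 0) + X q - q.2.1 * fderiv ℝ X q (0, 1, 0))
      - E.H q (E.U q) (fderiv ℝ Y q (0, 1, 0)))) (dom S.I S.r₀) := by fun_prop
  have h1 := tendsto_nhds_unique (tendsto_along_ray hI hS.r₀_pos s1 hu hx)
    (((hξ.falloff_ur u hu x hx).congr' (by
      filter_upwards [eventually_gt_atTop S.r₀] with r hr
      exact variation_ur (F := F) (X := X) (Y := Y) hS E h.components hu hr hx (h.F_rho hS))
      EventuallyEq.rfl).trans isBigO_inv_sq_inv |>.trans_tendsto tendsto_inv_atTop_zero)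
  have h2 : X (u, 0, x) = -(1 / 2) * sphDiv (fun y => Y₀ (u, 0, y)) x := h.rad_zero hS hu hx
  rw [E.fderiv_b hS hq0, b_zero hS E hu hx, U_zero hS hu hx, h2, map_zero, zero_apply] at h1
  simp only [ne_eq, OfNat.ofNat_ne_zero, not_false_eq_true, zero_pow, zero_mul, mul_zero] at h1
  linarith

lemma inner_fderiv_ang_of_falloff {e : E3} (he : Tangent x e) :
    inner ℝ (fderiv ℝ Y₀ (u, 0, x) (1, 0, 0)) e = 0 := by
  have hI := hS.isOpen_I
  have hq0 := zero_mem_dom hS.r₀_pos hu (ne_zero_of_norm_eq_one hx)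
  set Y := gaugeAng E F Y₀ with hYdef
  set X := gaugeRad E F Y with hXdef
  have sF := h.smooth_F
  have sX : ContDiffOn ℝ ∞ X (dom S.I S.r₀) := h.smooth_rad hS
  have sY : ContDiffOn ℝ ∞ Y (dom S.I S.r₀) := h.smooth_ang hS
  have sa := E.smooth_a
  have sb := E.smooth_b
  have sH := E.smooth_H
  have sU := E.smooth_U
  have sDH := ((contDiffOn_fderiv_confField hI sF sX sY sH).clm_apply
    sU).clm_apply (contDiffOn_const (c := e))
  have sFe := contDiffOn_fderiv_apply hI sF (0, 0, e)
  have sXe := contDiffOn_fderiv_apply hI sX (0, 0, e)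
  have sLu := contDiffOn_confLie hI sF sX sY sU (1, 0, 0)
  have sLe := contDiffOn_confLie hI sF sX sY sU (0, 0, e)
  have s1 : ContDiffOn ℝ ∞ (fun q => -(q.2.1 ^ 2 * (E.a q * fderiv ℝ F q (0, 0, e))
      + q.2.1 * (E.b q * fderiv ℝ X q (0, 0, e))
      + (2 * X q * E.H q (E.U q) e
        + fderiv ℝ E.H q (confField F X Y q) (E.U q) e
        - E.H q (confLie E.U F X Y q (1, 0, 0)) e
        + E.H q (E.U q) (confLie E.U F X Y q (0, 0, e))))) (dom S.I S.r₀) := by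
    refine ContDiffOn.neg (ContDiffOn.add ?_ (ContDiffOn.add (ContDiffOn.sub
      (ContDiffOn.add ?_ sDH) ?_) ?_)) <;> fun_prop
  have h1 := eq_zero_of_isBigO_sq hI hS.r₀_pos s1 hu hx (by
    -- O(1) is weakened to O(r): only the r² coefficient of δg_uA is needed.
    have hone : (fun _ : ℝ => (1 : ℝ)) =O[atTop] fun r : ℝ => r :=
      (isLittleO_const_id_atTop (1 : ℝ)).isBigO
    refine ((hξ.falloff_uA u hu x hx e he).trans hone).congr' ?_ EventuallyEq.rfl
    filter_upwards [eventually_gt_atTop S.r₀] with r hr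
    have hr' : r ≠ 0 := (hS.r₀_pos.trans hr).ne'
    have hq2 : (ray u x r).2.1 = r⁻¹ := rfl
    rw [variation_uA (F := F) (X := X) (Y := Y) hS E h.components hu hr hx he, hq2]
    field_simp)
  have he0 : inner ℝ x e = (0 : ℝ) := he
  have h2 : fderiv ℝ Y (u, 0, x) (1, 0, 0) = fderiv ℝ Y₀ (u, 0, x) (1, 0, 0) := by
    rw [fderiv_gaugeAng E hS h.smooth_F h.smooth_Y hq0]
    simp
  rw [E.confLie_u hS F X Y hq0, h2, U_zero hS hu hx] at h1
  simp only [ne_eq, OfNat.ofNat_ne_zero, not_false_eq_true, zero_pow, zero_mul, mul_zero, zero_smul,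
    sub_zero, map_zero, zero_apply, add_zero, zero_add, zero_sub, neg_neg] at h1
  rw [H_zero hS E hu hx, he0, mul_zero, sub_zero] at h1
  exact h1

end

omit h hξ in
lemma u_line_hasDerivAt {G : Type} [NormedAddCommGroup G] [NormedSpace ℝ G] {W : Conf → G}
    (hW : ContDiffOn ℝ ∞ W (dom S.I S.r₀)) {u : ℝ} (hu : u ∈ S.I) {x : E3} (hx : ‖x‖ = 1) :
    HasDerivAt (fun u => W (u, 0, x)) (fderiv ℝ W (u, 0, x) (1, 0, 0)) u := by
  have h1 : HasDerivAt (fun u : ℝ => ((u, 0, x) : Conf)) (1, 0, 0) u :=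
    (hasDerivAt_id u).prodMk (hasDerivAt_const u ((0, x) : ℝ × E3))
  exact (hasFDerivAt_of_dom hS.isOpen_I hW
    (zero_mem_dom hS.r₀_pos hu (ne_zero_of_norm_eq_one hx))).comp_hasDerivAt u h1

/-- The fall-off controls the pairing of ∂_u Y₀ with tangent vectors. As Y₀ stays tangent at fixed
x, so does ∂_u Y₀, which can thus be paired with itself; then Y₀ is constant in u because I is an
interval. -/
lemma ang_eq_of_falloff (hT : ∀ q ∈ dom S.I S.r₀, Tangent (dir q.2.2) (Y₀ q)) {u u₀ : ℝ}
    (hu : u ∈ S.I) (hu₀ : u₀ ∈ S.I) {x : E3} (hx : ‖x‖ = 1) :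
    Y₀ (u, 0, x) = Y₀ (u₀, 0, x) := by
  have h1 : ∀ u ∈ S.I, HasDerivAt (fun u => Y₀ (u, 0, x)) 0 u := by
    intro u hu
    have hd := u_line_hasDerivAt hS h.smooth_Y hu hx
    refine hd.congr_deriv ?_
    have htan : Tangent x (fderiv ℝ Y₀ (u, 0, x) (1, 0, 0)) := by
      have h2 := (innerSL ℝ x).hasFDerivAt.comp_hasDerivAt _ hd
      refine h2.unique ((hasDerivAt_const _ (0 : ℝ)).congr_of_eventuallyEq ?_)
      filter_upwards [hS.isOpen_I.mem_nhds hu] with u' hu'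
      have := hT _ (zero_mem_dom hS.r₀_pos hu' (ne_zero_of_norm_eq_one hx))
      rw [dir_of_norm_eq_one hx] at this
      exact this
    exact inner_self_eq_zero.1 (h.inner_fderiv_ang_of_falloff hS hξ hu hx htan)
  exact eq_of_line_hasDerivAt hS.isOpen_I hS.ordConnected_I h1
    (fun u _ => hasDerivAt_const u (Y₀ (u₀, 0, x))) hu₀ rfl hu

end IsGaugeField

theorem exists_asymptoticForm {S : MetricData} (hS : S.IsBondiSachs) (E : MetricExpansion S)
    {ξ : Spacetime → Spacetime} (hξ : IsAsymptoticKilling S ξ) :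
    ∃ (α : E3 → ℝ) (f : E3 → E3), SmoothOnSphere α ∧ IsConformalKilling f ∧
      HasAsymptoticForm S ξ α f := by
  obtain ⟨F, Y₀, h, hT⟩ := exists_isGaugeField hS E hξ
  obtain ⟨u₀, hu₀⟩ := hS.nonempty_I
  have h0 : (0 : ℝ) < 1 / S.r₀ := one_div_pos.2 hS.r₀_pos
  set f : E3 → E3 := fun y => Y₀ (u₀, 0, y) with hf
  have sf : SmoothOnSphere f := smoothOnSphere_slice h.smooth_Y h.static_Y.isRadial hu₀ h0
  have hK : IsConformalKilling f := by
    refine ⟨⟨sf, fun x hx => ?_⟩, fun x hx v w hv hw => ?_⟩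
    · have := hT _ (zero_mem_dom hS.r₀_pos hu₀ (ne_zero_of_norm_eq_one hx))
      rwa [dir_of_norm_eq_one hx] at this
    · exact h.conformal_of_falloff hS hξ hu₀ hx hv hw
  have hY : ∀ u ∈ S.I, ∀ x : E3, ‖x‖ = 1 → Y₀ (u, 0, x) = f x := fun u hu x hx =>
    h.ang_eq_of_falloff hS hξ hT hu hu₀ hx
  -- α is chosen so that α + (u/2) D_A f^A equals F at u = u₀; both have the same u-derivative on
  -- the interval I.
  refine ⟨fun y => F (u₀, 0, y) + (-(u₀ / 2)) • sphDiv f y, f,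
    (smoothOnSphere_slice h.smooth_F h.static_F.isRadial hu₀ h0).add (sf.sphDiv.const_smul _), hK,
    h.hasAsymptoticForm hS (fun u hu x hx => ?_) hY⟩
  have h1 : ∀ u ∈ S.I, HasDerivAt (fun u => F (u, 0, x)) (1 / 2 * sphDiv f x) u := by
    intro u hu
    have := IsGaugeField.u_line_hasDerivAt hS h.smooth_F hu hx
    rwa [h.fderiv_time_of_falloff hS hξ hu hx, sphDiv_congr (hY u hu) hx] at this
  have h2 : ∀ u ∈ S.I, HasDerivAt (fun u => timeShift
      (fun y => F (u₀, 0, y) + (-(u₀ / 2)) • sphDiv f y) f u x) (1 / 2 * sphDiv f x) u :=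
    fun u _ => (((hasDerivAt_id u).div_const 2).mul_const _).const_add _
  refine eq_of_line_hasDerivAt hS.isOpen_I hS.ordConnected_I h1 h2 hu₀ ?_ hu
  simp only [timeShift, smul_eq_mul]
  ring

end

end BondiSachs

open BondiSachs

theorem mainTheorem3 :
    (∀ S : MetricData, S.IsBondiSachs → S.IsAsymptoticallyFlat →
      (∀ ξ : Spacetime → Spacetime, IsAsymptoticKilling S ξ →
        ∃ (α : E3 → ℝ) (f : E3 → E3), SmoothOnSphere α ∧ IsConformalKilling f ∧
          HasAsymptoticForm S ξ α f) ∧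
      (∀ (α : E3 → ℝ) (f : E3 → E3), SmoothOnSphere α → IsConformalKilling f →
        ∃ ξ : Spacetime → Spacetime, IsAsymptoticKilling S ξ ∧ HasAsymptoticForm S ξ α f)) ∧
    (∀ (α : E3 → ℝ) (f : E3 → E3), SmoothOnSphere α → IsConformalKilling f →
      ∃ (φ : ℝ → E3 → E3) (K A : ℝ → E3 → ℝ), IsBMSGroup φ K A ∧ IsFlowOf α f φ K A ∧
        ∀ t : ℝ, ∀ x : E3, ‖x‖ = 1 →
          K t x ^ 2 = Real.exp (∫ s in (0 : ℝ)..t, sphDiv f (φ s x)) ∧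
          A t x = ∫ s in (0 : ℝ)..t, α (φ s x) / K s x) ∧
    (∀ (φ : ℝ → E3 → E3) (K A : ℝ → E3 → ℝ), IsBMSGroup φ K A →
      ∃ (α : E3 → ℝ) (f : E3 → E3), SmoothOnSphere α ∧ IsConformalKilling f ∧
        IsFlowOf α f φ K A) := by
  refine ⟨fun S hS hA => ?_, fun α f hα hf => exists_bmsGroup hα hf,
    fun φ K A hG => hG.exists_generator⟩
  obtain ⟨E⟩ := nonempty_metricExpansion hS hA
  exact ⟨fun ξ hξ => exists_asymptoticForm hS E hξ,
    fun α f hα hf => exists_asymptoticKilling hS E hα hf⟩
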